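/- Let $\mathbb{D}=\{z\in\mathbb{C}:|z|<1\}$. A one-parameter semigroup is a family $(\phi_t)_{t\ge 0}$ of holomorphic self-maps of $\mathbb{D}$ with $\phi_0=\mathrm{id}$, $\phi_{s+t}=\phi_s\circ\phi_t$ for all $s,t\ge0$, and $\phi_t(z)\to z$ as $t\to0^+$ for every $z\in\mathbb{D}$. Its infinitesimal generator is the holomorphic function $G:\mathbb{D}\to\mathbb{C}$ with $\frac{d}{dt}\phi_t(z)=G(\phi_t(z))$ for all $z\in\mathbb{D}$, $t\ge0$. Write $\angle\lim$ for angular (non-tangential) limits. A point $\sigma\in\partial\mathbb{D}$ is a boundary regular fixed point (BRFP) of a holomorphic map $f:\mathbb{D}\to\mathbb{D}$ if $\angle\lim_{z\to\sigma}f(z)=\sigma$ and the angular derivative $f'(\sigma)=\angle\lim_{z\to\sigma}\frac{f(z)-\sigma}{z-\sigma}$ exists finitely; it is a BRFP of $(\phi_t)$ if it is a BRFP of every $\phi_t$, and then the spectral value of $(\phi_t)$ at $\sigma$ is the number $\angle\lim_{z\to\sigma}\frac{G(z)}{\sigma-z}$. The Denjoy--Wolff point of a holomorphic map $f:\mathbb{D}\to\mathbb{D}$,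 $f\neq\mathrm{id}$, is its fixed point in $\mathbb{D}$ if there is one, and otherwise the unique BRFP $\tau\in\partial\mathbb{D}$ of $f$ with $f'(\tau)\le1$; the semigroup $(\phi_t)$ has Denjoy--Wolff point $\tau$ if every $\phi_t\ne\mathrm{id}$ does. Let $F=\{\sigma_1,\dots,\sigma_n\}\subset\partial\mathbb{D}$ be a set of $n$ pairwise distinct points and let $\tau\in\overline{\mathbb{D}}\setminus F$. Let $\mathrm{Gen}_\tau(F)$ be the set consisting of $G\equiv0$ and of all infinitesimal generators $G$ of one-parameter semigroups $(\phi_t)$ with Denjoy--Wolff point $\tau$ which have BRFPs at $\sigma_1,\dots,\sigma_n$ with spectral values $\lambda_1,\dots,\lambda_n<0$ satisfying $\sum_{k=1}^n|\lambda_k|\le1$. **Theorem.** A function $G:\mathbb{D}\to\mathbb{C}$, $G\not\equiv0$, is an extreme point of $\mathrm{Gen}_\tau(F)$ if and only if there exist $b\in\mathbb{R}$ and $L=(\lambda_1,\dots,\lambda_n)\in(-\infty,0)^n$ with $\sum_{k=1}^n|\lambda_k|=1$ such that $$G(z)=\frac{(\tau-z)(1-\overline{\tau}z)}{ib+p_0(z;F,L)}\quad\text{for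 all }z\in\mathbb{D},\qquad\text{where}\qquad p_0(z;F,L):=\sum_{k=1}^n\frac{|\tau-\sigma_k|^2}{2|\lambda_k|}\,\frac{\sigma_k+z}{\sigma_k-z}.$$ -/

import Mathlib

open scoped Complex.UnitDisc ComplexConjugate Topology NNReal

namespace DiscSemigroup

noncomputable section

/-- A complex valued function on the open unit disc is holomorphic. Functions in `Hol(𝔻)` are
represented as functions on the type `𝔻`, so that equality of functions is equality on the disc;
the extension by zero is used only in order to apply Mathlib's notion of differentiability. -/
def IsHol (f : 𝔻 → ℂ) : Prop :=
  DifferentiableOn ℂ (fun z : ℂ => if h : ‖z‖ < 1 then f (Complex.UnitDisc.mk z h) else 0)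
    (Metric.ball 0 1)

/-- The Stolz angle of opening `M` with vertex at the boundary point `σ`. -/
def stolzAngle (σ : ℂ) (M : ℝ) : Set 𝔻 :=
  {z | ‖σ - (z : ℂ)‖ < M * (1 - ‖(z : ℂ)‖)}

/-- The angular (non-tangential) limit of `f` at the boundary point `σ` exists and equals `l`:
`f z → l` as `z → σ` within every Stolz angle with vertex `σ`. -/
def HasAngularLimit (f : 𝔻 → ℂ) (σ l : ℂ) : Prop :=
  ∀ M : ℝ, 1 < M →
    Filter.Tendsto f
      (Filter.comap (fun z : 𝔻 => (z : ℂ)) (𝓝 σ) ⊓ Filter.principal (stolzAngle σ M)) (𝓝 l)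

/-- `σ` is a boundary fixed point of the self-map `f`. -/
def IsBoundaryFixedPoint (f : 𝔻 → 𝔻) (σ : ℂ) : Prop :=
  ‖σ‖ = 1 ∧ HasAngularLimit (fun z => (f z : ℂ)) σ σ

/-- The angular derivative of the self-map `f` at its boundary fixed point `σ` exists finitely and
equals `d`. -/
def HasAngularDerivAt (f : 𝔻 → 𝔻) (σ d : ℂ) : Prop :=
  HasAngularLimit (fun z => ((f z : ℂ) - σ) / ((z : ℂ) - σ)) σ d

/-- `σ` is a boundary regular fixed point (BRFP) of the self-map `f`. -/
def IsBRFP (f : 𝔻 → 𝔻) (σ : ℂ) : Prop :=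
  IsBoundaryFixedPoint f σ ∧ ∃ d : ℂ, HasAngularDerivAt f σ d

/-- `τ` is the Denjoy-Wolff point of the holomorphic self-map `f ≠ id`: either `τ` is a fixed point
in the open disc, or `f` has no fixed points in the open disc and `τ` is a BRFP on the unit circle
with angular derivative at most `1`. -/
def IsDWPoint (f : 𝔻 → 𝔻) (τ : ℂ) : Prop :=
  (∃ w : 𝔻, (w : ℂ) = τ ∧ f w = w) ∨
  ((∀ w : 𝔻, f w ≠ w) ∧ IsBoundaryFixedPoint f τ ∧
    ∃ d : ℝ, d ≤ 1 ∧ HasAngularDerivAt f τ (d : ℂ))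

/-- `(φ_t)_{t ≥ 0}` is a one-parameter semigroup of holomorphic self-maps of the unit disc. -/
structure IsSemigroup (φ : ℝ≥0 → 𝔻 → 𝔻) : Prop where
  hol : ∀ t, IsHol (fun z => (φ t z : ℂ))
  zero : ∀ z, φ 0 z = z
  add : ∀ s t z, φ (s + t) z = φ s (φ t z)
  tendsto : ∀ z, Filter.Tendsto (fun t => φ t z) (𝓝[>] 0) (𝓝 z)

/-- `G` is the infinitesimal generator of `(φ_t)`: it is holomorphic and
`d φ_t(z) / dt = G (φ_t(z))` for all `z ∈ 𝔻` and all `t ≥ 0` (one-sided derivative at `t = 0`). -/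
def IsGenerator (φ : ℝ≥0 → 𝔻 → 𝔻) (G : 𝔻 → ℂ) : Prop :=
  IsHol G ∧ ∀ (z : 𝔻) (t : ℝ≥0),
    HasDerivWithinAt (fun s : ℝ => (φ s.toNNReal z : ℂ)) (G (φ t z)) (Set.Ici 0) (t : ℝ)

/-- All the maps `φ_t ≠ id` of the semigroup have Denjoy-Wolff point `τ`; for the trivial semigroup
this holds for every `τ`. -/
def HasDWPoint (φ : ℝ≥0 → 𝔻 → 𝔻) (τ : ℂ) : Prop :=
  ∀ t, φ t ≠ id → IsDWPoint (φ t) τ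

/-- `σ` is a boundary regular fixed point of the semigroup `(φ_t)`. -/
def IsSemigroupBRFP (φ : ℝ≥0 → 𝔻 → 𝔻) (σ : ℂ) : Prop :=
  ∀ t, IsBRFP (φ t) σ

/-- `l` is the spectral value at the BRFP `σ` of the semigroup generated by `G`, i.e. the angular
limit of `G z / (σ - z)` at `σ`. -/
def HasSpectralValue (G : 𝔻 → ℂ) (σ : ℂ) (l : ℝ) : Prop :=
  HasAngularLimit (fun z => G z / (σ - (z : ℂ))) σ (l : ℂ)

/-- The class `Gen_τ(F)`, `F = {σ_1, …, σ_n}`: the zero function and all infinitesimal generators of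
one-parameter semigroups with Denjoy-Wolff point `τ` that have BRFPs at `σ_1, …, σ_n` with repelling
spectral values `l_1, …, l_n < 0` subject to `∑ |l_k| ≤ 1`. -/
def GenClass {n : ℕ} (τ : ℂ) (σ : Fin n → ℂ) : Set (𝔻 → ℂ) :=
  {G | G = 0 ∨ ∃ φ : ℝ≥0 → 𝔻 → 𝔻,
    IsSemigroup φ ∧ IsGenerator φ G ∧ HasDWPoint φ τ ∧ (∀ k, IsSemigroupBRFP φ (σ k)) ∧
    ∃ l : Fin n → ℝ, (∀ k, l k < 0 ∧ HasSpectralValue G (σ k) (l k)) ∧ ∑ k, |l k| ≤ 1}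

/-- `p₀(z; F, L) = ∑ α_k (σ_k + z) / (σ_k - z)` with `α_k = |τ - σ_k|² / (2 |l_k|)`. -/
def p0 {n : ℕ} (τ : ℂ) (σ : Fin n → ℂ) (L : Fin n → ℝ) (z : ℂ) : ℂ :=
  ∑ k, ((‖τ - σ k‖ ^ 2 / (2 * |L k|) : ℝ) : ℂ) * ((σ k + z) / (σ k - z))

end

end DiscSemigroup

namespace DiscSemigroup

open Metric Set Filter

/-! By Berkson--Porta, a generator with Denjoy--Wolff point τ is (τ-z)(1-conj τ z)p(z) with Re p ≥ 0
(`exists_berkson_porta`). Julia--Wolff theory (`julia_wolff`) attaches to a function with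
nonnegative real part a point mass at every boundary point, read off from an angular limit. A
spectral value λ at σ amounts to a mass |τ-σ|²/(2|λ|) of 1/p at σ (`mass_of_spectral`), and
conversely such masses produce boundary regular fixed points (`mem_genClass`). The question thus
becomes one about convex combinations of functions p.

Sufficiency: if 1/p is ib plus a positive combination of the n Cayley kernels, then p is rational
with n simple poles on the circle, so its measure consists of n atoms. In a decomposition p = s p₁ +
t p₂ both measures live on these atoms, so p₁ has the same denominator as p; since p₁ vanishes at
the n points σ_k, its numerator is a multiple of that of p (`eq_mul_of_add_eq`). The sums of
spectral values are at least -1 for both parts and average to -1, which forces the multiple to be 1.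

Necessity: rescaling time gives ∑|λ_k| = 1. Multiply the measure of p by 1 ± ε times a real
trigonometric polynomial of degree at most n and add an imaginary constant. Staying in the class
costs 2n real conditions at the points σ_k and one for the sum of spectral values; with one
normalisation this makes 2n+2 equations in 2n+3 real unknowns (`exists_admissible`). Extremality
makes a nontrivial solution act trivially, so p times a real trigonometric polynomial equals an
imaginary one with double zeros at all σ_k. Hence 1/p is rational with poles only at the σ_k, and
removing its masses leaves an imaginary constant (`inv_eq_of_pert_eq_zero`). -/

/-! ### Schwarz--Pick estimates and the two-point Pick inequality. -/

theorem one_sub_mul_conj_ne_zero {z w : ℂ} (hz : ‖z‖ < 1) (hw : ‖w‖ ≤ 1) : 1 - conj w * z ≠ 0 := by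
  intro h
  have h1 : conj w * z = 1 := (sub_eq_zero.1 h).symm
  have h2 : ‖conj w * z‖ < 1 := by
    rw [norm_mul, RCLike.norm_conj]
    nlinarith [norm_nonneg w, norm_nonneg z]
  rw [h1] at h2
  simp at h2

/-- The pseudohyperbolic identity: it bounds Möbius maps by 1 and lets |z - w| be traded for |1 -
conj w z| after squaring Schwarz--Pick inequalities. -/
theorem sq_norm_one_sub_conj_mul (z w : ℂ) :
    ‖1 - conj w * z‖ ^ 2 = ‖z - w‖ ^ 2 + (1 - ‖z‖ ^ 2) * (1 - ‖w‖ ^ 2) := by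
  simp only [Complex.sq_norm, Complex.normSq_apply, Complex.sub_re, Complex.sub_im, Complex.mul_re,
    Complex.mul_im, Complex.conj_re, Complex.conj_im, Complex.one_re, Complex.one_im]
  ring

theorem sq_norm_add_conj (a b : ℂ) : ‖a + conj b‖ ^ 2 = ‖a - b‖ ^ 2 + 4 * a.re * b.re := by
  simp only [Complex.sq_norm, Complex.normSq_apply, Complex.sub_re, Complex.sub_im, Complex.add_re,
    Complex.add_im, Complex.conj_re, Complex.conj_im]
  ring

/-- The Schwarz lemma for a function vanishing at an arbitrary point of the disc. -/
theorem norm_mul_le_of_eq_zero {g : ℂ → ℂ} (hg : DifferentiableOn ℂ g (ball 0 1))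
    (hb : ∀ z, ‖z‖ < 1 → ‖g z‖ ≤ 1) {w : ℂ} (hw : ‖w‖ < 1) (h0 : g w = 0) {z : ℂ} (hz : ‖z‖ < 1) :
    ‖g z‖ * ‖1 - conj w * z‖ ≤ ‖z - w‖ := by
  -- The disc automorphism taking 0 to w, so that g ∘ M vanishes at 0 and the classical Schwarz
  -- lemma applies.
  set M : ℂ → ℂ := fun ζ => (ζ + w) / (1 + conj w * ζ) with hM
  have hden : ∀ ζ : ℂ, ‖ζ‖ < 1 → 1 + conj w * ζ ≠ 0 := by
    intro ζ hζ
    have := one_sub_mul_conj_ne_zero (z := -ζ) (w := w) (by simpa using hζ) hw.le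
    simpa using this
  have hmaps : ∀ ζ : ℂ, ‖ζ‖ < 1 → ‖M ζ‖ < 1 := by
    intro ζ hζ
    have hd := hden ζ hζ
    rw [hM]
    simp only [norm_div]
    rw [div_lt_one (norm_pos_iff.2 hd)]
    have h1 := sq_norm_one_sub_conj_mul (-ζ) w
    have h2 : ‖(1 : ℂ) - conj w * -ζ‖ = ‖1 + conj w * ζ‖ := by congr 1; ring
    have h3 : ‖-ζ - w‖ = ‖ζ + w‖ := by rw [← norm_neg]; congr 1; ring
    rw [h2, h3, norm_neg] at h1
    have h4 : 0 < (1 - ‖ζ‖ ^ 2) * (1 - ‖w‖ ^ 2) := by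
      apply mul_pos <;> nlinarith [norm_nonneg ζ, norm_nonneg w]
    exact lt_of_pow_lt_pow_left₀ 2 (norm_nonneg _) (by linarith)
  have hdiff : DifferentiableOn ℂ (g ∘ M) (ball 0 1) := by
    refine hg.comp ?_ fun ζ hζ => ?_
    · refine DifferentiableOn.div (by fun_prop) (by fun_prop) fun ζ hζ => hden ζ (by simpa using hζ)
    · simpa using hmaps ζ (by simpa using hζ)
  have hD := one_sub_mul_conj_ne_zero hz hw.le
  set ζ : ℂ := (z - w) / (1 - conj w * z) with hζ
  have hζ1 : ‖ζ‖ < 1 := by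
    rw [hζ, norm_div, div_lt_one (norm_pos_iff.2 hD)]
    have h1 := sq_norm_one_sub_conj_mul z w
    have h4 : 0 < (1 - ‖z‖ ^ 2) * (1 - ‖w‖ ^ 2) := by
      apply mul_pos <;> nlinarith [norm_nonneg z, norm_nonneg w]
    exact lt_of_pow_lt_pow_left₀ 2 (norm_nonneg _) (by linarith)
  have hMζ : M ζ = z := by
    have h1 := hden ζ hζ1
    rw [hM]
    simp only
    have hz' : ζ * (1 - conj w * z) = z - w := by rw [hζ, div_mul_cancel₀ _ hD]
    rw [div_eq_iff h1]
    linear_combination hz'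
  have := Complex.norm_le_norm_of_mapsTo_ball (f := g ∘ M) hdiff
    (fun ζ hζ => by
      simpa using hb _ (hmaps ζ (by simpa using hζ))) (by simp [hM, h0]) hζ1
  simp only [Function.comp_apply, hMζ] at this
  rw [hζ, norm_div, le_div_iff₀ (norm_pos_iff.2 hD)] at this
  exact this

/-- The Schwarz-Pick inequality at a fixed point of a self-map of the disc. -/
theorem norm_mul_le_of_fixed {f : ℂ → ℂ} (hf : DifferentiableOn ℂ f (ball 0 1))
    (hb : ∀ z, ‖z‖ < 1 → ‖f z‖ < 1) {w : ℂ} (hw : ‖w‖ < 1) (h0 : f w = w) {z : ℂ} (hz : ‖z‖ < 1) :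
    ‖f z - w‖ * ‖1 - conj w * z‖ ≤ ‖z - w‖ * ‖1 - conj w * f z‖ := by
  have hD := one_sub_mul_conj_ne_zero (hb z hz) hw.le
  have := norm_mul_le_of_eq_zero (g := fun z => (f z - w) / (1 - conj w * f z))
    (DifferentiableOn.div (by fun_prop) (by fun_prop) fun ζ hζ =>
      one_sub_mul_conj_ne_zero (hb ζ (by simpa using hζ)) hw.le)
    (fun ζ hζ => by
      have hD' := one_sub_mul_conj_ne_zero (hb ζ hζ) hw.le
      rw [norm_div, div_le_one (norm_pos_iff.2 hD')]
      have h1 := sq_norm_one_sub_conj_mul (f ζ) w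
      have h4 : 0 ≤ (1 - ‖f ζ‖ ^ 2) * (1 - ‖w‖ ^ 2) := by
        have := hb ζ hζ
        apply mul_nonneg <;> nlinarith [norm_nonneg (f ζ), norm_nonneg w]
      exact le_of_pow_le_pow_left₀ two_ne_zero (norm_nonneg _) (by linarith)) hw (by simp [h0]) hz
  rw [norm_div, div_mul_eq_mul_div, div_le_iff₀ (norm_pos_iff.2 hD)] at this
  exact this

/-- The Cayley-type quotient (p - p w)/(p + conj (p w)) maps into the closed unit disc and vanishes
at w. Squaring its Schwarz bound and inserting the two norm identities gives the Pick form. -/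
theorem pick_ineq_of_pos {p : ℂ → ℂ} (hp : DifferentiableOn ℂ p (ball 0 1))
    (hre : ∀ z, ‖z‖ < 1 → 0 < (p z).re) {z w : ℂ} (hz : ‖z‖ < 1) (hw : ‖w‖ < 1) :
    ‖p z + conj (p w)‖ ^ 2 * ((1 - ‖z‖ ^ 2) * (1 - ‖w‖ ^ 2)) ≤
      4 * (p z).re * (p w).re * ‖1 - conj w * z‖ ^ 2 := by
  have hne : ∀ z, ‖z‖ < 1 → p z + conj (p w) ≠ 0 := by
    intro z hz h
    have := congrArg Complex.re h
    simp only [Complex.add_re, Complex.conj_re, Complex.zero_re] at this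
    linarith [hre z hz, hre w hw]
  have := norm_mul_le_of_eq_zero (g := fun z => (p z - p w) / (p z + conj (p w)))
    (DifferentiableOn.div (by fun_prop) (by fun_prop) fun ζ hζ => hne ζ (by simpa using hζ))
    (fun ζ hζ => by
      rw [norm_div, div_le_one (norm_pos_iff.2 (hne ζ hζ))]
      have h1 := sq_norm_add_conj (p ζ) (p w)
      have h4 := mul_pos (hre ζ hζ) (hre w hw)
      exact le_of_pow_le_pow_left₀ two_ne_zero (norm_nonneg _) (by linarith)) hw (by simp) hz
  rw [norm_div, div_mul_eq_mul_div, div_le_iff₀ (norm_pos_iff.2 (hne z hz))] at this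
  have h2 := pow_le_pow_left₀ (by positivity) this 2
  rw [mul_pow, mul_pow] at h2
  have h1 := sq_norm_add_conj (p z) (p w)
  have h3 := sq_norm_one_sub_conj_mul z w
  have e1 : ‖p z - p w‖ ^ 2 = ‖p z + conj (p w)‖ ^ 2 - 4 * (p z).re * (p w).re := by linarith
  have e2 : ‖z - w‖ ^ 2 = ‖1 - conj w * z‖ ^ 2 - (1 - ‖z‖ ^ 2) * (1 - ‖w‖ ^ 2) := by linarith
  rw [e1, e2] at h2
  nlinarith

/-- The two-point Pick inequality for holomorphic functions with nonnegative real part. -/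
theorem pick_ineq {p : ℂ → ℂ} (hp : DifferentiableOn ℂ p (ball 0 1))
    (hre : ∀ z, ‖z‖ < 1 → 0 ≤ (p z).re) {z w : ℂ} (hz : ‖z‖ < 1) (hw : ‖w‖ < 1) :
    ‖p z + conj (p w)‖ ^ 2 * ((1 - ‖z‖ ^ 2) * (1 - ‖w‖ ^ 2)) ≤
      4 * (p z).re * (p w).re * ‖1 - conj w * z‖ ^ 2 := by
  -- Adding ε makes the real part strictly positive, so that the Cayley quotient is defined; then ε
  -- tends to 0.
  have key : ∀ ε : ℝ, 0 < ε → ‖p z + ε + conj (p w + ε)‖ ^ 2 * ((1 - ‖z‖ ^ 2) * (1 - ‖w‖ ^ 2)) ≤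
      4 * (p z + ε).re * (p w + ε).re * ‖1 - conj w * z‖ ^ 2 := fun ε hε =>
    pick_ineq_of_pos (p := fun z => p z + ε) (by fun_prop)
      (fun z hz => by simpa using add_pos_of_nonneg_of_pos (hre z hz) hε) hz hw
  have c1 : Tendsto (fun ε : ℝ => ‖p z + ε + conj (p w + ε)‖ ^ 2 * ((1 - ‖z‖ ^ 2) * (1 - ‖w‖ ^ 2)))
      (𝓝[>] 0) (𝓝 (‖p z + (0 : ℝ) + conj (p w + (0 : ℝ))‖ ^ 2 * ((1 - ‖z‖ ^ 2) * (1 - ‖w‖ ^ 2)))) :=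
    (Continuous.tendsto (by fun_prop) 0).mono_left nhdsWithin_le_nhds
  have c2 : Tendsto (fun ε : ℝ => 4 * (p z + ε).re * (p w + ε).re * ‖1 - conj w * z‖ ^ 2)
      (𝓝[>] 0) (𝓝 (4 * (p z + (0 : ℝ)).re * (p w + (0 : ℝ)).re * ‖1 - conj w * z‖ ^ 2)) :=
    (Continuous.tendsto (by fun_prop) 0).mono_left nhdsWithin_le_nhds
  have := le_of_tendsto_of_tendsto c1 c2
    (eventually_nhdsWithin_of_forall fun ε hε => key ε hε)
  simpa using this

/-- A minimum principle: the right side of the Pick inequality is zero, so p z = -conj (p w), and p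
w is imaginary. -/
theorem eq_of_re_eq_zero {p : ℂ → ℂ} (hp : DifferentiableOn ℂ p (ball 0 1))
    (hre : ∀ z, ‖z‖ < 1 → 0 ≤ (p z).re) {w : ℂ} (hw : ‖w‖ < 1) (h0 : (p w).re = 0)
    {z : ℂ} (hz : ‖z‖ < 1) : p z = p w := by
  have h := pick_ineq hp hre hz hw
  rw [h0] at h
  have h4 : 0 < (1 - ‖z‖ ^ 2) * (1 - ‖w‖ ^ 2) := by
    apply mul_pos <;> nlinarith [norm_nonneg z, norm_nonneg w]
  have h5 : ‖p z + conj (p w)‖ ^ 2 ≤ 0 := by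
    by_contra hc
    push Not at hc
    nlinarith [mul_pos hc h4]
  have h6 : p z + conj (p w) = 0 := by
    rw [← norm_eq_zero]
    nlinarith [norm_nonneg (p z + conj (p w))]
  rw [eq_neg_of_add_eq_zero_left h6]
  apply Complex.ext <;> simp [h0]

/-- The infinitesimal Pick inequality, obtained by dividing the two-point version by |z - w|² and
letting z tend to w. -/
theorem norm_deriv_mul_le {p : ℂ → ℂ} (hp : DifferentiableOn ℂ p (ball 0 1))
    (hre : ∀ z, ‖z‖ < 1 → 0 ≤ (p z).re) {w : ℂ} (hw : ‖w‖ < 1) :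
    ‖deriv p w‖ * (1 - ‖w‖ ^ 2) ≤ 2 * (p w).re := by
  have hd : HasDerivAt p (deriv p w) w :=
    (hp.differentiableAt (isOpen_ball.mem_nhds (by simpa using hw))).hasDerivAt
  have hpos : 0 < 1 - ‖w‖ ^ 2 := by nlinarith [norm_nonneg w]
  have t1 : Tendsto (fun z => ‖slope p w z‖ ^ 2 * ‖1 - conj w * z‖ ^ 2) (𝓝[≠] w)
      (𝓝 (‖deriv p w‖ ^ 2 * ‖1 - conj w * w‖ ^ 2)) :=
    ((hasDerivAt_iff_tendsto_slope.1 hd).norm.pow 2).mul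
      ((Continuous.tendsto (by fun_prop) w).mono_left nhdsWithin_le_nhds)
  have t2 : Tendsto (fun z => ‖p z + conj (p w)‖ ^ 2) (𝓝[≠] w) (𝓝 (‖p w + conj (p w)‖ ^ 2)) :=
    (((hd.continuousAt.tendsto).add_const _).norm.pow 2).mono_left nhdsWithin_le_nhds
  have hle := le_of_tendsto_of_tendsto t1 t2 (by
    have : ∀ᶠ z in 𝓝[≠] w, ‖z‖ < 1 :=
      nhdsWithin_le_nhds ((continuous_norm.tendsto w).eventually (gt_mem_nhds hw))
    filter_upwards [this, self_mem_nhdsWithin] with z hz hzw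
    have hzw' : 0 < ‖z - w‖ := norm_pos_iff.2 (sub_ne_zero.2 hzw)
    have h := pick_ineq hp hre hz hw
    have h1 := sq_norm_add_conj (p z) (p w)
    have h3 := sq_norm_one_sub_conj_mul z w
    rw [slope_def_field, norm_div, div_pow, div_mul_eq_mul_div, div_le_iff₀ (by positivity)]
    have e1 : ‖p z - p w‖ ^ 2 = ‖p z + conj (p w)‖ ^ 2 - 4 * (p z).re * (p w).re := by linarith
    have e2 : ‖z - w‖ ^ 2 = ‖1 - conj w * z‖ ^ 2 - (1 - ‖z‖ ^ 2) * (1 - ‖w‖ ^ 2) := by linarith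
    rw [e1, e2]
    nlinarith)
  have e : (1 : ℂ) - conj w * w = ((1 - ‖w‖ ^ 2 : ℝ) : ℂ) := by
    rw [mul_comm, Complex.mul_conj, Complex.normSq_eq_norm_sq]; push_cast; ring
  have e2 : p w + conj (p w) = ((2 * (p w).re : ℝ) : ℂ) := Complex.add_conj _
  rw [e, e2, Complex.norm_real, Complex.norm_real, ← mul_pow, Real.norm_of_nonneg hpos.le,
    Real.norm_of_nonneg (by linarith [hre w hw])] at hle
  exact le_of_pow_le_pow_left₀ two_ne_zero (by linarith [hre w hw]) hle

/-! ### Cayley kernels and the calculus of angular limits. -/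

theorem ne_of_norm_lt_one {σ z : ℂ} (hσ : ‖σ‖ = 1) (hz : ‖z‖ < 1) : σ - z ≠ 0 := by
  intro h
  rw [sub_eq_zero.1 h] at hσ
  linarith

theorem re_cayley {σ : ℂ} (hσ : ‖σ‖ = 1) (z : ℂ) :
    ((σ + z) / (σ - z)).re = (1 - ‖z‖ ^ 2) / ‖σ - z‖ ^ 2 := by
  have h1 : ‖σ‖ ^ 2 = 1 := by rw [hσ]; norm_num
  rw [Complex.sq_norm, Complex.normSq_apply] at h1
  rw [Complex.div_re, ← add_div, Complex.sq_norm, Complex.sq_norm, Complex.normSq_apply z]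
  congr 1
  simp only [Complex.add_re, Complex.sub_re, Complex.add_im, Complex.sub_im]
  linarith

theorem norm_one_sub_conj_mul_of_norm_eq_one {σ : ℂ} (hσ : ‖σ‖ = 1) (z : ℂ) :
    ‖1 - conj σ * z‖ = ‖σ - z‖ := by
  have h := sq_norm_one_sub_conj_mul z σ
  rw [hσ] at h
  rw [norm_sub_rev σ z]
  have h2 : ‖1 - conj σ * z‖ ^ 2 = ‖z - σ‖ ^ 2 := by linarith
  exact (pow_left_inj₀ (norm_nonneg _) (norm_nonneg _) two_ne_zero).1 h2

/-- Radial points rσ near σ lie in every Stolz angle with M > 1. This nontriviality is what makes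
angular limits unique. -/
theorem stolz_neBot {σ : ℂ} (hσ : ‖σ‖ = 1) {M : ℝ} (hM : 1 < M) :
    (comap (fun z : 𝔻 => (z : ℂ)) (𝓝 σ) ⊓ 𝓟 (stolzAngle σ M)).NeBot := by
  rw [inf_principal_neBot_iff]
  intro U hU
  obtain ⟨V, hV, hVU⟩ := mem_comap.1 hU
  have hc : Tendsto (fun r : ℝ => (r : ℂ) * σ) (𝓝[<] 1) (𝓝 σ) := by
    have : Tendsto (fun r : ℝ => (r : ℂ) * σ) (𝓝 1) (𝓝 (((1 : ℝ) : ℂ) * σ)) :=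
      Continuous.tendsto (by fun_prop) 1
    simpa using this.mono_left nhdsWithin_le_nhds
  have h0 : ∀ᶠ r : ℝ in 𝓝[<] 1, 0 < r := nhdsWithin_le_nhds (lt_mem_nhds one_pos)
  obtain ⟨r, hr, hr0, hr1⟩ := ((hc.eventually hV).and (h0.and self_mem_nhdsWithin)).exists
  have hr1 : r < 1 := hr1
  have hn : ‖(r : ℂ) * σ‖ = r := by
    rw [norm_mul, hσ, mul_one, Complex.norm_real, Real.norm_of_nonneg hr0.le]
  refine ⟨Complex.UnitDisc.mk (r * σ) (by rw [hn]; exact hr1), hVU hr, ?_⟩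
  have e : σ - r * σ = ((1 - r : ℝ) : ℂ) * σ := by push_cast; ring
  simp only [stolzAngle, mem_ofPred_eq, Complex.UnitDisc.coe_mk, hn]
  rw [e, norm_mul, hσ, mul_one, Complex.norm_real, Real.norm_of_nonneg (by linarith)]
  nlinarith

namespace HasAngularLimit

variable {f g : 𝔻 → ℂ} {σ a b : ℂ}

theorem unique (hσ : ‖σ‖ = 1) (ha : HasAngularLimit f σ a) (hb : HasAngularLimit f σ b) : a = b := by
  have := stolz_neBot hσ (M := 2) (by norm_num)
  exact tendsto_nhds_unique (ha 2 (by norm_num)) (hb 2 (by norm_num))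

theorem add (hf : HasAngularLimit f σ a) (hg : HasAngularLimit g σ b) :
    HasAngularLimit (fun z => f z + g z) σ (a + b) := fun M hM => (hf M hM).add (hg M hM)

theorem sub (hf : HasAngularLimit f σ a) (hg : HasAngularLimit g σ b) :
    HasAngularLimit (fun z => f z - g z) σ (a - b) := fun M hM => (hf M hM).sub (hg M hM)

theorem mul (hf : HasAngularLimit f σ a) (hg : HasAngularLimit g σ b) :
    HasAngularLimit (fun z => f z * g z) σ (a * b) := fun M hM => (hf M hM).mul (hg M hM)

theorem div (hf : HasAngularLimit f σ a) (hg : HasAngularLimit g σ b) (hb : b ≠ 0) :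
    HasAngularLimit (fun z => f z / g z) σ (a / b) := fun M hM => (hf M hM).div (hg M hM) hb

theorem congr (hf : HasAngularLimit f σ a) (h : ∀ z, f z = g z) : HasAngularLimit g σ a := by
  rwa [show g = f from funext fun z => (h z).symm]

theorem congr_lim (hf : HasAngularLimit f σ a) (h : a = b) : HasAngularLimit f σ b := h ▸ hf

theorem of_continuousAt {F : ℂ → ℂ} (hF : ContinuousAt F σ) :
    HasAngularLimit (fun z => F z) σ (F σ) := fun _ _ =>
  (hF.tendsto.comp tendsto_comap).mono_left inf_le_left

theorem const (c : ℂ) : HasAngularLimit (fun _ => c) σ c := fun _ _ => tendsto_const_nhds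

end HasAngularLimit

/-! ### Julia--Wolff theory: point masses at the boundary. -/

theorem le_of_frequently_le_of_tendsto {α : Type*} {l : Filter α} {f g : α → ℝ} {a b : ℝ}
    (hf : Tendsto f l (𝓝 a)) (hg : Tendsto g l (𝓝 b)) (h : ∃ᶠ x in l, f x ≤ g x) : a ≤ b := by
  by_contra hc
  push Not at hc
  exact h ((hg.eventually_lt hf hc).mono fun x hx => not_le.2 hx)

/-- A holomorphic function with nonnegative real part which dominates no positive multiple of the
Poisson kernel at `σ` has no mass at `σ`. -/
theorem hasAngularLimit_zero_of_maximal {s : ℂ → ℂ} (hs : DifferentiableOn ℂ s (ball 0 1))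
    (hre : ∀ z, ‖z‖ < 1 → 0 ≤ (s z).re) {σ : ℂ} (hσ : ‖σ‖ = 1)
    (hmax : ∀ c : ℝ, 0 ≤ c → (∀ z, ‖z‖ < 1 → c * (1 - ‖z‖ ^ 2) ≤ (s z).re * ‖σ - z‖ ^ 2) → c = 0) :
    HasAngularLimit (fun z => (σ - z) * s z) σ 0 := by
  intro M hM
  by_contra hcon
  rw [Metric.tendsto_nhds] at hcon
  push Not at hcon
  obtain ⟨ε, hε, hfr⟩ := hcon
  have hM0 : 0 < M := by linarith
  -- If the limit fails, |σ - w| |s w| ≥ ε for points w of the Stolz angle arbitrarily close to σ.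
  -- Letting such w tend to σ in the Pick inequality with z fixed yields ε(1-|z|²) ≤ 4M Re s(z)
  -- |σ-z|², which contradicts `hmax` with c = ε/(4M).
  have hc : ε / (4 * M) = 0 := by
    refine hmax _ (by positivity) fun z hz => ?_
    have hz2 : 0 < 1 - ‖z‖ ^ 2 := by nlinarith [norm_nonneg z]
    have hcoe : Tendsto (fun z : 𝔻 => (z : ℂ))
        (comap (fun z : 𝔻 => (z : ℂ)) (𝓝 σ) ⊓ 𝓟 (stolzAngle σ M)) (𝓝 σ) :=
      tendsto_comap.mono_left inf_le_left
    have t1 : Tendsto (fun w : 𝔻 => (ε - 2 * ‖s z‖ * ‖σ - w‖) * (1 - ‖z‖ ^ 2))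
        (comap (fun z : 𝔻 => (z : ℂ)) (𝓝 σ) ⊓ 𝓟 (stolzAngle σ M))
        (𝓝 ((ε - 2 * ‖s z‖ * ‖σ - σ‖) * (1 - ‖z‖ ^ 2))) :=
      (Continuous.tendsto (f := fun w : ℂ => (ε - 2 * ‖s z‖ * ‖σ - w‖) * (1 - ‖z‖ ^ 2))
        (by fun_prop) σ).comp hcoe
    have t2 : Tendsto (fun w : 𝔻 => 4 * M * (s z).re * ‖1 - conj (w : ℂ) * z‖ ^ 2)
        (comap (fun z : 𝔻 => (z : ℂ)) (𝓝 σ) ⊓ 𝓟 (stolzAngle σ M))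
        (𝓝 (4 * M * (s z).re * ‖1 - conj σ * z‖ ^ 2)) :=
      (Continuous.tendsto (f := fun w : ℂ => 4 * M * (s z).re * ‖1 - conj w * z‖ ^ 2)
        (by fun_prop) σ).comp hcoe
    have hst : ∀ᶠ w in comap (fun z : 𝔻 => (z : ℂ)) (𝓝 σ) ⊓ 𝓟 (stolzAngle σ M),
        w ∈ stolzAngle σ M := mem_inf_of_right (mem_principal_self _)
    have := le_of_frequently_le_of_tendsto t1 t2 ((hfr.and_eventually hst).mono ?_)
    · rw [norm_one_sub_conj_mul_of_norm_eq_one hσ, sub_self, norm_zero, mul_zero, sub_zero] at this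
      rw [div_mul_eq_mul_div, div_le_iff₀ (by positivity)]
      linarith
    · rintro w ⟨hw, hwS⟩
      rw [dist_zero_right, norm_mul] at hw
      have hw1 := w.norm_lt_one
      have hwS : ‖σ - (w : ℂ)‖ < M * (1 - ‖(w : ℂ)‖) := hwS
      have hpk := pick_ineq hs hre hz hw1
      set D := ‖1 - conj (w : ℂ) * z‖ ^ 2
      set a := ‖s w‖
      set A := ‖s z‖
      have hD : 0 ≤ D := by positivity
      have ha : 0 < a := by
        rcases (norm_nonneg (s w)).eq_or_lt with h | h
        · rw [show a = 0 from h.symm, mul_zero] at hw; linarith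
        · exact h
      have h1 : |a - A| ≤ ‖s z + conj (s w)‖ := by
        have := abs_norm_sub_norm_le (s z) (-conj (s w))
        rw [norm_neg, RCLike.norm_conj, sub_neg_eq_add, abs_sub_comm] at this
        exact this
      have h2 : (a - A) ^ 2 ≤ ‖s z + conj (s w)‖ ^ 2 := by
        rw [← sq_abs]; exact pow_le_pow_left₀ (abs_nonneg _) h1 2
      have hw2 : ‖σ - (w : ℂ)‖ ≤ M * (1 - ‖(w : ℂ)‖ ^ 2) := by
        have : 1 - ‖(w : ℂ)‖ ≤ 1 - ‖(w : ℂ)‖ ^ 2 := by nlinarith [norm_nonneg (w : ℂ)]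
        nlinarith
      have hrz := hre z hz
      have hA0 : 0 ≤ A := norm_nonneg _
      have h3 : (s w).re ≤ a := Complex.re_le_norm _
      have hQ : 0 < 1 - ‖(w : ℂ)‖ ^ 2 := by nlinarith [norm_nonneg (w : ℂ)]
      set Q := 1 - ‖(w : ℂ)‖ ^ 2
      set P := 1 - ‖z‖ ^ 2
      set d := ‖σ - (w : ℂ)‖
      have hd0 : 0 ≤ d := norm_nonneg _
      have h4 : (a - 2 * A) * (P * Q) ≤ 4 * (s z).re * D := by
        have h5 : (a ^ 2 - 2 * a * A) * (P * Q) ≤ 4 * (s z).re * a * D := by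
          calc (a ^ 2 - 2 * a * A) * (P * Q) ≤ ‖s z + conj (s w)‖ ^ 2 * (P * Q) := by
                apply mul_le_mul_of_nonneg_right _ (by positivity)
                nlinarith [sq_nonneg A]
            _ ≤ 4 * (s z).re * (s w).re * D := hpk
            _ ≤ 4 * (s z).re * a * D := by gcongr
        have h6 : a * ((a - 2 * A) * (P * Q)) ≤ a * (4 * (s z).re * D) := by linarith
        exact le_of_mul_le_mul_left h6 ha
      have h7 : 0 ≤ 4 * (s z).re * D := by positivity
      -- If a < 2A, the left side is nonpositive because ε ≤ d a; otherwise d ≤ M Q from the Stolz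
      -- angle converts the Pick bound.
      rcases le_or_gt 0 (a - 2 * A) with h8 | h8
      · calc (ε - 2 * A * d) * P ≤ (a - 2 * A) * d * P := by
              apply mul_le_mul_of_nonneg_right _ hz2.le
              linarith
          _ ≤ (a - 2 * A) * (M * Q) * P := by gcongr
          _ = M * ((a - 2 * A) * (P * Q)) := by ring
          _ ≤ M * (4 * (s z).re * D) := by gcongr
          _ = 4 * M * (s z).re * D := by ring
      · have h9 : (ε - 2 * A * d) ≤ 0 := by nlinarith
        calc (ε - 2 * A * d) * P ≤ 0 := mul_nonpos_of_nonpos_of_nonneg h9 hz2.le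
          _ ≤ M * (4 * (s z).re * D) := by positivity
          _ = 4 * M * (s z).re * D := by ring
  have : 0 < ε / (4 * M) := by positivity
  linarith

theorem differentiableOn_cayley {σ : ℂ} (hσ : ‖σ‖ = 1) :
    DifferentiableOn ℂ (fun z => (σ + z) / (σ - z)) (ball 0 1) :=
  DifferentiableOn.div (by fun_prop) (by fun_prop) fun z hz =>
    ne_of_norm_lt_one hσ (by simpa using hz)

/-- The mass at a boundary point of a holomorphic function with nonnegative real part. -/
theorem julia_wolff {p : ℂ → ℂ} (hp : DifferentiableOn ℂ p (ball 0 1))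
    (hre : ∀ z, ‖z‖ < 1 → 0 ≤ (p z).re) {σ : ℂ} (hσ : ‖σ‖ = 1) :
    ∃ β : ℝ, 0 ≤ β ∧ (∀ z, ‖z‖ < 1 → β * ((σ + z) / (σ - z)).re ≤ (p z).re) ∧
      HasAngularLimit (fun z => (σ - z) * p z) σ (2 * σ * β) := by
  have hequiv : ∀ (c : ℝ) (z : ℂ), ‖z‖ < 1 → ∀ x : ℝ,
      (c * ((σ + z) / (σ - z)).re ≤ x ↔ c * (1 - ‖z‖ ^ 2) ≤ x * ‖σ - z‖ ^ 2) := by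
    intro c z hz x
    have : 0 < ‖σ - z‖ ^ 2 := by
      have := norm_pos_iff.2 (ne_of_norm_lt_one hσ hz); positivity
    rw [re_cayley hσ, ← mul_div_assoc, div_le_iff₀ this]
  -- The mass is the largest multiple of the Poisson kernel lying below Re p. It is bounded by Re
  -- p(0) and attained by closedness; after subtracting it no positive multiple is left.
  set S : Set ℝ := {β | 0 ≤ β ∧ ∀ z, ‖z‖ < 1 → β * ((σ + z) / (σ - z)).re ≤ (p z).re} with hS
  have h0 : (0 : ℝ) ∈ S := ⟨le_rfl, fun z hz => by simpa using hre z hz⟩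
  have hbdd : BddAbove S := by
    refine ⟨(p 0).re, fun β hβ => ?_⟩
    have hσ0 : σ ≠ 0 := by rintro rfl; simp at hσ
    simpa [hσ0] using hβ.2 0 (by simp)
  have hclosed : IsClosed S := by
    rw [hS]
    simp only [ofPred_and, ofPred_forall]
    exact (isClosed_le continuous_const continuous_id).inter (isClosed_iInter fun z =>
      isClosed_iInter fun _ => isClosed_le (by fun_prop) continuous_const)
  have hmem : sSup S ∈ S := hclosed.csSup_mem ⟨0, h0⟩ hbdd
  set β := sSup S with hβ
  refine ⟨β, hmem.1, hmem.2, ?_⟩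
  have hlim := hasAngularLimit_zero_of_maximal (s := fun z => p z - β * ((σ + z) / (σ - z)))
    (hp.sub ((differentiableOn_cayley hσ).const_mul _))
    (fun z hz => by
      have := hmem.2 z hz
      rw [Complex.sub_re, Complex.re_ofReal_mul]
      linarith) hσ (fun c hc h => by
      have : β + c ∈ S := by
        refine ⟨add_nonneg hmem.1 hc, fun z hz => ?_⟩
        have := (hequiv c z hz _).2 (h z hz)
        rw [Complex.sub_re, Complex.re_ofReal_mul] at this
        linarith
      linarith [le_csSup hbdd this])
  have h2 : HasAngularLimit (fun z => β * (σ + z)) σ (β * (σ + σ)) :=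
    HasAngularLimit.of_continuousAt (F := fun z => β * (σ + z)) (by fun_prop)
  refine ((hlim.add h2).congr fun z => ?_).congr_lim (by ring)
  have := ne_of_norm_lt_one hσ z.norm_lt_one
  field_simp
  ring

/-- Simultaneous extraction of the masses at finitely many boundary points. -/
theorem re_sub_sum_nonneg {ι : Type*} {p : ℂ → ℂ} (hp : DifferentiableOn ℂ p (ball 0 1))
    (hre : ∀ z, ‖z‖ < 1 → 0 ≤ (p z).re) {σ : ι → ℂ} (hσ : ∀ k, ‖σ k‖ = 1)
    (hinj : Function.Injective σ) {β : ι → ℝ}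
    (hlim : ∀ k, HasAngularLimit (fun z => (σ k - z) * p z) (σ k) (2 * σ k * β k))
    (S : Finset ι) :
    ∀ z, ‖z‖ < 1 → 0 ≤ (p z - ∑ k ∈ S, β k * ((σ k + z) / (σ k - z))).re := by
  classical
  induction S using Finset.induction_on with
  | empty => simpa using hre
  | insert j S hj ih =>
    obtain ⟨γ, -, hγ, hγl⟩ := julia_wolff
      (p := fun z => p z - ∑ k ∈ S, β k * ((σ k + z) / (σ k - z)))
      (hp.sub (DifferentiableOn.fun_sum fun k _ => (differentiableOn_cayley (hσ k)).const_mul _))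
      ih (hσ j)
    -- The kernels removed so far are continuous at σ_j, so the remainder still has mass β_j there.
    have hl : HasAngularLimit (fun z => (σ j - z) * (p z - ∑ k ∈ S, β k * ((σ k + z) / (σ k - z))))
        (σ j) (2 * σ j * β j - (σ j - σ j) * ∑ k ∈ S, β k * ((σ k + σ j) / (σ k - σ j))) := by
      refine ((hlim j).sub (HasAngularLimit.of_continuousAt
        (F := fun z => (σ j - z) * ∑ k ∈ S, β k * ((σ k + z) / (σ k - z))) ?_)).congr fun z => by ring
      refine ContinuousAt.mul (by fun_prop) (tendsto_finsetSum _ fun k hk => ?_)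
      refine ContinuousAt.mul (by fun_prop) (ContinuousAt.div (by fun_prop) (by fun_prop) ?_)
      rw [sub_ne_zero]
      intro h
      exact hj (hinj h ▸ hk)
    have hγβ : γ = β j := by
      have hσ0 : σ j ≠ 0 := by intro h; have := hσ j; rw [h] at this; simp at this
      have := hγl.unique (hσ j) hl
      rw [sub_self, zero_mul, sub_zero] at this
      have h2 := mul_left_cancel₀ (mul_ne_zero two_ne_zero hσ0) this
      exact_mod_cast h2
    intro z hz
    have := hγ z hz
    rw [hγβ] at this
    rw [Finset.sum_insert hj, ← sub_sub, sub_right_comm, Complex.sub_re _ (β j * _), Complex.re_ofReal_mul]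
    linarith

/-! ### Flows of Berkson--Porta vector fields. -/

/-- A holomorphic vector field on the disc can be cut off outside a smaller disc. -/
theorem exists_cutoff {G : ℂ → ℂ} (hG : DifferentiableOn ℂ G (ball 0 1)) {ρ : ℝ} (hρ0 : 0 < ρ)
    (hρ : ρ < 1) : ∃ (V : ℂ → ℂ) (K B : ℝ≥0), LipschitzWith K V ∧ (∀ z, ‖V z‖ ≤ B) ∧
      (∀ z, ‖z‖ ≤ ρ → V z = G z) ∧ (∀ z, 1 ≤ ‖z‖ → V z = 0) ∧
      ∀ z, ∃ c : ℝ, 0 ≤ c ∧ c ≤ 1 ∧ V z = c * G z := by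
  -- The bump is 1 up to radius ρ and vanishes from (1+ρ)/2 on, so χG is C¹ with compact support,
  -- hence globally bounded and Lipschitz.
  let χ : ContDiffBump (0 : ℂ) := ⟨ρ, (1 + ρ) / 2, hρ0, by linarith⟩
  set V : ℂ → ℂ := fun z => (χ z : ℂ) * G z with hV
  have hsupp : ∀ z : ℂ, (1 + ρ) / 2 ≤ ‖z‖ → χ z = 0 := fun z hz =>
    χ.zero_of_le_dist (by simpa using hz)
  have hcs : HasCompactSupport V := by
    refine HasCompactSupport.intro (isCompact_closedBall (0 : ℂ) ((1 + ρ) / 2)) fun z hz => ?_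
    rw [mem_closedBall, dist_zero_right, not_le] at hz
    rw [hV]
    simp [hsupp z hz.le]
  have hcd : ContDiff ℝ 1 V := by
    rw [contDiff_iff_contDiffAt]
    intro z
    rcases lt_or_ge ‖z‖ 1 with hz | hz
    · have h1 : ContDiffAt ℝ 1 G z :=
        ((hG.analyticAt (isOpen_ball.mem_nhds (by simpa using hz))).contDiffAt (n := 1)).restrict_scalars ℝ
      have h2 : ContDiffAt ℝ 1 (fun z => (χ z : ℂ)) z :=
        Complex.ofRealCLM.contDiff.contDiffAt.comp z χ.contDiffAt
      exact h2.mul h1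
    · have : V =ᶠ[𝓝 z] fun _ => 0 := by
        have : ∀ᶠ w in 𝓝 z, (1 + ρ) / 2 < ‖w‖ :=
          (continuous_norm.tendsto z).eventually (lt_mem_nhds (by linarith))
        filter_upwards [this] with w hw
        rw [hV]
        simp [hsupp w hw.le]
      exact contDiffAt_const.congr_of_eventuallyEq this
  obtain ⟨K, hK⟩ := hcd.lipschitzWith_of_hasCompactSupport hcs one_ne_zero
  obtain ⟨B, hB⟩ := hcs.exists_bound_of_continuous hcd.continuous
  refine ⟨V, K, B.toNNReal, hK, fun z => (hB z).trans (Real.le_coe_toNNReal B), fun z hz => ?_,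
    fun z hz => ?_, fun z => ⟨χ z, χ.nonneg, χ.le_one, rfl⟩⟩
  · rw [hV]
    simp [χ.one_of_mem_closedBall (by simpa using hz)]
  · rw [hV]
    simp [hsupp z (by linarith)]

/-- The infinitesimal contraction property of semicomplete vector fields in Berkson-Porta form. -/
theorem re_deriv_mul_add_le {p : ℂ → ℂ} (hp : DifferentiableOn ℂ p (ball 0 1))
    (hre : ∀ z, ‖z‖ < 1 → 0 ≤ (p z).re) (τ : ℂ) {z : ℂ} (hz : ‖z‖ < 1) :
    (deriv (fun z => (τ - z) * (1 - conj τ * z) * p z) z).re * (1 - ‖z‖ ^ 2) +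
      2 * (conj z * ((τ - z) * (1 - conj τ * z) * p z)).re ≤ 0 := by
  have hd : HasDerivAt p (deriv p z) z :=
    (hp.differentiableAt (isOpen_ball.mem_nhds (by simpa using hz))).hasDerivAt
  have hA : HasDerivAt (fun z : ℂ => τ - z) (-1) z := by simpa using (hasDerivAt_id z).const_sub τ
  have hB : HasDerivAt (fun z : ℂ => 1 - conj τ * z) (-conj τ) z := by
    simpa using ((hasDerivAt_id z).const_mul (conj τ)).const_sub 1
  have hD := ((hA.mul hB).mul hd).deriv
  rw [show deriv (fun z => (τ - z) * (1 - conj τ * z) * p z) z = _ from hD]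
  have hR : ((1 - ‖z‖ ^ 2 : ℝ) : ℂ) = 1 - z * conj z := by
    rw [Complex.mul_conj, Complex.normSq_eq_norm_sq]; push_cast; ring
  have e1 : ((‖τ - z‖ ^ 2 + ‖1 - conj τ * z‖ ^ 2 : ℝ) : ℂ) =
      (τ - z) * conj (τ - z) + (1 - conj τ * z) * conj (1 - conj τ * z) := by
    rw [Complex.mul_conj, Complex.mul_conj, Complex.normSq_eq_norm_sq, Complex.normSq_eq_norm_sq]
    push_cast; ring
  -- The derivative of the quadratic factor and the term 2 conj z G combine to -(|τ-z|² + |1-conj τ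
  -- z|²) p. The p' term is at most 2|τ-z||1-conj τ z| Re p, so what remains is minus a square times
  -- Re p.
  have e2 : (((-1 * (1 - conj τ * z) + (τ - z) * -conj τ) * p z +
      (τ - z) * (1 - conj τ * z) * deriv p z) * ((1 - ‖z‖ ^ 2 : ℝ) : ℂ) +
      ((2 : ℝ) : ℂ) * (conj z * ((τ - z) * (1 - conj τ * z) * p z))) =
      ((-(‖τ - z‖ ^ 2 + ‖1 - conj τ * z‖ ^ 2) : ℝ) : ℂ) * p z +
        ((1 - ‖z‖ ^ 2 : ℝ) : ℂ) * ((τ - z) * (1 - conj τ * z) * deriv p z) := by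
    rw [Complex.ofReal_neg, e1, hR]
    simp only [map_sub, map_mul, map_one, Complex.conj_conj]
    push_cast
    ring
  have e3 := congrArg Complex.re e2
  simp only [Complex.add_re, Complex.re_mul_ofReal, Complex.re_ofReal_mul] at e3
  simp only [Pi.mul_apply, Complex.add_re]
  rw [e3]
  have h1 : ((τ - z) * (1 - conj τ * z) * deriv p z).re ≤
      ‖τ - z‖ * ‖1 - conj τ * z‖ * ‖deriv p z‖ := by
    refine (Complex.re_le_norm _).trans ?_
    rw [norm_mul, norm_mul]
  have h2 := norm_deriv_mul_le hp hre hz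
  have h3 : 0 < 1 - ‖z‖ ^ 2 := by nlinarith [norm_nonneg z]
  have h4 : (1 - ‖z‖ ^ 2) * ((τ - z) * (1 - conj τ * z) * deriv p z).re ≤
      ‖τ - z‖ * ‖1 - conj τ * z‖ * (2 * (p z).re) := by
    calc _ ≤ (1 - ‖z‖ ^ 2) * (‖τ - z‖ * ‖1 - conj τ * z‖ * ‖deriv p z‖) := by gcongr
      _ = ‖τ - z‖ * ‖1 - conj τ * z‖ * (‖deriv p z‖ * (1 - ‖z‖ ^ 2)) := by ring
      _ ≤ _ := by gcongr
  nlinarith [mul_nonneg (sq_nonneg (‖τ - z‖ - ‖1 - conj τ * z‖)) (hre z hz)]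

/-- Trajectories of `G` on `[0, T]` inside the disc. -/
def IsTraj (G : ℂ → ℂ) (T : ℝ) (x : ℝ → ℂ) : Prop :=
  ∀ t ∈ Icc 0 T, ‖x t‖ < 1 ∧ HasDerivWithinAt x (G (x t)) (Icc 0 T) t

theorem IsTraj.continuousOn {G : ℂ → ℂ} {T : ℝ} {x : ℝ → ℂ} (h : IsTraj G T x) :
    ContinuousOn x (Icc 0 T) := fun t ht => (h t ht).2.continuousWithinAt

theorem IsTraj.mono {G : ℂ → ℂ} {T S : ℝ} {x : ℝ → ℂ} (h : IsTraj G T x) (hS : S ≤ T) :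
    IsTraj G S x := fun t ht =>
  ⟨(h t ⟨ht.1, ht.2.trans hS⟩).1,
    (h t ⟨ht.1, ht.2.trans hS⟩).2.mono (Icc_subset_Icc_right hS)⟩

theorem hasDerivWithinAt_Ici_of_Icc {x : ℝ → ℂ} {T t : ℝ} {d : ℂ} (ht : t ∈ Ico 0 T)
    (h : HasDerivWithinAt x d (Icc 0 T) t) : HasDerivWithinAt x d (Ici t) t :=
  (h.mono (Icc_subset_Icc_left ht.1)).mono_of_mem_nhdsWithin (Icc_mem_nhdsGE ht.2)

theorem IsTraj.exists_norm_le {G : ℂ → ℂ} {T : ℝ} {x : ℝ → ℂ} (h : IsTraj G T x) :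
    ∃ ρ, 0 < ρ ∧ ρ < 1 ∧ ∀ t ∈ Icc 0 T, ‖x t‖ ≤ ρ := by
  rcases (Icc 0 T).eq_empty_or_nonempty with he | hne
  · exact ⟨1 / 2, by norm_num, by norm_num, by simp [he]⟩
  · obtain ⟨t, ht, hmax⟩ := isCompact_Icc.exists_isMaxOn hne h.continuousOn.norm
    exact ⟨max ‖x t‖ (1 / 2), by positivity, max_lt (h t ht).1 (by norm_num),
      fun s hs => le_max_of_le_left (hmax hs)⟩

/-- Both curves stay where V = G, so Grönwall's estimate for the globally Lipschitz field V applies.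
-/
theorem IsTraj.dist_le {G V : ℂ → ℂ} {K : ℝ≥0} {ρ T : ℝ} {x y : ℝ → ℂ} (hV : LipschitzWith K V)
    (hVG : ∀ z, ‖z‖ ≤ ρ → V z = G z) (hx : IsTraj G T x) (hy : IsTraj G T y)
    (hxρ : ∀ t ∈ Icc 0 T, ‖x t‖ ≤ ρ) (hyρ : ∀ t ∈ Icc 0 T, ‖y t‖ ≤ ρ) :
    ∀ t ∈ Icc 0 T, dist (x t) (y t) ≤ dist (x 0) (y 0) * Real.exp (K * t) := by
  have := dist_le_of_trajectories_ODE (v := fun _ => V) (fun _ => hV) hx.continuousOn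
    (fun t ht => by
      rw [hVG _ (hxρ t (Ico_subset_Icc_self ht))]
      exact hasDerivWithinAt_Ici_of_Icc ht (hx t (Ico_subset_Icc_self ht)).2) hy.continuousOn
    (fun t ht => by
      rw [hVG _ (hyρ t (Ico_subset_Icc_self ht))]
      exact hasDerivWithinAt_Ici_of_Icc ht (hy t (Ico_subset_Icc_self ht)).2) le_rfl
  simpa using this

theorem IsTraj.eqOn {G : ℂ → ℂ} (hG : DifferentiableOn ℂ G (ball 0 1)) {T : ℝ} {x y : ℝ → ℂ}
    (hx : IsTraj G T x) (hy : IsTraj G T y) (h0 : x 0 = y 0) : EqOn x y (Icc 0 T) := by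
  obtain ⟨ρ₁, h1, h1', hxρ⟩ := hx.exists_norm_le
  obtain ⟨ρ₂, h2, h2', hyρ⟩ := hy.exists_norm_le
  obtain ⟨V, K, B, hV, -, hVG, -⟩ := exists_cutoff hG (ρ := max ρ₁ ρ₂) (by positivity) (max_lt h1' h2')
  intro t ht
  have := hx.dist_le hV hVG hy (fun t ht => le_max_of_le_left (hxρ t ht))
    (fun t ht => le_max_of_le_right (hyρ t ht)) t ht
  rw [h0, dist_self, zero_mul] at this
  exact dist_le_zero.1 this

theorem hasDerivWithinAt_one_sub_sq_norm {x : ℝ → ℂ} {d : ℂ} {s : Set ℝ} {t : ℝ}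
    (h : HasDerivWithinAt x d s t) :
    HasDerivWithinAt (fun t => 1 - ‖x t‖ ^ 2) (-(2 * (conj (x t) * d).re)) s t := by
  have := h.norm_sq.const_sub 1
  rwa [Complex.inner, mul_comm d] at this

/-- Existence of trajectories, with a quantitative bound of the distance to the boundary. -/
theorem exists_isTraj {p : ℂ → ℂ} (hp : DifferentiableOn ℂ p (ball 0 1))
    (hre : ∀ z, ‖z‖ < 1 → 0 ≤ (p z).re) (τ : ℂ) {G : ℂ → ℂ}
    (hG : G = fun z => (τ - z) * (1 - conj τ * z) * p z) {z : ℂ} (hz : ‖z‖ < 1) {T : ℝ} (hT : 0 ≤ T) :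
    ∃ x, x 0 = z ∧ IsTraj G T x ∧ ∀ t ∈ Icc 0 T,
      (1 - ‖z‖ ^ 2) * Real.exp (-(2 * (‖G z‖ / (1 - ‖z‖ ^ 2)) * T)) ≤ 1 - ‖x t‖ ^ 2 := by
  have hGd : DifferentiableOn ℂ G (ball 0 1) := by rw [hG]; fun_prop
  have hineq : ∀ w, ‖w‖ < 1 → (deriv G w).re * (1 - ‖w‖ ^ 2) + 2 * (conj w * G w).re ≤ 0 := by
    intro w hw
    rw [hG]
    exact re_deriv_mul_add_le hp hre τ hw
  have hN : 0 < 1 - ‖z‖ ^ 2 := by nlinarith [norm_nonneg z]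
  -- K is the hyperbolic speed at time 0. Infinitesimal contraction keeps the speed below K, so
  -- 1-|x|² decays at most like exp(-2Kt); m below is the resulting lower bound up to time T.
  set K := ‖G z‖ / (1 - ‖z‖ ^ 2) with hK
  have hK0 : 0 ≤ K := by positivity
  set m := (1 - ‖z‖ ^ 2) * Real.exp (-(2 * K * T)) with hm
  have hm0 : 0 < m := by positivity
  have hm1 : m ≤ 1 - ‖z‖ ^ 2 := by
    have : Real.exp (-(2 * K * T)) ≤ 1 := Real.exp_le_one_iff.2 (by
      have : 0 ≤ 2 * K * T := by positivity
      linarith)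
    nlinarith
  have hm2 : m ≤ 1 := by nlinarith [sq_nonneg ‖z‖]
  set ρ := max (Real.sqrt (1 - m)) (1 / 2) with hρ
  have hρ1 : ρ < 1 := by
    refine max_lt ?_ (by norm_num)
    rw [Real.sqrt_lt' one_pos]
    linarith
  obtain ⟨V, L, B, hV, hB, hVG, hV0, hVc⟩ := exists_cutoff hGd (ρ := ρ) (by positivity) hρ1
  have hpl : IsPicardLindelof (fun _ => V) (tmin := 0) (tmax := T) ⟨0, left_mem_Icc.2 hT⟩ z
      (B * ⟨T, hT⟩) 0 B L := by
    refine IsPicardLindelof.of_time_independent (fun x _ => hB x) hV.lipschitzOnWith ?_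
    simp [hT]
    rfl
  obtain ⟨x, hx0, hx⟩ := hpl.exists_eq_forall_mem_Icc_hasDerivWithinAt₀
  have hxc : ContinuousOn x (Icc 0 T) := fun t ht => (hx t ht).continuousWithinAt
  -- The cut-off field vanishes outside the disc, so a point reached there is also a constant
  -- solution; backward uniqueness would place the starting point outside too.
  have hx1 : ∀ t ∈ Icc 0 T, ‖x t‖ < 1 := by
    intro t ht
    by_contra hcon
    push Not at hcon
    have hsub : Icc 0 t ⊆ Icc 0 T := Icc_subset_Icc_right ht.2
    have := ODE_solution_unique_of_mem_Icc_left (v := fun _ => V) (s := fun _ => univ) (K := L)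
      (f := x) (g := fun _ => x t) (a := 0) (b := t) (fun _ _ => hV.lipschitzOnWith) (hxc.mono hsub)
      (fun s hs => ((hx s (hsub (Ioc_subset_Icc_self hs))).mono
        (Icc_subset_Icc_right (hs.2.trans ht.2))).mono_of_mem_nhdsWithin (Icc_mem_nhdsLE hs.1))
      (fun _ _ => trivial) continuousOn_const
      (fun s _ => by
        simp only [hV0 _ hcon]
        exact hasDerivWithinAt_const _ _ _) (fun _ _ => trivial) rfl (left_mem_Icc.2 ht.1)
    simp only at this hx0
    rw [hx0] at this
    rw [← this] at hcon
    linarith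
  have hNpos : ∀ t ∈ Icc 0 T, 0 < 1 - ‖x t‖ ^ 2 := fun t ht => by
    nlinarith [norm_nonneg (x t), hx1 t ht]
  have hGx : ∀ t ∈ Icc 0 T, HasDerivWithinAt (fun t => G (x t)) (deriv G (x t) * V (x t)) (Icc 0 T) t :=
    fun t ht => by
      have hd := (hGd.differentiableAt (isOpen_ball.mem_nhds
        (by simpa using hx1 t ht : x t ∈ ball (0 : ℂ) 1))).hasDerivAt
      rw [mul_comm]
      exact hd.scomp_hasDerivWithinAt t (hx t ht)
  have hspeed : ∀ t ∈ Icc 0 T, ‖G (x t)‖ ≤ K * (1 - ‖x t‖ ^ 2) := by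
    -- The squared hyperbolic speed has derivative a nonnegative multiple of the expression in
    -- `hineq`; the factor c of the cut-off does not spoil the sign.
    have hanti : AntitoneOn (fun t => ‖G (x t)‖ ^ 2 / (1 - ‖x t‖ ^ 2) ^ 2) (Icc 0 T) := by
      have hder : ∀ t ∈ Icc 0 T, HasDerivWithinAt (fun t => ‖G (x t)‖ ^ 2 / (1 - ‖x t‖ ^ 2) ^ 2) _
          (Icc 0 T) t := fun t ht =>
        ((hGx t ht).norm_sq).div ((hasDerivWithinAt_one_sub_sq_norm (hx t ht)).pow 2)
          (pow_ne_zero 2 (hNpos t ht).ne')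
      refine antitoneOn_of_hasDerivWithinAt_nonpos (convex_Icc 0 T)
        (fun t ht => (hder t ht).continuousWithinAt)
        (fun t ht => (hder t (interior_subset ht)).mono interior_subset) fun t ht => ?_
      have ht := interior_subset ht
      have hn := hNpos t ht
      obtain ⟨c, hc0, -, hc⟩ := hVc (x t)
      have hi := hineq _ (hx1 t ht)
      apply div_nonpos_of_nonpos_of_nonneg _ (by positivity)
      have e1 : inner ℝ (G (x t)) (deriv G (x t) * V (x t)) = c * ‖G (x t)‖ ^ 2 * (deriv G (x t)).re := by
        have : deriv G (x t) * (c * G (x t)) * conj (G (x t)) =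
            ((c * ‖G (x t)‖ ^ 2 : ℝ) : ℂ) * deriv G (x t) := by
          have := Complex.mul_conj (G (x t))
          rw [Complex.normSq_eq_norm_sq] at this
          push_cast at this ⊢
          linear_combination (deriv G (x t) * c) * this
        rw [Complex.inner, hc, this, Complex.re_ofReal_mul]
      have e2 : (conj (x t) * V (x t)).re = c * (conj (x t) * G (x t)).re := by
        rw [hc, mul_left_comm, Complex.re_ofReal_mul]
      rw [e1, e2]
      have : 2 * (c * ‖G (x t)‖ ^ 2 * (deriv G (x t)).re) * (1 - ‖x t‖ ^ 2) ^ 2 -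
          ‖G (x t)‖ ^ 2 * ((2 : ℕ) * (1 - ‖x t‖ ^ 2) ^ (2 - 1) * -(2 * (c * (conj (x t) * G (x t)).re))) =
          2 * c * ‖G (x t)‖ ^ 2 * (1 - ‖x t‖ ^ 2) *
            ((deriv G (x t)).re * (1 - ‖x t‖ ^ 2) + 2 * (conj (x t) * G (x t)).re) := by
        norm_num
        ring
      rw [this]
      exact mul_nonpos_of_nonneg_of_nonpos (by positivity) hi
    intro t ht
    have h := hanti (left_mem_Icc.2 hT) ht ht.1
    simp only [show x 0 = z from hx0] at h
    rw [← div_pow, ← div_pow, ← hK] at h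
    have hn := hNpos t ht
    rw [← div_le_iff₀ hn]
    exact le_of_pow_le_pow_left₀ two_ne_zero hK0 h
  have hbound : ∀ t ∈ Icc 0 T, m ≤ 1 - ‖x t‖ ^ 2 := by
    have hmono : MonotoneOn (fun t => (1 - ‖x t‖ ^ 2) * Real.exp (2 * K * t)) (Icc 0 T) := by
      have hder : ∀ t ∈ Icc 0 T, HasDerivWithinAt (fun t => (1 - ‖x t‖ ^ 2) * Real.exp (2 * K * t)) _
          (Icc 0 T) t := fun t ht =>
        (hasDerivWithinAt_one_sub_sq_norm (hx t ht)).mul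
          (((hasDerivAt_id t).const_mul (2 * K)).exp.hasDerivWithinAt)
      refine monotoneOn_of_hasDerivWithinAt_nonneg (convex_Icc 0 T)
        (fun t ht => (hder t ht).continuousWithinAt)
        (fun t ht => (hder t (interior_subset ht)).mono interior_subset) fun t ht => ?_
      have ht := interior_subset ht
      have hn := hNpos t ht
      obtain ⟨c, hc0, hc1, hc⟩ := hVc (x t)
      have h1 : (conj (x t) * V (x t)).re ≤ K * (1 - ‖x t‖ ^ 2) := by
        refine (Complex.re_le_norm _).trans ?_
        rw [norm_mul, RCLike.norm_conj, hc, norm_mul, Complex.norm_real, Real.norm_of_nonneg hc0]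
        have h2 := hspeed t ht
        calc ‖x t‖ * (c * ‖G (x t)‖) ≤ 1 * (1 * ‖G (x t)‖) := by
              gcongr
              exact (hx1 t ht).le
          _ ≤ _ := by simpa using h2
      have h3 := Real.exp_pos (2 * K * t)
      simp only [id, mul_one]
      nlinarith [mul_nonneg h3.le (sub_nonneg.2 h1)]
    intro t ht
    have h := hmono (left_mem_Icc.2 hT) ht ht.1
    simp only [show x 0 = z from hx0, mul_zero, Real.exp_zero, mul_one] at h
    have h2 : (1 - ‖x t‖ ^ 2) * Real.exp (2 * K * t) ≤ (1 - ‖x t‖ ^ 2) * Real.exp (2 * K * T) := by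
      have := hNpos t ht
      have := ht.2
      gcongr
    rw [hm, Real.exp_neg, ← div_eq_mul_inv, div_le_iff₀ (Real.exp_pos _)]
    exact h.trans h2
  refine ⟨x, hx0, fun t ht => ⟨hx1 t ht, ?_⟩, hbound⟩
  -- The bound m confines the curve to radius ρ, where the cut-off is inactive, so it solves the
  -- original equation.
  rw [← hVG]
  · exact hx t ht
  · refine le_max_of_le_left (Real.le_sqrt_of_sq_le ?_)
    linarith [hbound t ht]

/-- Existence of global trajectories. -/
theorem exists_global_traj {p : ℂ → ℂ} (hp : DifferentiableOn ℂ p (ball 0 1))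
    (hre : ∀ z, ‖z‖ < 1 → 0 ≤ (p z).re) (τ : ℂ) {G : ℂ → ℂ}
    (hG : G = fun z => (τ - z) * (1 - conj τ * z) * p z) {z : ℂ} (hz : ‖z‖ < 1) :
    ∃ x, x 0 = z ∧ ∀ T, 0 ≤ T → IsTraj G T x ∧ ∀ t ∈ Icc 0 T,
      (1 - ‖z‖ ^ 2) * Real.exp (-(2 * (‖G z‖ / (1 - ‖z‖ ^ 2)) * T)) ≤ 1 - ‖x t‖ ^ 2 := by
  have hGd : DifferentiableOn ℂ G (ball 0 1) := by rw [hG]; fun_prop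
  have hex := fun (T : ℝ≥0) => exists_isTraj hp hre τ hG hz T.2
  choose y hy0 hy hyb using hex
  -- At time t the solution on [0, t+1] is used; uniqueness makes the choices compatible.
  set x : ℝ → ℂ := fun t => y (t.toNNReal + 1) t with hx
  have hxy : ∀ T : ℝ≥0, EqOn x (y T) (Icc 0 T) := by
    intro T s hs
    have hs1 : ((s.toNNReal + 1 : ℝ≥0) : ℝ) = s + 1 := by
      push_cast; rw [Real.coe_toNNReal s hs.1]
    have h1 : IsTraj G s (y (s.toNNReal + 1)) := (hy _).mono (by
      change s ≤ ((s.toNNReal + 1 : ℝ≥0) : ℝ)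
      rw [hs1]; linarith)
    exact h1.eqOn hGd ((hy T).mono hs.2) (by rw [hy0, hy0]) (right_mem_Icc.2 hs.1)
  refine ⟨x, hy0 _, fun T hT => ⟨fun t ht => ?_, fun t ht => ?_⟩⟩
  · have h := hy ⟨T, hT⟩ t ht
    have e := hxy ⟨T, hT⟩ ht
    rw [e]
    exact ⟨h.1, h.2.congr (hxy ⟨T, hT⟩) e⟩
  · rw [hxy ⟨T, hT⟩ ht]
    exact hyb ⟨T, hT⟩ t ht

/-- Mean value inequality for w ↦ G w - G'(a) w on the convex set where |w| ≤ ρ and |w - a| ≤ |b -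
a|; there its derivative is at most K|b - a|. -/
theorem norm_taylor_le {G V : ℂ → ℂ} (hG : DifferentiableOn ℂ G (ball 0 1)) {K : ℝ≥0} {ρ : ℝ}
    (hρ : ρ < 1) (hV : LipschitzWith K V) (hVG : ∀ z, ‖z‖ ≤ ρ → V z = deriv G z) {a b : ℂ}
    (ha : ‖a‖ ≤ ρ) (hb : ‖b‖ ≤ ρ) : ‖G b - G a - deriv G a * (b - a)‖ ≤ K * ‖b - a‖ ^ 2 := by
  have h := Convex.norm_image_sub_le_of_norm_hasDerivWithin_le (𝕜 := ℂ)
    (f := fun w => G w - deriv G a * w) (f' := fun w => deriv G w - deriv G a * 1)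
    (s := closedBall 0 ρ ∩ closedBall a ‖b - a‖) (C := K * ‖b - a‖) (x := a) (y := b)
    (fun w hw => by
      have hw1 : w ∈ ball (0 : ℂ) 1 := by
        have := hw.1
        simp only [mem_closedBall, dist_zero_right, mem_ball] at this ⊢
        linarith
      have hd := (hG.differentiableAt (isOpen_ball.mem_nhds hw1)).hasDerivAt
      exact (hd.sub ((hasDerivAt_id w).const_mul (deriv G a))).hasDerivWithinAt)
    (fun w hw => by
      have hw1 : ‖w‖ ≤ ρ := by simpa using hw.1
      have hw2 : ‖w - a‖ ≤ ‖b - a‖ := by simpa [dist_eq_norm] using hw.2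
      rw [mul_one, ← hVG w hw1, ← hVG a ha]
      exact (hV.norm_sub_le w a).trans (by gcongr))
    ((convex_closedBall _ _).inter (convex_closedBall _ _))
    ⟨by simpa using ha, by simp⟩ ⟨by simpa using hb, by simp [dist_eq_norm]⟩
  calc _ = ‖G b - deriv G a * b - (G a - deriv G a * a)‖ := by congr 1; ring
    _ ≤ _ := h
    _ = _ := by ring

/-- Holomorphic dependence of trajectories on the initial value. -/
theorem differentiableAt_flow {G : ℂ → ℂ} (hG : DifferentiableOn ℂ G (ball 0 1)) {X : ℂ → ℝ → ℂ}
    (hX0 : ∀ z, ‖z‖ < 1 → X z 0 = z)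
    (hX : ∀ z, ‖z‖ < 1 → ∀ T, 0 ≤ T → IsTraj G T (X z) ∧ ∀ t ∈ Icc 0 T,
      (1 - ‖z‖ ^ 2) * Real.exp (-(2 * (‖G z‖ / (1 - ‖z‖ ^ 2)) * T)) ≤ 1 - ‖X z t‖ ^ 2)
    {t : ℝ} (ht : 0 ≤ t) {z₀ : ℂ} (hz₀ : ‖z₀‖ < 1) : DifferentiableAt ℂ (fun z => X z t) z₀ := by
  -- The lower bound for 1-|X|² is continuous in the starting point, so all trajectories starting
  -- near z₀ stay in one disc of radius ρ < 1 up to time t.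
  set b : ℂ → ℝ := fun z =>
    (1 - ‖z‖ ^ 2) * Real.exp (-(2 * (‖G z‖ / (1 - ‖z‖ ^ 2)) * t)) with hb
  have hN : 0 < 1 - ‖z₀‖ ^ 2 := by nlinarith [norm_nonneg z₀]
  have hb0 : 0 < b z₀ := by simp only [hb]; positivity
  have hGc : ContinuousAt G z₀ :=
    hG.continuousOn.continuousAt (isOpen_ball.mem_nhds (by simpa using hz₀))
  have hbc : ContinuousAt b z₀ := by
    simp only [hb]
    refine ContinuousAt.mul (by fun_prop) (Real.continuous_exp.continuousAt.comp ?_)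
    refine ContinuousAt.neg (ContinuousAt.mul (ContinuousAt.mul continuousAt_const ?_) continuousAt_const)
    exact ContinuousAt.div hGc.norm (by fun_prop) hN.ne'
  set ρ := max (Real.sqrt (1 - b z₀ / 2)) (1 / 2) with hρ
  have hρ1 : ρ < 1 := by
    refine max_lt ?_ (by norm_num)
    rw [Real.sqrt_lt' one_pos]
    linarith
  have hbd : ∀ z, ‖z‖ < 1 → b z₀ / 2 < b z → ∀ s ∈ Icc 0 t, ‖X z s‖ ≤ ρ := by
    intro z hz hbz s hs
    have := (hX z hz t ht).2 s hs
    refine le_max_of_le_left (Real.le_sqrt_of_sq_le ?_)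
    simp only [hb] at hbz ⊢
    linarith
  have hx₀ρ := hbd z₀ hz₀ (by linarith)
  obtain ⟨V, K, B, hV, -, hVG, -⟩ := exists_cutoff hG (ρ := ρ) (by positivity) hρ1
  obtain ⟨V', K', B', hV', -, hVG', -⟩ :=
    exists_cutoff (hG.deriv isOpen_ball) (ρ := ρ) (by positivity) hρ1
  have hx₀ := (hX z₀ hz₀ t ht).1
  -- G' along the base trajectory, extended continuously to all times so that its primitive A is
  -- differentiable everywhere; exp(A t) will be the derivative of the flow.
  set c : ℝ → ℂ := fun s => V' (X z₀ (projIcc 0 t ht s)) with hc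
  have hcc : Continuous c := by
    refine hV'.continuous.comp ?_
    exact hx₀.continuousOn.domRestrict.comp continuous_projIcc
  have hcs : ∀ s ∈ Icc 0 t, c s = deriv G (X z₀ s) := by
    intro s hs
    simp only [hc]
    rw [projIcc_of_mem ht hs]
    exact hVG' _ (hx₀ρ s hs)
  set A : ℝ → ℂ := fun s => ∫ u in (0 : ℝ)..s, c u with hA
  have hAd : ∀ s, HasDerivAt A (c s) s := fun s =>
    (hcc.integral_hasStrictDerivAt 0 s).hasDerivAt
  have hEd : ∀ s, HasDerivAt (fun s => Complex.exp (-A s)) (Complex.exp (-A s) * -c s) s := fun s =>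
    (hAd s).neg.cexp
  have hEc : Continuous fun s => Complex.exp (-A s) :=
    continuous_iff_continuousAt.2 fun s => (hEd s).continuousAt
  obtain ⟨M, hM⟩ := (isCompact_Icc (a := (0 : ℝ)) (b := t)).exists_bound_of_continuousOn
    hEc.continuousOn
  have hM0 : 0 ≤ M := (norm_nonneg _).trans (hM 0 (left_mem_Icc.2 ht))
  set C := ‖Complex.exp (A t)‖ * (M * (K' * Real.exp (K * t) ^ 2) * t) with hC
  have key : ∀ᶠ z in 𝓝 z₀, ‖X z t - X z₀ t - (z - z₀) • Complex.exp (A t)‖ ≤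
      C * ‖‖z - z₀‖ ^ 2‖ := by
    have e1 : ∀ᶠ z in 𝓝 z₀, ‖z‖ < 1 := (continuous_norm.tendsto z₀).eventually (gt_mem_nhds hz₀)
    have e2 : ∀ᶠ z in 𝓝 z₀, b z₀ / 2 < b z := hbc.eventually (lt_mem_nhds (by linarith))
    filter_upwards [e1, e2] with z hz hbz
    have hxρ := hbd z hz hbz
    have hx := (hX z hz t ht).1
    have hdist : ∀ s ∈ Icc 0 t, ‖X z s - X z₀ s‖ ≤ ‖z - z₀‖ * Real.exp (K * t) := by
      intro s hs
      have := hx.dist_le hV hVG hx₀ hxρ hx₀ρ s hs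
      rw [hX0 z hz, hX0 z₀ hz₀, dist_eq_norm, dist_eq_norm] at this
      refine this.trans ?_
      have := hs.2
      gcongr
    -- Variation of constants: the factor exp(-A) cancels the linear part of the equation for the
    -- difference, leaving a derivative of second order in z - z₀.
    have hη := Convex.norm_image_sub_le_of_norm_hasDerivWithin_le (𝕜 := ℝ)
      (f := fun s => (X z s - X z₀ s) * Complex.exp (-A s))
      (f' := fun s => (G (X z s) - G (X z₀ s)) * Complex.exp (-A s) +
        (X z s - X z₀ s) * (Complex.exp (-A s) * -c s))
      (s := Icc 0 t) (C := M * (K' * (‖z - z₀‖ * Real.exp (K * t)) ^ 2)) (x := 0) (y := t)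
      (fun s hs => ((hx s hs).2.sub (hx₀ s hs).2).mul (hEd s).hasDerivWithinAt)
      (fun s hs => by
        have : (G (X z s) - G (X z₀ s)) * Complex.exp (-A s) +
            (X z s - X z₀ s) * (Complex.exp (-A s) * -c s) = Complex.exp (-A s) *
            (G (X z s) - G (X z₀ s) - deriv G (X z₀ s) * (X z s - X z₀ s)) := by
          rw [hcs s hs]; ring
        rw [this, norm_mul]
        have h1 := norm_taylor_le hG hρ1 hV' hVG' (hx₀ρ s hs) (hxρ s hs)
        have h2 := hdist s hs
        have h3 := hM s hs
        calc _ ≤ M * (K' * ‖X z s - X z₀ s‖ ^ 2) := by gcongr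
          _ ≤ _ := by gcongr) (convex_Icc 0 t) (left_mem_Icc.2 ht) (right_mem_Icc.2 ht)
    have hA0 : A 0 = 0 := by simp [hA]
    simp only [hA0, neg_zero, Complex.exp_zero, mul_one, hX0 z hz, hX0 z₀ hz₀, sub_zero] at hη
    have : X z t - X z₀ t - (z - z₀) • Complex.exp (A t) =
        Complex.exp (A t) * ((X z t - X z₀ t) * Complex.exp (-A t) - (z - z₀)) := by
      have : Complex.exp (A t) * Complex.exp (-A t) = 1 := by rw [← Complex.exp_add]; simp
      rw [smul_eq_mul]
      linear_combination (-(X z t - X z₀ t)) * this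
    rw [this, norm_mul, hC, norm_pow, norm_norm]
    calc _ ≤ ‖Complex.exp (A t)‖ * (M * (K' * (‖z - z₀‖ * Real.exp (K * t)) ^ 2) * ‖t‖) := by gcongr
      _ = _ := by rw [Real.norm_of_nonneg ht]; ring
  have hderiv : HasDerivAt (fun z => X z t) (Complex.exp (A t)) z₀ := by
    rw [hasDerivAt_iff_isLittleO]
    exact (Asymptotics.IsBigO.of_bound C key).trans_isLittleO
      (Asymptotics.isLittleO_pow_sub_sub z₀ one_lt_two)
  exact hderiv.differentiableAt

theorem isHol_coe_of_differentiableOn {F : ℂ → ℂ} (hF : DifferentiableOn ℂ F (ball 0 1)) :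
    IsHol (fun z : 𝔻 => F z) := by
  refine hF.congr fun z hz => ?_
  have hz : ‖z‖ < 1 := by simpa using hz
  simp [hz]

/-- Every vector field in Berkson-Porta form generates a one-parameter semigroup. -/
theorem exists_semigroup {p : ℂ → ℂ} (hp : DifferentiableOn ℂ p (ball 0 1))
    (hre : ∀ z, ‖z‖ < 1 → 0 ≤ (p z).re) (τ : ℂ) :
    ∃ φ : ℝ≥0 → 𝔻 → 𝔻, IsSemigroup φ ∧
      IsGenerator φ (fun z => (τ - z) * (1 - conj τ * z) * p z) := by
  set G : ℂ → ℂ := fun z => (τ - z) * (1 - conj τ * z) * p z with hG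
  have hGd : DifferentiableOn ℂ G (ball 0 1) := by rw [hG]; fun_prop
  have hex : ∀ z : ℂ, ∃ x : ℝ → ℂ, ‖z‖ < 1 → x 0 = z ∧ ∀ T, 0 ≤ T → IsTraj G T x ∧ ∀ t ∈ Icc 0 T,
      (1 - ‖z‖ ^ 2) * Real.exp (-(2 * (‖G z‖ / (1 - ‖z‖ ^ 2)) * T)) ≤ 1 - ‖x t‖ ^ 2 := by
    intro z
    by_cases hz : ‖z‖ < 1
    · obtain ⟨x, hx⟩ := exists_global_traj hp hre τ hG hz
      exact ⟨x, fun _ => hx⟩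
    · exact ⟨0, fun h => absurd h hz⟩
  choose X hX' using hex
  have hX0 : ∀ z, ‖z‖ < 1 → X z 0 = z := fun z hz => (hX' z hz).1
  have hX := fun z hz => (hX' z hz).2
  have hX1 : ∀ z, ‖z‖ < 1 → ∀ t, 0 ≤ t → ‖X z t‖ < 1 := fun z hz t ht =>
    ((hX z hz t ht).1 t (right_mem_Icc.2 ht)).1
  have hder : ∀ z, ‖z‖ < 1 → ∀ t, 0 ≤ t → HasDerivWithinAt (X z) (G (X z t)) (Ici 0) t := by
    intro z hz t ht
    have h := ((hX z hz (t + 1) (by linarith)).1 t ⟨ht, by linarith⟩).2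
    refine h.mono_of_mem_nhdsWithin ?_
    have : Iic (t + 1) ∈ 𝓝 t := Iic_mem_nhds (by linarith)
    rw [← Ici_inter_Iic]
    exact inter_mem self_mem_nhdsWithin (nhdsWithin_le_nhds this)
  let φ : ℝ≥0 → 𝔻 → 𝔻 := fun t z => Complex.UnitDisc.mk (X z t) (hX1 z z.norm_lt_one t t.2)
  have hφ : ∀ t z, (φ t z : ℂ) = X z t := fun t z => rfl
  refine ⟨φ, ⟨fun t => ?_, fun z => ?_, fun s t z => ?_, fun z => ?_⟩, ?_, fun z t => ?_⟩
  · refine isHol_coe_of_differentiableOn (F := fun z => X z t) fun z hz => ?_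
    exact (differentiableAt_flow hGd hX0 hX t.2 (by simpa using hz)).differentiableWithinAt
  · rw [← Complex.UnitDisc.coe_inj, hφ]
    exact hX0 z z.norm_lt_one
  · rw [← Complex.UnitDisc.coe_inj, hφ, hφ, hφ]
    have hw := hX1 z z.norm_lt_one t t.2
    -- The semigroup law: by autonomy the time shift is again a trajectory, starting at X z t, and
    -- uniqueness applies.
    have h1 : IsTraj G s (fun u => X z (u + t)) := by
      intro u hu
      refine ⟨hX1 z z.norm_lt_one _ (add_nonneg hu.1 t.2), ?_⟩
      have h := hder z z.norm_lt_one (u + t) (add_nonneg hu.1 t.2)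
      have h2 : HasDerivWithinAt (fun u : ℝ => u + (t : ℝ)) 1 (Icc 0 (s : ℝ)) u :=
        (hasDerivAt_id u).add_const _ |>.hasDerivWithinAt
      have := h.scomp u h2 (fun v hv => add_nonneg hv.1 t.2)
      simpa using! this
    have := h1.eqOn hGd (hX (X z t) hw s s.2).1 (by simp [hX0 _ hw]) (right_mem_Icc.2 s.2)
    simpa using this
  · rw [Complex.UnitDisc.isEmbedding_coe.tendsto_nhds_iff]
    have hc : ContinuousWithinAt (X z) (Ici 0) 0 :=
      (hder z z.norm_lt_one 0 le_rfl).continuousWithinAt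
    have h0 := hX0 z z.norm_lt_one
    have h1 : Tendsto (X z) (𝓝[≥] 0) (𝓝 z) := by
      have := hc.tendsto
      rwa [h0] at this
    refine h1.comp (tendsto_nhdsWithin_iff.2 ⟨?_, Eventually.of_forall fun t => t.2⟩)
    exact (NNReal.continuous_coe.tendsto 0).mono_left nhdsWithin_le_nhds
  · exact isHol_coe_of_differentiableOn hGd
  · have h := hder z z.norm_lt_one t t.2
    have e : ∀ s ∈ Ici (0 : ℝ), (φ s.toNNReal z : ℂ) = X z s := fun s hs => by
      rw [hφ, Real.coe_toNNReal s hs]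
    exact h.congr e (e t t.2)

/-! ### Julia's inequality for self-maps and the Berkson--Porta representation. -/

theorem IsHol.exists_ext {f : 𝔻 → ℂ} (hf : IsHol f) :
    ∃ F : ℂ → ℂ, DifferentiableOn ℂ F (ball 0 1) ∧ ∀ z : 𝔻, F z = f z :=
  ⟨_, hf, fun z => by simp [z.norm_lt_one]⟩

theorem cayley_re_pos {σ : ℂ} (hσ : ‖σ‖ = 1) {z : ℂ} (hz : ‖z‖ < 1) :
    0 < ((σ + z) / (σ - z)).re := by
  rw [re_cayley hσ]
  have := norm_pos_iff.2 (ne_of_norm_lt_one hσ hz)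
  have : 0 < 1 - ‖z‖ ^ 2 := by nlinarith [norm_nonneg z]
  positivity

theorem ne_zero_of_norm_eq_one {σ : ℂ} (hσ : ‖σ‖ = 1) : σ ≠ 0 := by
  rintro rfl
  simp at hσ

/-- The mass at a boundary point of the Cayley transform of a self-map of the disc. -/
theorem exists_mass_cayley {f : 𝔻 → 𝔻} (hf : IsHol fun z => (f z : ℂ)) {σ : ℂ} (hσ : ‖σ‖ = 1) {c : ℝ}
    (hc : ∀ z : 𝔻, c * ((σ + z) / (σ - z) : ℂ).re ≤ ((σ + f z) / (σ - f z) : ℂ).re) :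
    ∃ β : ℝ, c ≤ β ∧ (∀ z : 𝔻, β * ((σ + z) / (σ - z) : ℂ).re ≤ ((σ + f z) / (σ - f z) : ℂ).re) ∧
      HasAngularLimit (fun z => (σ - z) * ((σ + f z) / (σ - f z))) σ (2 * σ * β) := by
  obtain ⟨F, hF, hFf⟩ := hf.exists_ext
  have hF1 : ∀ z, ‖z‖ < 1 → ‖F z‖ < 1 := fun z hz => by
    have := hFf (Complex.UnitDisc.mk z hz)
    rw [Complex.UnitDisc.coe_mk] at this
    rw [this]
    exact (f _).norm_lt_one
  -- Subtracting c times the kernel beforehand leaves a nonnegative remaining mass, hence a total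
  -- mass of at least c.
  obtain ⟨β, hβ0, hβ, hl⟩ := julia_wolff
    (p := fun z => (σ + F z) / (σ - F z) - c * ((σ + z) / (σ - z)))
    ((DifferentiableOn.div (by fun_prop) (by fun_prop) fun z hz =>
      ne_of_norm_lt_one hσ (hF1 z (by simpa using hz))).sub
      ((differentiableOn_cayley hσ).const_mul _))
    (fun z hz => by
      have h1 := hc (Complex.UnitDisc.mk z hz)
      have h2 := hFf (Complex.UnitDisc.mk z hz)
      rw [Complex.UnitDisc.coe_mk] at h1 h2
      rw [← h2] at h1
      rw [Complex.sub_re, Complex.re_ofReal_mul]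
      linarith) hσ
  refine ⟨β + c, by linarith, fun z => ?_, ?_⟩
  · have := hβ z z.norm_lt_one
    rw [Complex.sub_re, Complex.re_ofReal_mul, hFf] at this
    linarith
  · have h2 : HasAngularLimit (fun z => c * (σ + z)) σ (c * (σ + σ)) :=
      HasAngularLimit.of_continuousAt (F := fun z => c * (σ + z)) (by fun_prop)
    refine ((hl.add h2).congr fun z => ?_).congr_lim (by push_cast; ring)
    have := ne_of_norm_lt_one hσ z.norm_lt_one
    rw [hFf]
    field_simp
    ring

/-- Julia's inequality implies that the boundary point is a boundary regular fixed point. -/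
theorem brfp_of_julia {f : 𝔻 → 𝔻} (hf : IsHol fun z => (f z : ℂ)) {σ : ℂ} (hσ : ‖σ‖ = 1) {c : ℝ}
    (hc0 : 0 < c)
    (hc : ∀ z : 𝔻, c * ((σ + z) / (σ - z) : ℂ).re ≤ ((σ + f z) / (σ - f z) : ℂ).re) :
    IsBoundaryFixedPoint f σ ∧ ∃ d : ℝ, d ≤ 1 / c ∧ HasAngularDerivAt f σ d := by
  obtain ⟨β, hcβ, -, hl⟩ := exists_mass_cayley hf hσ hc
  have hσ0 := ne_zero_of_norm_eq_one hσ
  have hβ : 0 < β := hc0.trans_le hcβ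
  have hβ' : (β : ℂ) ≠ 0 := by exact_mod_cast hβ.ne'
  have hlim0 : 2 * σ * (β : ℂ) ≠ 0 := mul_ne_zero (mul_ne_zero two_ne_zero hσ0) hβ'
  have hplus : ∀ z : 𝔻, σ + f z ≠ 0 := fun z => by
    have := ne_of_norm_lt_one hσ (z := -(f z : ℂ)) (by simpa using (f z).norm_lt_one)
    simpa using this
  have hz0 : HasAngularLimit (fun z => σ - z) σ (σ - σ) :=
    HasAngularLimit.of_continuousAt (F := fun z => σ - z) (by fun_prop)
  -- The quotient is σ - z divided by (σ-z)(σ+f)/(σ-f), and the latter has the nonzero limit 2σβ.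
  -- Inverting the Cayley transform then gives f → σ.
  have hQ : HasAngularLimit (fun z => (σ - f z) / (σ + f z)) σ 0 := by
    refine ((hz0.div hl hlim0).congr fun z => ?_).congr_lim (by simp)
    have h1 := ne_of_norm_lt_one hσ z.norm_lt_one
    have h2 := ne_of_norm_lt_one hσ (f z).norm_lt_one
    have h3 := hplus z
    field_simp
  have hfix : HasAngularLimit (fun z => (f z : ℂ)) σ σ := by
    refine (((HasAngularLimit.const σ).mul ((HasAngularLimit.const 1).sub hQ)).div
      ((HasAngularLimit.const 1).add hQ) (by simp)).congr (fun z => ?_) |>.congr_lim (by simp)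
    have h3 := hplus z
    have e1 : 1 - (σ - f z) / (σ + f z) = 2 * f z / (σ + f z) := by field_simp; ring
    have e2 : 1 + (σ - f z) / (σ + f z) = 2 * σ / (σ + f z) := by field_simp; ring
    rw [e1, e2]
    field_simp
  refine ⟨⟨hσ, hfix⟩, 1 / β, by gcongr, ?_⟩
  refine ((((HasAngularLimit.const σ).add hfix).div hl hlim0).congr fun z => ?_).congr_lim ?_
  · have h1 := ne_of_norm_lt_one hσ z.norm_lt_one
    have h1' : (z : ℂ) - σ ≠ 0 := by rw [← neg_sub]; exact neg_ne_zero.2 h1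
    have h2 := ne_of_norm_lt_one hσ (f z).norm_lt_one
    have h3 := hplus z
    rw [← neg_sub σ (f z : ℂ), ← neg_sub σ (z : ℂ), neg_div_neg_eq]
    field_simp
  · push_cast
    field_simp
    norm_num

/-- Julia's inequality at a boundary fixed point with real angular derivative at most one. -/
theorem julia_of_deriv_le_one {f : 𝔻 → 𝔻} (hf : IsHol fun z => (f z : ℂ)) {τ : ℂ}
    (hfix : IsBoundaryFixedPoint f τ) {d : ℝ} (hd1 : d ≤ 1) (hd : HasAngularDerivAt f τ d) (z : 𝔻) :
    ((τ + z) / (τ - z) : ℂ).re ≤ ((τ + f z) / (τ - f z) : ℂ).re := by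
  have hτ := hfix.1
  have hτ0 := ne_zero_of_norm_eq_one hτ
  obtain ⟨β, hβ0, hβ, hl⟩ := exists_mass_cayley hf hτ (c := 0) fun z => by
    simpa using (cayley_re_pos hτ (f z).norm_lt_one).le
  -- Mass times difference quotient telescopes to τ + f, whose limit is 2τ; hence βd = 1, and d ≤ 1
  -- gives β ≥ 1.
  have h : HasAngularLimit (fun z => τ + f z) τ (2 * τ * β * d) := by
    refine (hl.mul hd).congr fun z => ?_
    have h1 := ne_of_norm_lt_one hτ z.norm_lt_one
    have h1' : (z : ℂ) - τ ≠ 0 := by rw [← neg_sub]; exact neg_ne_zero.2 h1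
    have h2 := ne_of_norm_lt_one hτ (f z).norm_lt_one
    rw [← neg_sub τ (f z : ℂ), ← neg_sub τ (z : ℂ), neg_div_neg_eq]
    field_simp
  have h2 := h.unique hτ ((HasAngularLimit.const τ).add hfix.2)
  have h3 : (β : ℂ) * d = 1 := by
    have : 2 * τ * ((β : ℂ) * d) = 2 * τ * 1 := by linear_combination h2
    exact mul_left_cancel₀ (mul_ne_zero two_ne_zero hτ0) this
  have h4 : β * d = 1 := by exact_mod_cast h3
  have h5 : 1 ≤ β := by nlinarith
  have h6 := hβ z
  have h7 := cayley_re_pos hτ z.norm_lt_one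
  nlinarith

theorem IsHol.comp_ext {f : 𝔻 → 𝔻} {F : ℂ → ℂ} (hFf : ∀ z : 𝔻, F z = f z) :
    ∀ z, ‖z‖ < 1 → ‖F z‖ < 1 := fun z hz => by
  have := hFf (Complex.UnitDisc.mk z hz)
  rw [Complex.UnitDisc.coe_mk] at this
  rw [this]
  exact (f _).norm_lt_one

theorem deriv_nonneg_of_min_left {g : ℝ → ℝ} {g' : ℝ} (h : HasDerivWithinAt g g' (Ici 0) 0)
    (hmin : ∀ t, 0 ≤ t → g 0 ≤ g t) : 0 ≤ g' := by
  have h1 := hasDerivWithinAt_iff_tendsto_slope.1 h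
  have h2 : (𝓝[Ici (0 : ℝ) \ {0}] 0).NeBot := by
    rw [Ici_sdiff_left]
    infer_instance
  refine ge_of_tendsto h1 (eventually_nhdsWithin_of_forall fun t ht => ?_)
  have ht0 : 0 ≤ t := ht.1
  rw [slope_def_field]
  exact div_nonneg (sub_nonneg.2 (hmin t ht0)) (by simpa using ht0)

theorem IsGenerator.hasDerivWithinAt_zero {φ : ℝ≥0 → 𝔻 → 𝔻} {G : 𝔻 → ℂ} (hφ : IsSemigroup φ)
    (hG : IsGenerator φ G) (z : 𝔻) :
    HasDerivWithinAt (fun s : ℝ => (φ s.toNNReal z : ℂ)) (G z) (Ici 0) 0 := by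
  have := hG.2 z 0
  rwa [hφ.zero, NNReal.coe_zero] at this

theorem hasDerivWithinAt_cayley {σ : ℂ} {x : ℝ → ℂ} {d : ℂ} {s : Set ℝ} {t : ℝ}
    (h : HasDerivWithinAt x d s t) (h0 : σ - x t ≠ 0) :
    HasDerivWithinAt (fun t => ((σ + x t) / (σ - x t)).re) (2 * σ * d / (σ - x t) ^ 2).re s t := by
  have h1 := (h.const_add σ).div (h.const_sub σ) h0
  have h2 := Complex.reCLM.hasFDerivAt.comp_hasDerivWithinAt t h1
  refine h2.congr_deriv ?_
  simp only [Complex.reCLM_apply]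
  congr 2
  ring

/-- The Berkson-Porta representation of generators with given Denjoy-Wolff point. -/
theorem exists_berkson_porta {φ : ℝ≥0 → 𝔻 → 𝔻} {G : 𝔻 → ℂ} (hφ : IsSemigroup φ)
    (hG : IsGenerator φ G) {τ : ℂ} (hτ : ‖τ‖ ≤ 1) (hDW : HasDWPoint φ τ) :
    ∃ p : ℂ → ℂ, DifferentiableOn ℂ p (ball 0 1) ∧ (∀ z, ‖z‖ < 1 → 0 ≤ (p z).re) ∧
      ∀ z : 𝔻, G z = (τ - z) * (1 - conj τ * z) * p z := by
  obtain ⟨F, hF, hFG⟩ := hG.1.exists_ext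
  rcases hτ.lt_or_eq with hτ1 | hτ1
  · set w : 𝔻 := Complex.UnitDisc.mk τ hτ1 with hw
    have hwτ : (w : ℂ) = τ := rfl
    have hfix : ∀ t, φ t w = w := by
      intro t
      by_cases hid : φ t = id
      · rw [hid]; rfl
      · rcases hDW t hid with ⟨w', hw', h⟩ | ⟨-, h, -⟩
        · rwa [show w' = w from Complex.UnitDisc.coe_injective (hw'.trans hwτ.symm)] at h
        · exact absurd h.1 hτ1.ne
    have hFτ : F τ = 0 := by
      have h1 := hG.hasDerivWithinAt_zero hφ w
      simp only [hfix] at h1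
      have h2 := (uniqueDiffOn_Ici (0 : ℝ) 0 self_mem_Ici).eq_deriv _ h1 (hasDerivWithinAt_const _ _ _)
      rw [← hwτ, hFG, h2]
    have hτn : ball (0 : ℂ) 1 ∈ 𝓝 τ := isOpen_ball.mem_nhds (by simpa using hτ1)
    have hds : DifferentiableOn ℂ (dslope F τ) (ball 0 1) :=
      (Complex.differentiableOn_dslope hτn).2 hF
    have hB0 : ∀ z, ‖z‖ < 1 → 1 - conj τ * z ≠ 0 := fun z hz => one_sub_mul_conj_ne_zero hz hτ
    set p : ℂ → ℂ := fun z => -dslope F τ z / (1 - conj τ * z) with hp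
    have hpd : DifferentiableOn ℂ p (ball 0 1) :=
      DifferentiableOn.div hds.neg (by fun_prop) fun z hz => hB0 z (by simpa using hz)
    have hFp : ∀ z, ‖z‖ < 1 → F z = (τ - z) * (1 - conj τ * z) * p z := by
      intro z hz
      have h1 := sub_smul_dslope F τ z
      rw [hFτ, smul_eq_mul, sub_zero] at h1
      have := hB0 z hz
      have h2 : (1 - conj τ * z) * p z = -dslope F τ z := by rw [hp, mul_div_cancel₀ _ this]
      rw [← h1]
      linear_combination (z - τ) * h2
    refine ⟨p, hpd, ?_, fun z => by rw [← hFG, hFp z z.norm_lt_one]⟩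
    have hne : ∀ z, ‖z‖ < 1 → z ≠ τ → 0 ≤ (p z).re := by
      intro z hz hzτ
      set z' : 𝔻 := Complex.UnitDisc.mk z hz
      have hzz : (z' : ℂ) = z := rfl
      have hd := hG.hasDerivWithinAt_zero hφ z'
      rw [← hFG, hzz, hFp z hz] at hd
      set A := ‖z - τ‖ ^ 2 with hA
      set B := ‖1 - conj τ * z‖ ^ 2 with hB
      have hA0 : 0 < A := by
        have := norm_pos_iff.2 (sub_ne_zero.2 hzτ); positivity
      have hB0' : 0 < B := by
        have := norm_pos_iff.2 (hB0 z hz); positivity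
      have h1 := (hd.sub_const τ).norm_sq
      have h2 := ((hd.const_mul (conj τ)).const_sub 1).norm_sq
      have h3 := (h2.const_mul A).sub (h1.const_mul B)
      have hz0 : (φ (Real.toNNReal 0) z' : ℂ) = z := by rw [Real.toNNReal_zero, hφ.zero, hzz]
      -- By Schwarz--Pick at the fixed point τ, the function A|1-conj τ φ_t|² - B|φ_t-τ|² is
      -- nonnegative and vanishes at t = 0. Its derivative there is a positive multiple of Re p.
      have h4 := deriv_nonneg_of_min_left h3 fun t ht => by
        simp only [hz0, Pi.sub_apply]
        obtain ⟨f, hf, hff⟩ := (hφ.hol t.toNNReal).exists_ext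
        have h5 := norm_mul_le_of_fixed hf (IsHol.comp_ext hff) hτ1 (by
          rw [← hwτ, hff, hfix]) hz
        rw [← hzz, hff, hzz] at h5
        have h6 := pow_le_pow_left₀ (by positivity) h5 2
        rw [mul_pow, mul_pow] at h6
        rw [← hA, ← hB] at h6 ⊢
        linarith
      simp only [hz0, Complex.inner] at h4
      have eA : (A : ℂ) = (z - τ) * conj (z - τ) := by
        rw [Complex.mul_conj, Complex.normSq_eq_norm_sq]
      have eB : (B : ℂ) = (1 - conj τ * z) * conj (1 - conj τ * z) := by
        rw [Complex.mul_conj, Complex.normSq_eq_norm_sq]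
      have eT : ((1 - ‖τ‖ ^ 2 : ℝ) : ℂ) = 1 - τ * conj τ := by
        rw [Complex.mul_conj, Complex.normSq_eq_norm_sq]; push_cast; ring
      have e3 : (A : ℂ) * (-(conj τ * ((τ - z) * (1 - conj τ * z) * p z)) * conj (1 - conj τ * z)) -
          (B : ℂ) * ((τ - z) * (1 - conj τ * z) * p z * conj (z - τ)) =
          ((A * B * (1 - ‖τ‖ ^ 2) : ℝ) : ℂ) * p z := by
        rw [Complex.ofReal_mul, Complex.ofReal_mul, eT, eA, eB]
        ring
      have e4 := congrArg Complex.re e3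
      rw [Complex.sub_re, Complex.re_ofReal_mul, Complex.re_ofReal_mul, Complex.re_ofReal_mul] at e4
      have h7 : 0 ≤ A * B * (1 - ‖τ‖ ^ 2) * (p z).re := by linarith
      have h8 : 0 < A * B * (1 - ‖τ‖ ^ 2) := by
        have : 0 < 1 - ‖τ‖ ^ 2 := by nlinarith [norm_nonneg τ]
        positivity
      exact nonneg_of_mul_nonneg_right h7 h8
    intro z hz
    by_cases hzτ : z = τ
    · have hc : ContinuousAt (fun z => (p z).re) τ :=
        Complex.continuous_re.continuousAt.comp (hpd.continuousOn.continuousAt hτn)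
      rw [hzτ]
      refine ge_of_tendsto (hc.tendsto.mono_left (nhdsWithin_le_nhds (s := {τ}ᶜ))) ?_
      filter_upwards [self_mem_nhdsWithin, nhdsWithin_le_nhds hτn] with u hu hu1
      exact hne u (by simpa using hu1) hu
    · exact hne z hz hzτ
  · have hτ0 := ne_zero_of_norm_eq_one hτ1
    have hn := fun z hz => ne_of_norm_lt_one hτ1 (z := z) hz
    have hττ : τ * conj τ = 1 := by
      rw [Complex.mul_conj, Complex.normSq_eq_norm_sq, hτ1]; norm_num
    -- For |τ| = 1 one has 1-conj τ z = conj τ (τ-z), which dictates this p.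
    refine ⟨fun z => τ * F z / (τ - z) ^ 2, ?_, ?_, fun z => ?_⟩
    · exact DifferentiableOn.div (by fun_prop) (by fun_prop) fun z hz =>
        pow_ne_zero 2 (hn z (by simpa using hz))
    · intro z hz
      set z' : 𝔻 := Complex.UnitDisc.mk z hz
      have hzz : (z' : ℂ) = z := rfl
      have hd := hG.hasDerivWithinAt_zero hφ z'
      rw [← hFG, hzz] at hd
      have hz0 : (φ (Real.toNNReal 0) z' : ℂ) = z := by rw [Real.toNNReal_zero, hφ.zero, hzz]
      have h1 := hasDerivWithinAt_cayley (σ := τ) hd (by rw [hz0]; exact hn z hz)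
      -- Julia's inequality keeps the Poisson kernel at τ from falling below its initial value; its
      -- derivative at time 0 is 2 Re p.
      have h2 := deriv_nonneg_of_min_left h1 fun t ht => by
        rw [hz0]
        by_cases hid : φ t.toNNReal = id
        · rw [hid]; rfl
        · rcases hDW _ hid with ⟨w', hw', h⟩ | ⟨-, h, d, hd1, hd⟩
          · have := w'.norm_lt_one
            rw [hw', hτ1] at this
            exact absurd this (lt_irrefl 1)
          · exact julia_of_deriv_le_one (hφ.hol _) h hd1 hd z'
      rw [hz0] at h2
      have e : 2 * τ * F z / (τ - z) ^ 2 = ((2 : ℝ) : ℂ) * (τ * F z / (τ - z) ^ 2) := by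
        push_cast; ring
      rw [e, Complex.re_ofReal_mul] at h2
      linarith
    · have h1 := hn z z.norm_lt_one
      have e : 1 - conj τ * z = conj τ * (τ - z) := by linear_combination -hττ
      rw [← hFG, e]
      field_simp
      linear_combination (-F z) * hττ

/-! ### Spectral values, masses of 1/p, and membership in the class. -/

/-- The value of the regularised Berkson-Porta factor at a boundary point. -/
theorem sub_mul_one_sub_conj_mul {σ : ℂ} (hσ : ‖σ‖ = 1) (τ : ℂ) :
    (τ - σ) * (1 - conj τ * σ) = -(σ * (‖τ - σ‖ ^ 2 : ℝ)) := by
  have h1 : σ * conj σ = 1 := by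
    rw [Complex.mul_conj, Complex.normSq_eq_norm_sq, hσ]; norm_num
  have h2 : ((‖τ - σ‖ ^ 2 : ℝ) : ℂ) = (τ - σ) * conj (τ - σ) := by
    rw [Complex.mul_conj, Complex.normSq_eq_norm_sq]
  rw [h2, map_sub]
  linear_combination (σ - τ) * h1

theorem factor_ne_zero {σ : ℂ} (hσ : ‖σ‖ = 1) {τ : ℂ} (hτσ : τ ≠ σ) :
    (τ - σ) * (1 - conj τ * σ) ≠ 0 := by
  rw [sub_mul_one_sub_conj_mul hσ]
  have := norm_pos_iff.2 (sub_ne_zero.2 hτσ)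
  refine neg_ne_zero.2 (mul_ne_zero (ne_zero_of_norm_eq_one hσ) ?_)
  exact_mod_cast (by positivity : ‖τ - σ‖ ^ 2 ≠ 0)

theorem factor_ne_zero_of_mem {τ : ℂ} (hτ : ‖τ‖ ≤ 1) {z : ℂ} (hz : ‖z‖ < 1) (hzτ : z ≠ τ) :
    (τ - z) * (1 - conj τ * z) ≠ 0 :=
  mul_ne_zero (sub_ne_zero.2 hzτ.symm) (one_sub_mul_conj_ne_zero hz hτ)

theorem continuousAt_factor (τ σ : ℂ) : ContinuousAt (fun z => (τ - z) * (1 - conj τ * z)) σ := by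
  fun_prop

/-- Passing from the spectral value to the limit of the Berkson-Porta factor. -/
theorem hasAngularLimit_div_of_spectral {τ σ : ℂ} (hτ : ‖τ‖ ≤ 1) (hσ : ‖σ‖ = 1) (hτσ : τ ≠ σ)
    {p : ℂ → ℂ} {l : ℝ}
    (h : HasSpectralValue (fun z : 𝔻 => (τ - z) * (1 - conj τ * z) * p z) σ l) :
    HasAngularLimit (fun z => p z / (σ - z)) σ (l / ((τ - σ) * (1 - conj τ * σ))) := by
  intro M hM
  have h1 := (HasAngularLimit.div h (HasAngularLimit.of_continuousAt (continuousAt_factor τ σ))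
    (factor_ne_zero hσ hτσ)) M hM
  refine h1.congr' ?_
  have hcoe : Tendsto (fun z : 𝔻 => (z : ℂ))
      (comap (fun z : 𝔻 => (z : ℂ)) (𝓝 σ) ⊓ 𝓟 (stolzAngle σ M)) (𝓝 σ) :=
    tendsto_comap.mono_left inf_le_left
  -- The quadratic factor vanishes at τ when τ is interior, but points close to σ avoid τ.
  filter_upwards [hcoe.eventually (isOpen_ne.mem_nhds hτσ.symm)] with z hz
  have h2 := factor_ne_zero_of_mem hτ z.norm_lt_one hz
  have h4 := ne_of_norm_lt_one hσ z.norm_lt_one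
  rw [div_div, mul_comm (σ - (z : ℂ)), ← div_div, mul_div_cancel_left₀ _ h2]

theorem hasSpectralValue_of_div {τ σ : ℂ} {p : ℂ → ℂ} {l : ℝ} (hσ : ‖σ‖ = 1) (hτσ : τ ≠ σ)
    (h : HasAngularLimit (fun z => p z / (σ - z)) σ (l / ((τ - σ) * (1 - conj τ * σ)))) :
    HasSpectralValue (fun z : 𝔻 => (τ - z) * (1 - conj τ * z) * p z) σ l := by
  refine ((HasAngularLimit.of_continuousAt (continuousAt_factor τ σ)).mul h).congr (fun z => ?_)
    |>.congr_lim ?_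
  · rw [mul_div_assoc]
  · rw [mul_div_cancel₀ _ (factor_ne_zero hσ hτσ)]

/-- The mass of the reciprocal of the Berkson-Porta factor in terms of the spectral value. -/
theorem mass_of_spectral {τ σ : ℂ} (hτ : ‖τ‖ ≤ 1) (hσ : ‖σ‖ = 1) (hτσ : τ ≠ σ) {p : ℂ → ℂ} {l : ℝ}
    (hl : l < 0) (h : HasSpectralValue (fun z : 𝔻 => (τ - z) * (1 - conj τ * z) * p z) σ l) :
    HasAngularLimit (fun z => (σ - z) * (p z)⁻¹) σ (2 * σ * (‖τ - σ‖ ^ 2 / (2 * |l|) : ℝ)) := by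
  have h1 := hasAngularLimit_div_of_spectral hτ hσ hτσ h
  have hl0 : (l : ℂ) ≠ 0 := by exact_mod_cast hl.ne
  refine (((HasAngularLimit.const 1).div h1
    (div_ne_zero hl0 (factor_ne_zero hσ hτσ))).congr fun z => ?_).congr_lim ?_
  · rw [one_div, inv_div, div_eq_mul_inv]
  · rw [abs_of_neg hl, sub_mul_one_sub_conj_mul hσ]
    push_cast
    have : (‖τ - σ‖ : ℂ) ≠ 0 := by
      exact_mod_cast (norm_pos_iff.2 (sub_ne_zero.2 hτσ)).ne'
    have := ne_zero_of_norm_eq_one hσ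
    field_simp

/-- An algebraic inequality in the right half-plane model. -/
theorem re_half_plane_ge {ω w p : ℂ} {α : ℝ} (hα : 0 < α) (hw : 0 ≤ w.re)
    (hp : α * w.re * ‖p‖ ^ 2 ≤ p.re) : -(w.re / α) ≤ ((ω - w) * (w + conj ω) * p).re := by
  have hpre : 0 ≤ p.re := le_trans (by positivity) hp
  rw [Complex.sq_norm, Complex.normSq_apply] at hp
  simp only [Complex.mul_re, Complex.mul_im, Complex.sub_re, Complex.sub_im, Complex.add_re,
    Complex.add_im, Complex.conj_re, Complex.conj_im]
  set x := w.re
  set s := w.im - ω.im with hs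
  set a := p.re
  set b := p.im
  have hs2 : w.im = s + ω.im := by rw [hs]; ring
  rw [hs2, neg_le_iff_add_nonneg]
  -- Completing squares: every summand on the left is nonnegative, the middle one by the mass
  -- hypothesis `hp`.
  have key : x / α * ((α * (x * a - s * b) - 1) ^ 2 + (α * (x * b + s * a)) ^ 2) +
      (x ^ 2 + s ^ 2) * (a - α * x * (a * a + b * b)) + ω.re ^ 2 * a =
      ((ω.re - x) * (x + ω.re) - (ω.im - (s + ω.im)) * (s + ω.im + -ω.im)) * a -
      ((ω.re - x) * (s + ω.im + -ω.im) + (ω.im - (s + ω.im)) * (x + ω.re)) * b + x / α := by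
    field_simp
    ring
  rw [← key]
  have : 0 ≤ a - α * x * (a * a + b * b) := by linarith
  positivity

/-- The vector field seen from a boundary point at which the reciprocal of the Berkson-Porta factor
has positive mass. -/
theorem re_cayley_field_ge {τ σ : ℂ} (hσ : ‖σ‖ = 1) (hτσ : τ ≠ σ) {z p : ℂ}
    (hz : ‖z‖ < 1) {α : ℝ} (hα : 0 < α) (hp : 0 < p.re)
    (hm : α * ((σ + z) / (σ - z)).re ≤ (p⁻¹).re) :
    -(‖τ - σ‖ ^ 2 / (2 * α)) * ((σ + z) / (σ - z)).re ≤
      (2 * σ * ((τ - z) * (1 - conj τ * z) * p) / (σ - z) ^ 2).re := by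
  have hw := cayley_re_pos hσ hz
  have hp0 : p ≠ 0 := by rintro rfl; simp at hp
  have hN : 0 < ‖p‖ ^ 2 := by have := norm_pos_iff.2 hp0; positivity
  have hm2 : α * ((σ + z) / (σ - z)).re * ‖p‖ ^ 2 ≤ p.re := by
    rw [Complex.inv_re, Complex.normSq_eq_norm_sq, le_div_iff₀ hN] at hm
    exact hm
  -- The Cayley transform at σ carries z to w and τ to ω, and the quadratic factor becomes
  -- (ω-w)(w+conj ω) up to a positive constant.
  have h1 := re_half_plane_ge (ω := (σ + τ) / (σ - τ)) hα hw.le hm2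
  have hσz := ne_of_norm_lt_one hσ hz
  have hσσ : σ * conj σ = 1 := by
    rw [Complex.mul_conj, Complex.normSq_eq_norm_sq, hσ]; norm_num
  have hστ : σ - τ ≠ 0 := sub_ne_zero.2 hτσ.symm
  have hσ0 := ne_zero_of_norm_eq_one hσ
  have hcτ : conj σ - conj τ ≠ 0 := by rw [← map_sub]; exact (map_ne_zero _).2 hστ
  have hN2 : ((‖τ - σ‖ ^ 2 / 2 : ℝ) : ℂ) = (σ - τ) * (conj σ - conj τ) / 2 := by
    have := Complex.mul_conj (σ - τ)
    rw [Complex.normSq_eq_norm_sq, map_sub, norm_sub_rev] at this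
    rw [this]
    push_cast
    ring
  have e : 2 * σ * ((τ - z) * (1 - conj τ * z) * p) / (σ - z) ^ 2 = ((‖τ - σ‖ ^ 2 / 2 : ℝ) : ℂ) *
      (((σ + τ) / (σ - τ) - (σ + z) / (σ - z)) *
        ((σ + z) / (σ - z) + conj ((σ + τ) / (σ - τ))) * p) := by
    have e1 : (σ + τ) / (σ - τ) - (σ + z) / (σ - z) = 2 * σ * (τ - z) / ((σ - τ) * (σ - z)) := by
      field_simp
      ring
    have e2 : (σ + z) / (σ - z) + conj ((σ + τ) / (σ - τ)) =
        2 * (1 - conj τ * z) / ((σ - z) * (conj σ - conj τ)) := by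
      rw [map_div₀, map_add, map_sub, div_add_div _ _ hσz hcτ]
      congr 1
      linear_combination 2 * hσσ
    rw [e1, e2, hN2]
    field_simp
  rw [e, Complex.re_ofReal_mul]
  calc -(‖τ - σ‖ ^ 2 / (2 * α)) * ((σ + z) / (σ - z)).re
      = (‖τ - σ‖ ^ 2 / 2) * -(((σ + z) / (σ - z)).re / α) := by field_simp
    _ ≤ _ := by gcongr

theorem IsGenerator.hasDerivWithinAt {φ : ℝ≥0 → 𝔻 → 𝔻} {G : 𝔻 → ℂ}
    (hG : IsGenerator φ G) (z : 𝔻) {t : ℝ} (ht : 0 ≤ t) :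
    HasDerivWithinAt (fun s : ℝ => (φ s.toNNReal z : ℂ)) (G (φ t.toNNReal z)) (Ici 0) t := by
  have := hG.2 z t.toNNReal
  rwa [Real.coe_toNNReal t ht] at this

/-- Integrated form of a differential inequality at a boundary point. -/
theorem julia_of_generator {φ : ℝ≥0 → 𝔻 → 𝔻} {G : 𝔻 → ℂ} (hφ : IsSemigroup φ)
    (hG : IsGenerator φ G) {σ : ℂ} (hσ : ‖σ‖ = 1) {C : ℝ}
    (hC : ∀ z : 𝔻, -C * ((σ + z) / (σ - z) : ℂ).re ≤ (2 * σ * G z / (σ - z) ^ 2).re)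
    (t : ℝ≥0) (z : 𝔻) :
    Real.exp (-(C * t)) * ((σ + z) / (σ - z) : ℂ).re ≤ ((σ + φ t z) / (σ - φ t z) : ℂ).re := by
  -- The integrating factor exp(Cs) turns the differential inequality into monotonicity.
  have hd : ∀ s ∈ Ici (0 : ℝ), HasDerivWithinAt
      (fun s : ℝ => ((σ + φ s.toNNReal z) / (σ - φ s.toNNReal z) : ℂ).re * Real.exp (C * s)) _
      (Ici 0) s := fun s hs =>
    (hasDerivWithinAt_cayley (hG.hasDerivWithinAt z hs)
      (ne_of_norm_lt_one hσ (φ s.toNNReal z).norm_lt_one)).mul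
      (((hasDerivAt_id s).const_mul C).exp.hasDerivWithinAt)
  have hmono := monotoneOn_of_hasDerivWithinAt_nonneg (convex_Ici 0)
    (fun s hs => (hd s hs).continuousWithinAt)
    (fun s hs => (hd s (interior_subset hs)).mono interior_subset) fun s hs => by
      have h1 := hC (φ s.toNNReal z)
      have h2 := Real.exp_pos (C * s)
      simp only [id, mul_one]
      nlinarith
  have h := hmono self_mem_Ici (show (t : ℝ) ∈ Ici 0 from t.2) t.2
  simp only [Real.toNNReal_zero, hφ.zero, Real.toNNReal_coe, mul_zero, Real.exp_zero, mul_one] at h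
  rw [Real.exp_neg, mul_comm, ← div_eq_mul_inv, div_le_iff₀ (Real.exp_pos _)]
  exact h

/-- An interior τ is an equilibrium, so uniqueness of trajectories fixes it. For |τ| = 1 the Poisson
kernel at τ grows along trajectories at rate 2 Re p > 0: this gives Julia's inequality with constant
1, and its strictness excludes interior fixed points. -/
theorem hasDWPoint_of_berkson_porta {φ : ℝ≥0 → 𝔻 → 𝔻} {p : ℂ → ℂ}
    (hp : DifferentiableOn ℂ p (ball 0 1)) (hre : ∀ z, ‖z‖ < 1 → 0 < (p z).re) {τ : ℂ}
    (hτ : ‖τ‖ ≤ 1) (hφ : IsSemigroup φ)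
    (hG : IsGenerator φ (fun z => (τ - z) * (1 - conj τ * z) * p z)) : HasDWPoint φ τ := by
  intro t ht
  rcases hτ.lt_or_eq with hτ1 | hτ1
  · refine Or.inl ⟨Complex.UnitDisc.mk τ hτ1, rfl, ?_⟩
    set w : 𝔻 := Complex.UnitDisc.mk τ hτ1 with hw
    have hwτ : (w : ℂ) = τ := rfl
    have h1 : IsTraj (fun z => (τ - z) * (1 - conj τ * z) * p z) t
        (fun s : ℝ => (φ s.toNNReal w : ℂ)) := fun s hs =>
      ⟨(φ _ w).norm_lt_one, (hG.hasDerivWithinAt w hs.1).mono Icc_subset_Ici_self⟩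
    have h2 : IsTraj (fun z => (τ - z) * (1 - conj τ * z) * p z) t (fun _ => τ) := fun s hs =>
      ⟨hτ1, by simpa using hasDerivWithinAt_const s (Icc 0 (t : ℝ)) τ⟩
    have h3 := h1.eqOn (by fun_prop) h2 (by simp [hφ.zero, hwτ]) (right_mem_Icc.2 t.2)
    rw [← Complex.UnitDisc.coe_inj, hwτ]
    simpa using h3
  · have hτ0 := ne_zero_of_norm_eq_one hτ1
    have hττ : τ * conj τ = 1 := by
      rw [Complex.mul_conj, Complex.normSq_eq_norm_sq, hτ1]; norm_num
    have hfield : ∀ z : 𝔻, (2 * τ * ((τ - z) * (1 - conj τ * z) * p z) / (τ - z) ^ 2).re =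
        2 * (p z).re := by
      intro z
      have h1 := ne_of_norm_lt_one hτ1 z.norm_lt_one
      have e : (1 : ℂ) - conj τ * z = conj τ * (τ - z) := by linear_combination -hττ
      have : 2 * τ * ((τ - z) * (1 - conj τ * z) * p z) / (τ - z) ^ 2 = ((2 : ℝ) : ℂ) * p z := by
        rw [e, div_eq_iff (pow_ne_zero 2 h1)]
        push_cast
        linear_combination (2 * (τ - z) ^ 2 * p z) * hττ
      rw [this, Complex.re_ofReal_mul]
    have ht0 : t ≠ 0 := by
      rintro rfl
      exact ht (funext hφ.zero)
    have hjulia := julia_of_generator hφ hG hτ1 (C := 0) fun z => by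
      rw [hfield]
      have := hre z z.norm_lt_one
      simp only [neg_zero, zero_mul]
      linarith
    obtain ⟨h1, d, hd, hd'⟩ := brfp_of_julia (hφ.hol t) hτ1 one_pos fun z => by
      simpa using hjulia t z
    refine Or.inr ⟨fun w hw => ?_, h1, d, by simpa using hd, hd'⟩
    have hd : ∀ s ∈ Ici (0 : ℝ), HasDerivWithinAt
        (fun s : ℝ => ((τ + φ s.toNNReal w) / (τ - φ s.toNNReal w) : ℂ).re) _ (Ici 0) s :=
      fun s hs => hasDerivWithinAt_cayley (hG.hasDerivWithinAt w hs)
        (ne_of_norm_lt_one hτ1 (φ s.toNNReal w).norm_lt_one)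
    have hmono := strictMonoOn_of_hasDerivWithinAt_pos (convex_Ici 0)
      (fun s hs => (hd s hs).continuousWithinAt)
      (fun s hs => (hd s (interior_subset hs)).mono interior_subset) fun s hs => by
        rw [hfield]
        have := hre _ (φ s.toNNReal w).norm_lt_one
        linarith
    have h := hmono self_mem_Ici (show (t : ℝ) ∈ Ici 0 from t.2)
      (show (0 : ℝ) < t by exact_mod_cast pos_iff_ne_zero.2 ht0)
    simp [hφ.zero, hw] at h

/-- Sufficient conditions for membership in the class `Gen_τ(F)`. -/
theorem mem_genClass {n : ℕ} {σ : Fin n → ℂ} (hσ : ∀ k, ‖σ k‖ = 1) {τ : ℂ} (hτ : ‖τ‖ ≤ 1)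
    (hτσ : ∀ k, τ ≠ σ k) {p : ℂ → ℂ} (hp : DifferentiableOn ℂ p (ball 0 1))
    (hre : ∀ z, ‖z‖ < 1 → 0 < (p z).re) {l : Fin n → ℝ} (hl : ∀ k, l k < 0)
    (hs : ∀ k, HasSpectralValue (fun z : 𝔻 => (τ - z) * (1 - conj τ * z) * p z) (σ k) (l k))
    (hsum : ∑ k, |l k| ≤ 1) :
    (fun z : 𝔻 => (τ - z) * (1 - conj τ * z) * p z) ∈ GenClass τ σ := by
  obtain ⟨φ, hφ, hG⟩ := exists_semigroup hp (fun z hz => (hre z hz).le) τ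
  refine Or.inr ⟨φ, hφ, hG, hasDWPoint_of_berkson_porta hp hre hτ hφ hG, fun k t => ?_, l,
    fun k => ⟨hl k, hs k⟩, hsum⟩
  have hp0 : ∀ z, ‖z‖ < 1 → p z ≠ 0 := fun z hz h => by
    have := hre z hz
    rw [h] at this
    simp at this
  have hinv : DifferentiableOn ℂ (fun z => (p z)⁻¹) (ball 0 1) :=
    hp.inv fun z hz => hp0 z (by simpa using hz)
  have hinvre : ∀ z, ‖z‖ < 1 → 0 ≤ ((p z)⁻¹).re := fun z hz => by
    rw [Complex.inv_re]
    exact div_nonneg (hre z hz).le (Complex.normSq_nonneg _)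
  -- By uniqueness of angular limits this mass of 1/p at σ_k is the positive number dictated by the
  -- spectral value.
  obtain ⟨α, hα0, hα, hαl⟩ := julia_wolff hinv hinvre (hσ k)
  have hα1 : 0 < α := by
    have h1 := hαl.unique (hσ k) (mass_of_spectral hτ (hσ k) (hτσ k) (hl k) (hs k))
    have h2 := mul_left_cancel₀ (mul_ne_zero two_ne_zero (ne_zero_of_norm_eq_one (hσ k))) h1
    have h3 : α = ‖τ - σ k‖ ^ 2 / (2 * |l k|) := by exact_mod_cast h2
    rw [h3]
    have := norm_pos_iff.2 (sub_ne_zero.2 (hτσ k))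
    have := abs_pos.2 (hl k).ne
    positivity
  -- Positive mass α bounds the expansion rate at σ_k by |τ-σ_k|²/(2α), so every φ_t satisfies a
  -- Julia inequality there.
  have hj := julia_of_generator hφ hG (hσ k) (C := ‖τ - σ k‖ ^ 2 / (2 * α)) (fun z =>
    re_cayley_field_ge (hσ k) (hτσ k) z.norm_lt_one hα1 (hre z z.norm_lt_one)
      (hα z z.norm_lt_one)) t
  obtain ⟨h1, d, -, hd⟩ := brfp_of_julia (hφ.hol t) (hσ k) (Real.exp_pos _) hj
  exact ⟨h1, d, hd⟩

/-! ### Multiplying the measure of p by a trigonometric polynomial. -/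

/-- Iterated backward shifts of a holomorphic function. -/
noncomputable def bshift (p : ℂ → ℂ) : ℕ → ℂ → ℂ
  | 0 => p
  | j + 1 => dslope (bshift p j) 0

theorem differentiableOn_bshift {p : ℂ → ℂ} (hp : DifferentiableOn ℂ p (ball 0 1)) (j : ℕ) :
    DifferentiableOn ℂ (bshift p j) (ball 0 1) := by
  induction j with
  | zero => exact hp
  | succ j ih => exact (Complex.differentiableOn_dslope (ball_mem_nhds 0 one_pos)).2 ih

/-- Taylor's formula with remainder: `bshift p i 0` is the i-th Taylor coefficient of p at 0. -/
theorem eq_sum_add_bshift (p : ℂ → ℂ) (j : ℕ) (z : ℂ) :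
    p z = ∑ i ∈ Finset.range j, bshift p i 0 * z ^ i + z ^ j * bshift p j z := by
  induction j with
  | zero => simp [bshift]
  | succ j ih =>
    have h := sub_smul_dslope (bshift p j) 0 z
    rw [sub_zero, smul_eq_mul] at h
    rw [Finset.sum_range_succ, ih, bshift]
    linear_combination (-z ^ j) * h

/-- The analytic polynomial entering the perturbation. -/
noncomputable def pertPoly {n : ℕ} (p : ℂ → ℂ) (c : Fin (n + 1) → ℂ) (z : ℂ) : ℂ :=
  ∑ j, c j * ∑ i ∈ Finset.range j, conj (bshift p i 0) * z ^ ((j : ℕ) - i)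

/-- The holomorphic function whose boundary measure is that of `p` multiplied by the trigonometric
polynomial `2 Re ∑ c_j ζ ^ j`. -/
noncomputable def pert {n : ℕ} (p : ℂ → ℂ) (c : Fin (n + 1) → ℂ) (z : ℂ) : ℂ :=
  ∑ j, (c j * z ^ (j : ℕ) * p z + conj (c j) * bshift p j z) + pertPoly p c z

theorem differentiableOn_pert {n : ℕ} {p : ℂ → ℂ} (hp : DifferentiableOn ℂ p (ball 0 1))
    (c : Fin (n + 1) → ℂ) : DifferentiableOn ℂ (pert p c) (ball 0 1) := by
  have h := differentiableOn_bshift hp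
  unfold pert pertPoly
  fun_prop

/-- Dilation replaces p by p(ρz), holomorphic past the circle. On |z| = 1 each backward shift is
conj z ^ j times p minus a Taylor polynomial, and `pertPoly` cancels those Taylor terms up to an
imaginary quantity; the real part becomes 2 Re(∑ c_j z^j) Re p(ρz). The maximum principle for
exp(-g) carries the sign inside, and ρ tends to 1. -/
theorem re_pert_nonneg {n : ℕ} {p : ℂ → ℂ} (hp : DifferentiableOn ℂ p (ball 0 1))
    (hre : ∀ z, ‖z‖ < 1 → 0 ≤ (p z).re) {c : Fin (n + 1) → ℂ}
    (hc : ∀ z : ℂ, ‖z‖ = 1 → 0 ≤ (∑ j, c j * z ^ (j : ℕ)).re) {z : ℂ} (hz : ‖z‖ < 1) :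
    0 ≤ (pert p c z).re := by
  have hb := differentiableOn_bshift hp
  set g : ℝ → ℂ → ℂ := fun ρ z =>
    ∑ j : Fin (n + 1), (c j * z ^ (j : ℕ) * p (ρ * z) + conj (c j) * (ρ ^ (j : ℕ) * bshift p j (ρ * z)) +
      c j * ∑ i ∈ Finset.range j, conj (bshift p i 0) * ρ ^ i * z ^ ((j : ℕ) - i)) with hg
  have hscale : ∀ ρ : ℝ, 0 < ρ → ρ < 1 → ∀ z : ℂ, ‖z‖ < 1 / ρ → ‖(ρ : ℂ) * z‖ < 1 := by
    intro ρ h0 h1 z hz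
    rw [norm_mul, Complex.norm_real, Real.norm_of_nonneg h0.le]
    rwa [lt_div_iff₀' h0] at hz
  have hgd : ∀ ρ : ℝ, 0 < ρ → ρ < 1 → DifferentiableOn ℂ (g ρ) (ball 0 (1 / ρ)) := by
    intro ρ h0 h1
    have hmaps : MapsTo (fun z : ℂ => (ρ : ℂ) * z) (ball 0 (1 / ρ)) (ball 0 1) := fun z hz => by
      have := hscale ρ h0 h1 z (by simpa using hz)
      simpa using this
    have h2 : DifferentiableOn ℂ (fun z : ℂ => p (ρ * z)) (ball 0 (1 / ρ)) :=
      hp.comp (by fun_prop) hmaps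
    have h3 : ∀ j, DifferentiableOn ℂ (fun z : ℂ => bshift p j (ρ * z)) (ball 0 (1 / ρ)) := fun j =>
      (hb j).comp (by fun_prop) hmaps
    simp only [hg]
    fun_prop
  have hcirc : ∀ ρ : ℝ, 0 < ρ → ρ < 1 → ∀ z : ℂ, ‖z‖ = 1 → 0 ≤ (g ρ z).re := by
    intro ρ h0 h1 z hz
    have hzz : conj z * z = 1 := by
      rw [mul_comm, Complex.mul_conj, Complex.normSq_eq_norm_sq, hz]; norm_num
    have hterm : ∀ j : Fin (n + 1), (c j * z ^ (j : ℕ) * p (ρ * z) +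
        conj (c j) * (ρ ^ (j : ℕ) * bshift p j (ρ * z)) +
        c j * ∑ i ∈ Finset.range j, conj (bshift p i 0) * ρ ^ i * z ^ ((j : ℕ) - i)).re =
        2 * (c j * z ^ (j : ℕ)).re * (p (ρ * z)).re := by
      intro j
      have h2 := eq_sum_add_bshift p j (ρ * z)
      have hpow : ∀ i ∈ Finset.range (j : ℕ), conj z ^ (j : ℕ) * z ^ i = conj z ^ ((j : ℕ) - i) := by
        intro i hi
        have hij := (Finset.mem_range.1 hi).le
        conv_lhs => rw [← Nat.sub_add_cancel hij, pow_add, mul_assoc, ← mul_pow, hzz, one_pow, mul_one]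
      have h3 : (ρ : ℂ) ^ (j : ℕ) * bshift p j (ρ * z) = conj z ^ (j : ℕ) * p (ρ * z) -
          ∑ i ∈ Finset.range j, bshift p i 0 * ρ ^ i * conj z ^ ((j : ℕ) - i) := by
        have h4 : conj z ^ (j : ℕ) * z ^ (j : ℕ) = 1 := by rw [← mul_pow, hzz, one_pow]
        have h5 : ∑ i ∈ Finset.range j, bshift p i 0 * ρ ^ i * conj z ^ ((j : ℕ) - i) =
            conj z ^ (j : ℕ) * ∑ i ∈ Finset.range j, bshift p i 0 * (ρ * z) ^ i := by
          rw [Finset.mul_sum]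
          refine Finset.sum_congr rfl fun i hi => ?_
          rw [← hpow i hi, mul_pow]
          ring
        rw [h5, h2, mul_pow]
        linear_combination (-(ρ : ℂ) ^ (j : ℕ) * bshift p j (ρ * z)) * h4
      set w := c j * ∑ i ∈ Finset.range j, conj (bshift p i 0) * ρ ^ i * z ^ ((j : ℕ) - i) with hw
      have hwc : conj w = conj (c j) * ∑ i ∈ Finset.range j,
          bshift p i 0 * ρ ^ i * conj z ^ ((j : ℕ) - i) := by
        rw [hw, map_mul, map_sum]
        simp
      have h6 : c j * z ^ (j : ℕ) * p (ρ * z) +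
          conj (c j) * (ρ ^ (j : ℕ) * bshift p j (ρ * z)) + w =
          (c j * z ^ (j : ℕ) + conj (c j * z ^ (j : ℕ))) * p (ρ * z) + (w - conj w) := by
        rw [h3, hwc, map_mul, map_pow]
        ring
      rw [h6, Complex.add_conj, Complex.add_re, Complex.re_ofReal_mul, Complex.sub_re, Complex.conj_re]
      ring
    simp only [hg, Complex.re_sum, hterm]
    rw [← Finset.sum_mul, ← Finset.mul_sum, ← Complex.re_sum]
    have h7 := hre (ρ * z) (hscale ρ h0 h1 z (by rw [hz, lt_div_iff₀ h0]; linarith))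
    have h8 := hc z hz
    positivity
  have hdisc : ∀ ρ : ℝ, 0 < ρ → ρ < 1 → 0 ≤ (g ρ z).re := by
    intro ρ h0 h1
    have h2 : (1 : ℝ) < 1 / ρ := by rw [lt_div_iff₀ h0]; linarith
    have h3 : DiffContOnCl ℂ (fun z => Complex.exp (-g ρ z)) (ball 0 1) := by
      refine DifferentiableOn.diffContOnCl_ball (U := ball 0 (1 / ρ)) ?_ ?_
      · exact (hgd ρ h0 h1).neg.cexp
      · exact closedBall_subset_ball h2
    have h4 := Complex.norm_le_of_forall_mem_frontier_norm_le isBounded_ball h3 (C := 1)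
      (fun w hw => by
        rw [frontier_ball _ one_ne_zero, mem_sphere, dist_zero_right] at hw
        rw [Complex.norm_exp, Complex.neg_re]
        exact Real.exp_le_one_iff.2 (by linarith [hcirc ρ h0 h1 w hw]))
      (subset_closure (by simpa using hz : z ∈ ball (0 : ℂ) 1))
    rw [Complex.norm_exp, Complex.neg_re, Real.exp_le_one_iff] at h4
    linarith
  have hlim : Tendsto (fun ρ : ℝ => (g ρ z).re) (𝓝[<] 1) (𝓝 (g (1 : ℝ) z).re) := by
    have hcz : Tendsto (fun ρ : ℝ => (ρ : ℂ) * z) (𝓝 1) (𝓝 (((1 : ℝ) : ℂ) * z)) :=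
      Continuous.tendsto (by fun_prop) 1
    have hz1 : ((1 : ℝ) : ℂ) * z ∈ ball (0 : ℂ) 1 := by simpa using hz
    have hcp : ∀ F : ℂ → ℂ, DifferentiableOn ℂ F (ball 0 1) →
        ContinuousAt (fun ρ : ℝ => F (ρ * z)) 1 := fun F hF =>
      Tendsto.comp (hF.continuousOn.continuousAt (isOpen_ball.mem_nhds hz1)) hcz
    have h1 := hcp p hp
    have h2 := fun j => hcp _ (hb j)
    have : ContinuousAt (fun ρ : ℝ => (g ρ z).re) 1 := by
      refine Complex.continuous_re.continuousAt.comp ?_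
      simp only [hg]
      refine tendsto_finsetSum _ fun j _ => ?_
      refine ContinuousAt.add (ContinuousAt.add (continuousAt_const.mul h1) (continuousAt_const.mul
        (ContinuousAt.mul (by fun_prop) (h2 j)))) (by fun_prop)
    exact this.tendsto.mono_left nhdsWithin_le_nhds
  have hg1 : g (1 : ℝ) z = pert p c z := by
    simp [hg, pert, pertPoly, Finset.sum_add_distrib]
  rw [← hg1]
  refine ge_of_tendsto hlim ?_
  have : ∀ᶠ ρ : ℝ in 𝓝[<] 1, 0 < ρ := nhdsWithin_le_nhds (lt_mem_nhds one_pos)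
  filter_upwards [this, self_mem_nhdsWithin] with ρ h0 h1
  exact hdisc ρ h0 h1

theorem re_sum_le {n : ℕ} (c : Fin (n + 1) → ℂ) {z : ℂ} (hz : ‖z‖ = 1) :
    |(∑ j, c j * z ^ (j : ℕ)).re| ≤ ∑ j, ‖c j‖ := by
  refine (Complex.abs_re_le_norm _).trans ((norm_sum_le _ _).trans ?_)
  simp [hz]

/-- The construction is real-linear in c, and the constant polynomial A contributes 2Ap. -/
theorem pert_single_add {n : ℕ} (p : ℂ → ℂ) (c : Fin (n + 1) → ℂ) (A ε : ℝ) (z : ℂ) :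
    pert p (fun j => (if j = 0 then (A : ℂ) else 0) + ε * c j) z = 2 * A * p z + ε * pert p c z := by
  have h1 : ∀ f : Fin (n + 1) → ℂ, ∑ j, (if j = 0 then (A : ℂ) else 0) * f j = A * f 0 := fun f => by
    simp
  simp only [pert, pertPoly, add_mul, map_add, map_mul, Complex.conj_ofReal, Finset.sum_add_distrib]
  have h2 : ∀ j : Fin (n + 1), conj (if j = 0 then (A : ℂ) else 0) = if j = 0 then (A : ℂ) else 0 :=
    fun j => by split_ifs <;> simp
  simp only [h2, h1, mul_assoc, ← Finset.mul_sum]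
  simp [bshift]
  ring

/-- The real part of the perturbation is controlled by that of `p`. -/
theorem abs_re_pert_le {n : ℕ} {p : ℂ → ℂ} (hp : DifferentiableOn ℂ p (ball 0 1))
    (hre : ∀ z, ‖z‖ < 1 → 0 ≤ (p z).re) (c : Fin (n + 1) → ℂ) {z : ℂ} (hz : ‖z‖ < 1) :
    |(pert p c z).re| ≤ 2 * (∑ j, ‖c j‖) * (p z).re := by
  -- Adding the constant ∑‖c_j‖ to ±∑ c_j z^j makes its real part nonnegative on the circle.
  have key : ∀ ε : ℝ, |ε| = 1 → 0 ≤ 2 * (∑ j, ‖c j‖) * (p z).re + ε * (pert p c z).re := by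
    intro ε hε
    have := re_pert_nonneg hp hre
      (c := fun j => (if j = 0 then ((∑ j, ‖c j‖ : ℝ) : ℂ) else 0) + ε * c j) (fun w hw => by
        have h1 := re_sum_le c hw
        have h2 : ∑ j, ((if j = 0 then ((∑ j, ‖c j‖ : ℝ) : ℂ) else 0) + ε * c j) * w ^ (j : ℕ) =
            ((∑ j, ‖c j‖ : ℝ) : ℂ) + ε * ∑ j, c j * w ^ (j : ℕ) := by
          simp only [add_mul, Finset.sum_add_distrib, Finset.mul_sum, mul_assoc]
          simp
        rw [h2, Complex.add_re, Complex.ofReal_re, Complex.re_ofReal_mul]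
        have h3 : |ε * (∑ j, c j * w ^ (j : ℕ)).re| ≤ ∑ j, ‖c j‖ := by
          rw [abs_mul, hε, one_mul]; exact h1
        linarith [neg_abs_le (ε * (∑ j, c j * w ^ (j : ℕ)).re)]) hz
    rw [pert_single_add] at this
    have e : (2 * ((∑ j, ‖c j‖ : ℝ) : ℂ) * p z) = ((2 * ∑ j, ‖c j‖ : ℝ) : ℂ) * p z := by push_cast; ring
    rwa [e, Complex.add_re, Complex.re_ofReal_mul, Complex.re_ofReal_mul] at this
  have h1 := key 1 (by simp)
  have h2 := key (-1) (by simp)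
  rw [abs_le]
  constructor <;> linarith

/-! ### Polynomial form of the perturbation and the linear system. -/

open Polynomial in
/-- The analytic part of the trigonometric polynomial. -/
noncomputable def coeffPoly {n : ℕ} (c : Fin (n + 1) → ℂ) : ℂ[X] := ∑ j, C (c j) * X ^ (j : ℕ)

open Polynomial in
/-- The polynomial with evaluation `pertPoly`. -/
noncomputable def corrPoly {n : ℕ} (p : ℂ → ℂ) (c : Fin (n + 1) → ℂ) : ℂ[X] :=
  ∑ j, C (c j) * ∑ i ∈ Finset.range j, C (conj (bshift p i 0)) * X ^ ((j : ℕ) - i)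

section
open Polynomial
variable {n : ℕ} (p : ℂ → ℂ) (c : Fin (n + 1) → ℂ)

theorem eval_coeffPoly (z : ℂ) : (coeffPoly c).eval z = ∑ j, c j * z ^ (j : ℕ) := by
  simp [coeffPoly, eval_finsetSum]

theorem eval_corrPoly (z : ℂ) : (corrPoly p c).eval z = pertPoly p c z := by
  simp [corrPoly, pertPoly, eval_finsetSum]

theorem natDegree_coeffPoly_le : (coeffPoly c).natDegree ≤ n :=
  natDegree_sum_le_of_forall_le _ _ fun j _ => (natDegree_C_mul_X_pow_le _ _).trans (by omega)

theorem natDegree_corrPoly_le : (corrPoly p c).natDegree ≤ n := by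
  refine natDegree_sum_le_of_forall_le _ _ fun j _ => (natDegree_C_mul_le _ _).trans ?_
  exact natDegree_sum_le_of_forall_le _ _ fun i _ => (natDegree_C_mul_X_pow_le _ _).trans (by omega)

theorem coeffPoly_coeff (j : Fin (n + 1)) : (coeffPoly c).coeff j = c j := by
  simp only [coeffPoly, finsetSum_coeff, coeff_C_mul, coeff_X_pow]
  simp [Fin.val_inj]

theorem eval_map_conj (P : ℂ[X]) (z : ℂ) :
    (P.map (starRingEnd ℂ)).eval (conj z) = conj (P.eval z) := by
  rw [eval_map]
  exact (hom_eval₂ P (RingHom.id ℂ) (starRingEnd ℂ) z).symm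

theorem coeffPoly_add (c d : Fin (n + 1) → ℂ) : coeffPoly (c + d) = coeffPoly c + coeffPoly d := by
  simp [coeffPoly, add_mul, Finset.sum_add_distrib]

theorem coeffPoly_smul (r : ℝ) (c : Fin (n + 1) → ℂ) :
    coeffPoly (r • c) = C (r : ℂ) * coeffPoly c := by
  simp [coeffPoly, Finset.mul_sum, mul_assoc]

theorem corrPoly_add (c d : Fin (n + 1) → ℂ) :
    corrPoly p (c + d) = corrPoly p c + corrPoly p d := by
  simp [corrPoly, add_mul, Finset.sum_add_distrib]

theorem corrPoly_smul (r : ℝ) (c : Fin (n + 1) → ℂ) :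
    corrPoly p (r • c) = C (r : ℂ) * corrPoly p c := by
  simp only [corrPoly, Finset.mul_sum (s := Finset.univ)]
  refine Finset.sum_congr rfl fun j _ => ?_
  rw [← mul_assoc, ← C_mul]
  simp

/-- The real trigonometric polynomial. -/
noncomputable def trig (z : ℂ) : ℂ :=
  (coeffPoly c).eval z + ((coeffPoly c).map (starRingEnd ℂ)).eval z⁻¹

/-- The imaginary trigonometric polynomial correcting the poles at the origin. -/
noncomputable def corr (z : ℂ) : ℂ :=
  (corrPoly p c).eval z - ((corrPoly p c).map (starRingEnd ℂ)).eval z⁻¹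

/-- Away from 0 the j-th backward shift is z^(-j) times p minus its Taylor polynomial; collecting
terms separates a factor real on the circle from a correction imaginary there. -/
theorem pert_eq_trig_mul_add_corr {z : ℂ} (hz : z ≠ 0) :
    pert p c z = trig c z * p z + corr p c z := by
  have h1 : ((coeffPoly c).map (starRingEnd ℂ)).eval z⁻¹ * p z -
      ((corrPoly p c).map (starRingEnd ℂ)).eval z⁻¹ = ∑ j, conj (c j) * bshift p j z := by
    simp only [coeffPoly, corrPoly, Polynomial.map_sum, Polynomial.map_mul, Polynomial.map_pow,
      map_X, map_C, eval_finsetSum, eval_mul, eval_pow, eval_X, eval_C, Complex.conj_conj]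
    rw [Finset.sum_mul, ← Finset.sum_sub_distrib]
    refine Finset.sum_congr rfl fun j _ => ?_
    have h3 : ∑ i ∈ Finset.range (j : ℕ), bshift p i 0 * z⁻¹ ^ ((j : ℕ) - i) =
        z⁻¹ ^ (j : ℕ) * ∑ i ∈ Finset.range (j : ℕ), bshift p i 0 * z ^ i := by
      rw [Finset.mul_sum]
      refine Finset.sum_congr rfl fun i hi => ?_
      have hij := (Finset.mem_range.1 hi).le
      have : z⁻¹ ^ (j : ℕ) * z ^ i = z⁻¹ ^ ((j : ℕ) - i) := by
        conv_lhs => rw [← Nat.sub_add_cancel hij, pow_add, mul_assoc, ← mul_pow, inv_mul_cancel₀ hz,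
          one_pow, mul_one]
      rw [← this]
      ring
    have h4 : z⁻¹ ^ (j : ℕ) * z ^ (j : ℕ) = 1 := by rw [← mul_pow, inv_mul_cancel₀ hz, one_pow]
    rw [h3]
    conv_lhs => enter [1]; rw [eq_sum_add_bshift p j z]
    linear_combination (conj (c j) * bshift p j z) * h4
  rw [trig, corr, pert, Finset.sum_add_distrib, ← h1, eval_corrPoly, eval_coeffPoly, ← Finset.sum_mul]
  ring

theorem inv_eq_conj_of_norm_eq_one {z : ℂ} (hz : ‖z‖ = 1) : z⁻¹ = conj z := by
  rw [Complex.inv_def, Complex.normSq_eq_norm_sq, hz]; simp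

theorem trig_of_norm_eq_one {z : ℂ} (hz : ‖z‖ = 1) :
    trig c z = ((2 * ((coeffPoly c).eval z).re : ℝ) : ℂ) := by
  rw [trig, inv_eq_conj_of_norm_eq_one hz, eval_map_conj, Complex.add_conj]

theorem corr_of_norm_eq_one {z : ℂ} (hz : ‖z‖ = 1) :
    corr p c z = Complex.I * ((2 * ((corrPoly p c).eval z).im : ℝ) : ℂ) := by
  rw [corr, inv_eq_conj_of_norm_eq_one hz, eval_map_conj, Complex.sub_conj, mul_comm]

theorem continuousAt_trig {z : ℂ} (hz : z ≠ 0) : ContinuousAt (trig c) z :=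
  (Polynomial.continuous _).continuousAt.add
    ((Polynomial.continuous _).continuousAt.comp (continuousAt_inv₀ hz))

/-- On the circle `corr` is imaginary, so its derivative is governed by a single real number. A
double zero of `corr` plus an imaginary constant therefore costs only two real equations. -/
theorem hasDerivAt_corr {z : ℂ} (hz : ‖z‖ = 1) :
    HasDerivAt (corr p c) (2 * ((z * (corrPoly p c).derivative.eval z).re : ℝ) * conj z) z := by
  have hz0 := ne_zero_of_norm_eq_one hz
  have h1 := ((corrPoly p c).hasDerivAt z).sub
    ((((corrPoly p c).map (starRingEnd ℂ)).hasDerivAt z⁻¹).comp z (hasDerivAt_inv hz0))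
  refine h1.congr_deriv ?_
  rw [derivative_map, inv_eq_conj_of_norm_eq_one hz, eval_map_conj]
  have h2 : z * conj z = 1 := by
    rw [Complex.mul_conj, Complex.normSq_eq_norm_sq, hz]; norm_num
  have h3 := Complex.add_conj (z * (corrPoly p c).derivative.eval z)
  push_cast at h3
  rw [← h3, ← inv_pow, inv_eq_conj_of_norm_eq_one hz, map_mul]
  linear_combination (-(corrPoly p c).derivative.eval z) * h2

/-- The linear system satisfied by admissible perturbations has a nontrivial solution. -/
theorem exists_admissible (σ : Fin n → ℂ) (m : Fin n → ℝ) :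
    ∃ (c : Fin (n + 1) → ℂ) (s : ℝ), (c ≠ 0 ∨ s ≠ 0) ∧
      (∀ k, 2 * ((corrPoly p c).eval (σ k)).im + s = 0) ∧
      (∀ k, (σ k * (corrPoly p c).derivative.eval (σ k)).re = 0) ∧
      ∑ k, m k * ((coeffPoly c).eval (σ k)).re = 0 ∧ (c 0).im = 0 := by
  let Φ : ((Fin (n + 1) → ℂ) × ℝ) →ₗ[ℝ] (Fin n → ℝ) × (Fin n → ℝ) × ℝ × ℝ :=
    { toFun := fun v => (fun k => 2 * ((corrPoly p v.1).eval (σ k)).im + v.2,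
        fun k => (σ k * (corrPoly p v.1).derivative.eval (σ k)).re,
        ∑ k, m k * ((coeffPoly v.1).eval (σ k)).re, (v.1 0).im)
      map_add' := fun v w => by
        simp only [Prod.fst_add, Prod.snd_add, corrPoly_add, coeffPoly_add, eval_add, Complex.add_im,
          Complex.add_re, derivative_add, mul_add, Finset.sum_add_distrib, Pi.add_apply, Prod.mk_add_mk]
        refine Prod.ext (funext fun k => ?_) (Prod.ext (funext fun k => ?_) rfl)
        · simp only [Pi.add_apply]; ring
        · simp only [Pi.add_apply]
      map_smul' := fun r v => by
        simp only [Prod.smul_fst, Prod.smul_snd, corrPoly_smul, coeffPoly_smul, eval_mul, eval_C,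
          derivative_C_mul, Complex.im_ofReal_mul, Complex.re_ofReal_mul, smul_eq_mul, RingHom.id_apply,
          mul_left_comm _ (r : ℂ)]
        refine Prod.ext (funext fun k => ?_) (Prod.ext (funext fun k => ?_) (Prod.ext ?_ ?_))
        · simp; ring
        · simp
        · simp [Finset.mul_sum, mul_left_comm]
        · simp }
  -- There are 2(n+1)+1 real unknowns and 2n+2 equations. The last equation discards Im c_0, which
  -- does not affect `trig`.
  have hlt : Module.finrank ℝ ((Fin n → ℝ) × (Fin n → ℝ) × ℝ × ℝ) <
      Module.finrank ℝ ((Fin (n + 1) → ℂ) × ℝ) := by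
    simp only [Module.finrank_prod, Module.finrank_pi_fintype, Complex.finrank_real_complex,
      Module.finrank_self, Finset.sum_const, Finset.card_univ, Fintype.card_fin, smul_eq_mul]
    omega
  have hker := LinearMap.ker_ne_bot_of_finrank_lt (f := Φ) hlt
  obtain ⟨v, hv, hv0⟩ := (Submodule.ne_bot_iff _).1 hker
  rw [LinearMap.mem_ker] at hv
  refine ⟨v.1, v.2, ?_, fun k => ?_, fun k => ?_, ?_, ?_⟩
  · by_contra hcon
    push Not at hcon
    exact hv0 (Prod.ext hcon.1 hcon.2)
  · exact congrFun (congrArg Prod.fst hv) k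
  · exact congrFun (congrArg (fun x => x.2.1) hv) k
  · exact congrArg (fun x => x.2.2.1) hv
  · exact congrArg (fun x => x.2.2.2) hv

end

/-! ### Boundary behaviour of admissible perturbations. -/

/-- The perturbation is negligible at the boundary points apart from the trigonometric factor. -/
theorem hasAngularLimit_pert {n : ℕ} {p : ℂ → ℂ} {c : Fin (n + 1) → ℂ} {s : ℝ} {σ a : ℂ}
    (hσ : ‖σ‖ = 1) (h1 : 2 * ((corrPoly p c).eval σ).im + s = 0)
    (h2 : (σ * (corrPoly p c).derivative.eval σ).re = 0)
    (hp : HasAngularLimit (fun z => p z / (σ - z)) σ a) :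
    HasAngularLimit (fun z => (pert p c z + Complex.I * s) / (σ - z)) σ
      (((2 * ((coeffPoly c).eval σ).re : ℝ) : ℂ) * a) := by
  have hσ0 := ne_zero_of_norm_eq_one hσ
  have ht := (HasAngularLimit.of_continuousAt (continuousAt_trig c hσ0)).mul hp
  rw [trig_of_norm_eq_one c hσ] at ht
  have hd := hasDerivAt_corr p c hσ
  rw [h2, Complex.ofReal_zero, mul_zero, zero_mul] at hd
  have hcσ : corr p c σ + Complex.I * s = 0 := by
    rw [corr_of_norm_eq_one p c hσ, ← mul_add, ← Complex.ofReal_add, h1]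
    simp
  -- The correction vanishes at σ together with its derivative, so even after division by σ - z it
  -- tends to 0.
  have hcorr : HasAngularLimit (fun z => (corr p c z + Complex.I * s) / (σ - z)) σ 0 := by
    intro M hM
    have hcoe : Tendsto (fun z : 𝔻 => (z : ℂ))
        (comap (fun z : 𝔻 => (z : ℂ)) (𝓝 σ) ⊓ 𝓟 (stolzAngle σ M)) (𝓝[≠] σ) := by
      refine tendsto_nhdsWithin_iff.2 ⟨tendsto_comap.mono_left inf_le_left,
        Eventually.of_forall fun z hz => ?_⟩
      exact ne_of_norm_lt_one hσ z.norm_lt_one (sub_eq_zero.2 (mem_singleton_iff.1 hz).symm)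
    have h3 := ((hasDerivAt_iff_tendsto_slope.1 hd).comp hcoe).neg
    rw [neg_zero] at h3
    refine h3.congr fun z => ?_
    have : corr p c σ = -(Complex.I * s) := eq_neg_of_add_eq_zero_left hcσ
    rw [Function.comp_apply, slope_def_field, this, sub_neg_eq_add, ← neg_sub σ (z : ℂ), div_neg,
      neg_neg]
  intro M hM
  have h5 := (ht.add hcorr) M hM
  rw [add_zero] at h5
  refine h5.congr' ?_
  have hcoe : Tendsto (fun z : 𝔻 => (z : ℂ))
      (comap (fun z : 𝔻 => (z : ℂ)) (𝓝 σ) ⊓ 𝓟 (stolzAngle σ M)) (𝓝 σ) :=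
    tendsto_comap.mono_left inf_le_left
  filter_upwards [hcoe.eventually (isOpen_ne.mem_nhds hσ0)] with z hz
  rw [pert_eq_trig_mul_add_corr p c hz]
  ring

/-- Small admissible perturbations stay in the class. -/
theorem pert_mem_genClass {n : ℕ} {σ : Fin n → ℂ} (hσ : ∀ k, ‖σ k‖ = 1) {τ : ℂ} (hτ : ‖τ‖ ≤ 1)
    (hτσ : ∀ k, τ ≠ σ k) {p : ℂ → ℂ} (hp : DifferentiableOn ℂ p (ball 0 1))
    (hre : ∀ z, ‖z‖ < 1 → 0 < (p z).re) {l : Fin n → ℝ} (hl : ∀ k, l k < 0)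
    (hs : ∀ k, HasSpectralValue (fun z : 𝔻 => (τ - z) * (1 - conj τ * z) * p z) (σ k) (l k))
    (hsum : ∑ k, |l k| ≤ 1) {c : Fin (n + 1) → ℂ} {s : ℝ}
    (h1 : ∀ k, 2 * ((corrPoly p c).eval (σ k)).im + s = 0)
    (h2 : ∀ k, (σ k * (corrPoly p c).derivative.eval (σ k)).re = 0)
    (h3 : ∑ k, |l k| * ((coeffPoly c).eval (σ k)).re = 0) {ε : ℝ}
    (hε : 2 * (∑ j, ‖c j‖) * |ε| < 1) :
    (fun z : 𝔻 => (τ - z) * (1 - conj τ * z) * (p z + ε * (pert p c z + Complex.I * s))) ∈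
      GenClass τ σ := by
  -- The perturbed spectral value is l_k times this number, the value at σ_k of the multiplier of
  -- the measure.
  have hpos : ∀ k, 0 < 1 + 2 * ε * ((coeffPoly c).eval (σ k)).re := by
    intro k
    have h4 := re_sum_le c (hσ k)
    rw [← eval_coeffPoly] at h4
    have h5 : |2 * ε * ((coeffPoly c).eval (σ k)).re| < 1 := by
      rw [abs_mul, abs_mul, abs_two]
      calc _ ≤ 2 * |ε| * ∑ j, ‖c j‖ := by gcongr
        _ < 1 := by linarith
    linarith [neg_abs_le (2 * ε * ((coeffPoly c).eval (σ k)).re)]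
  refine mem_genClass hσ hτ hτσ (p := fun z => p z + ε * (pert p c z + Complex.I * s))
    (hp.add (((differentiableOn_pert hp c).add_const _).const_mul _)) (fun z hz => ?_)
    (l := fun k => l k * (1 + 2 * ε * ((coeffPoly c).eval (σ k)).re))
    (fun k => mul_neg_of_neg_of_pos (hl k) (hpos k)) (fun k => ?_) ?_
  · have h4 := abs_re_pert_le hp (fun z hz => (hre z hz).le) c hz
    have h5 := hre z hz
    have e : (p z + ε * (pert p c z + Complex.I * s)).re = (p z).re + ε * (pert p c z).re := by
      simp
    rw [e]
    have h6 : |ε * (pert p c z).re| < (p z).re := by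
      rw [abs_mul]
      calc |ε| * |(pert p c z).re| ≤ |ε| * (2 * (∑ j, ‖c j‖) * (p z).re) := by gcongr
        _ = 2 * (∑ j, ‖c j‖) * |ε| * (p z).re := by ring
        _ < 1 * (p z).re := by gcongr
        _ = (p z).re := one_mul _
    linarith [neg_abs_le (ε * (pert p c z).re)]
  · have h4 := hasAngularLimit_div_of_spectral hτ (hσ k) (hτσ k) (hs k)
    have h5 := hasAngularLimit_pert (hσ k) (h1 k) (h2 k) h4
    refine hasSpectralValue_of_div (p := fun z => p z + ε * (pert p c z + Complex.I * s))
      (hσ k) (hτσ k) ?_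
    refine ((h4.add ((HasAngularLimit.const (ε : ℂ)).mul h5)).congr fun z => ?_).congr_lim ?_
    · ring
    · push_cast; ring
  · have h4 : ∀ k, |l k * (1 + 2 * ε * ((coeffPoly c).eval (σ k)).re)| =
        |l k| + 2 * ε * (|l k| * ((coeffPoly c).eval (σ k)).re) := fun k => by
      rw [abs_mul, abs_of_pos (hpos k)]; ring
    simp only [h4, Finset.sum_add_distrib, ← Finset.mul_sum, h3]
    linarith

/-! ### Rationality of p when the perturbation vanishes. -/

theorem eqOn_ball_of_eqOn_diff {F H : ℂ → ℂ} (hF : ContinuousOn F (ball 0 1))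
    (hH : ContinuousOn H (ball 0 1)) {S : Set ℂ} (hS : S.Finite)
    (h : ∀ z, ‖z‖ < 1 → z ∉ S → F z = H z) {z : ℂ} (hz : ‖z‖ < 1) : F z = H z := by
  have hd : Dense Sᶜ := hS.countable.dense_compl ℂ
  have h1 : EqOn F H (ball 0 1 ∩ Sᶜ) := fun w hw => h w (by simpa using hw.1) hw.2
  exact h1.of_subset_closure hF hH inter_subset_left
    (hd.open_subset_closure_inter isOpen_ball) (by simpa using hz)

/-- Provides a point of the circle off the poles, where kernel sums are imaginary and constants can
be tested. -/
theorem exists_norm_eq_one_notMem {ι : Type*} [Finite ι] (σ : ι → ℂ) : ∃ ζ : ℂ, ‖ζ‖ = 1 ∧ ∀ k, ζ ≠ σ k := by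
  have : Infinite Circle := Circle.argEquiv.infinite_iff.2
    (Set.Ioc_infinite (by linarith [Real.pi_pos] : -Real.pi < Real.pi)).to_subtype
  have hinf : (Set.range fun u : Circle => (u : ℂ)).Infinite :=
    Set.infinite_range_of_injective Circle.coe_injective
  obtain ⟨ζ, ⟨u, hu⟩, hζ⟩ := hinf.exists_notMem_finite (Set.finite_range σ)
  exact ⟨ζ, by rw [← hu]; exact Circle.norm_coe u, fun k hk => hζ ⟨k, hk.symm⟩⟩

section
open Polynomial

theorem sq_sub_C_dvd {P : ℂ[X]} {a : ℂ} (h0 : P.eval a = 0) (h1 : P.derivative.eval a = 0) :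
    (X - C a) ^ 2 ∣ P := by
  obtain ⟨Q, rfl⟩ := dvd_iff_isRoot.2 h0
  have h2 : Q.eval a = 0 := by simpa using h1
  obtain ⟨R, rfl⟩ := dvd_iff_isRoot.2 h2
  exact ⟨R, by ring⟩

theorem exists_eq_C_mul_of_dvd {P Q : ℂ[X]} (hQ : Q.Monic) (hd : P.natDegree ≤ Q.natDegree)
    (h : Q ∣ P) : ∃ κ, P = C κ * Q := by
  obtain ⟨R, rfl⟩ := h
  rcases eq_or_ne R 0 with rfl | hR
  · exact ⟨0, by simp⟩
  · rw [hQ.natDegree_mul' hR] at hd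
    have : R.natDegree = 0 := by omega
    rw [eq_C_of_natDegree_eq_zero this]
    exact ⟨_, mul_comm _ _⟩

variable {n : ℕ}

/-- The monic polynomial with simple roots at the given points. -/
noncomputable def rootPoly (σ : Fin n → ℂ) : ℂ[X] := ∏ k, (X - C (σ k))

theorem monic_rootPoly (σ : Fin n → ℂ) : (rootPoly σ).Monic := monic_prod_X_sub_C _ _

theorem natDegree_rootPoly (σ : Fin n → ℂ) : (rootPoly σ).natDegree = n := by
  simp [rootPoly]

theorem eval_rootPoly (σ : Fin n → ℂ) (z : ℂ) : (rootPoly σ).eval z = ∏ k, (z - σ k) := by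
  simp [rootPoly, eval_prod]

theorem eval_rootPoly_ne_zero {σ : Fin n → ℂ} {z : ℂ} (hz : ∀ k, z ≠ σ k) :
    (rootPoly σ).eval z ≠ 0 := by
  rw [eval_rootPoly]
  exact Finset.prod_ne_zero_iff.2 fun k _ => sub_ne_zero.2 (hz k)

theorem rootPoly_eq_mul (σ : Fin n → ℂ) (k : Fin n) :
    rootPoly σ = (X - C (σ k)) * ∏ j ∈ Finset.univ.erase k, (X - C (σ j)) :=
  (Finset.mul_prod_erase Finset.univ (fun j => X - C (σ j)) (Finset.mem_univ k)).symm

theorem eq_C_mul_rootPoly {σ : Fin n → ℂ} (hinj : Function.Injective σ) {P : ℂ[X]}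
    (hd : P.natDegree ≤ n) (h0 : ∀ k, P.eval (σ k) = 0) : ∃ κ, P = C κ * rootPoly σ := by
  refine exists_eq_C_mul_of_dvd (monic_rootPoly σ) (by rwa [natDegree_rootPoly]) ?_
  exact Finset.prod_dvd_of_coprime ((pairwise_coprime_X_sub_C hinj).set_pairwise _)
    fun k _ => dvd_iff_isRoot.2 (h0 k)

theorem eq_C_mul_rootPoly_sq {σ : Fin n → ℂ} (hinj : Function.Injective σ) {P : ℂ[X]}
    (hd : P.natDegree ≤ 2 * n) (h0 : ∀ k, P.eval (σ k) = 0)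
    (h1 : ∀ k, P.derivative.eval (σ k) = 0) : ∃ κ, P = C κ * rootPoly σ ^ 2 := by
  refine exists_eq_C_mul_of_dvd ((monic_rootPoly σ).pow 2) ?_ ?_
  · rwa [natDegree_pow, natDegree_rootPoly]
  · rw [rootPoly, ← Finset.prod_pow]
    exact Finset.prod_dvd_of_coprime
      (fun i _ j _ hij => (pairwise_coprime_X_sub_C hinj hij).pow)
      fun k _ => sq_sub_C_dvd (h0 k) (h1 k)

/-- The polynomial `rootPoly σ * ∑ α_k (σ_k + z) / (σ_k - z)`. -/
noncomputable def massPoly (σ : Fin n → ℂ) (α : Fin n → ℝ) : ℂ[X] :=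
  ∑ k, C (-(α k : ℂ)) * ((X + C (σ k)) * ∏ j ∈ Finset.univ.erase k, (X - C (σ j)))

theorem natDegree_massPoly_le (σ : Fin n → ℂ) (α : Fin n → ℝ) : (massPoly σ α).natDegree ≤ n := by
  refine natDegree_sum_le_of_forall_le _ _ fun k _ => (natDegree_C_mul_le _ _).trans ?_
  refine natDegree_mul_le.trans ?_
  have hn : 0 < n := k.pos
  rw [natDegree_X_add_C, natDegree_prod_of_monic _ _ fun j _ => monic_X_sub_C _]
  simp
  omega

theorem eval_massPoly (σ : Fin n → ℂ) (α : Fin n → ℝ) {z : ℂ} (hz : ∀ k, z ≠ σ k) :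
    (massPoly σ α).eval z = (rootPoly σ).eval z * ∑ k, α k * ((σ k + z) / (σ k - z)) := by
  rw [massPoly, eval_finsetSum, Finset.mul_sum]
  refine Finset.sum_congr rfl fun k _ => ?_
  rw [rootPoly_eq_mul σ k]
  simp only [eval_mul, eval_C, eval_add, eval_X, eval_sub]
  have : σ k - z ≠ 0 := sub_ne_zero.2 (hz k).symm
  field_simp
  ring

theorem eval_reflect_conj {P : ℂ[X]} (hP : P.natDegree ≤ n) {z : ℂ} (hz : z ≠ 0) :
    (reflect n (P.map (starRingEnd ℂ))).eval z = z ^ n * (P.map (starRingEnd ℂ)).eval z⁻¹ := by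
  let _ : Invertible z⁻¹ := invertibleOfNonzero (inv_ne_zero hz)
  have h := eval₂_reflect_mul_pow (RingHom.id ℂ) z⁻¹ n (P.map (starRingEnd ℂ))
    ((natDegree_map_le).trans hP)
  rw [invOf_eq_inv, inv_inv] at h
  change (reflect n (P.map (starRingEnd ℂ))).eval z * z⁻¹ ^ n = (P.map (starRingEnd ℂ)).eval z⁻¹ at h
  rw [← h, inv_pow]
  field_simp

variable (p : ℂ → ℂ) (c : Fin (n + 1) → ℂ) (s : ℝ)

/-- `z ^ n` times the real trigonometric polynomial. -/
noncomputable def trigPoly : ℂ[X] :=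
  X ^ n * coeffPoly c + reflect n ((coeffPoly c).map (starRingEnd ℂ))

/-- `z ^ n` times the imaginary correction. -/
noncomputable def corrTrigPoly : ℂ[X] :=
  X ^ n * corrPoly p c - reflect n ((corrPoly p c).map (starRingEnd ℂ)) + C (Complex.I * s) * X ^ n

theorem eval_trigPoly {z : ℂ} (hz : z ≠ 0) : (trigPoly c).eval z = z ^ n * trig c z := by
  simp only [trigPoly, trig, eval_add, eval_mul, eval_pow, eval_X,
    eval_reflect_conj (natDegree_coeffPoly_le c) hz]
  ring

theorem eval_corrTrigPoly {z : ℂ} (hz : z ≠ 0) :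
    (corrTrigPoly p c s).eval z = z ^ n * (corr p c z + Complex.I * s) := by
  simp only [corrTrigPoly, corr, eval_add, eval_sub, eval_mul, eval_pow, eval_X, eval_C,
    eval_reflect_conj (natDegree_corrPoly_le p c) hz]
  ring

theorem natDegree_reflect_conj_le {P : ℂ[X]} (hP : P.natDegree ≤ n) :
    (reflect n (P.map (starRingEnd ℂ))).natDegree ≤ 2 * n := by
  have h1 : (P.map (starRingEnd ℂ)).natDegree ≤ n := natDegree_map_le.trans hP
  refine (natDegree_le_iff_coeff_eq_zero.2 fun N hN => ?_)
  rw [coeff_reflect, revAt_eq_self_of_lt (by omega), coeff_eq_zero_of_natDegree_lt (by omega)]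

theorem natDegree_X_pow_mul_le {P : ℂ[X]} (hP : P.natDegree ≤ n) :
    (X ^ n * P).natDegree ≤ 2 * n :=
  natDegree_mul_le.trans (by rw [natDegree_X_pow]; omega)

theorem natDegree_trigPoly_le : (trigPoly c).natDegree ≤ 2 * n :=
  natDegree_add_le_of_degree_le (natDegree_X_pow_mul_le (natDegree_coeffPoly_le c))
    (natDegree_reflect_conj_le (natDegree_coeffPoly_le c))

theorem natDegree_corrTrigPoly_le : (corrTrigPoly p c s).natDegree ≤ 2 * n :=
  natDegree_add_le_of_degree_le ((natDegree_sub_le_of_le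
    (natDegree_X_pow_mul_le (natDegree_corrPoly_le p c))
    (natDegree_reflect_conj_le (natDegree_corrPoly_le p c))).trans (max_self _).le)
    ((natDegree_C_mul_X_pow_le _ _).trans (by omega))

/-- The coefficient of degree n+j is c_j for j > 0 and 2 Re c_0 for j = 0, so only Im c_0 is
invisible. -/
theorem eq_zero_of_trigPoly_eq_zero {c : Fin (n + 1) → ℂ} (h : trigPoly c = 0)
    (h0 : (c 0).im = 0) : c = 0 := by
  funext j
  have h1 := congrArg (fun P => P.coeff (n + (j : ℕ))) h
  simp only [trigPoly, coeff_add, coeff_zero, coeff_reflect, coeff_map] at h1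
  rw [add_comm n (j : ℕ), coeff_X_pow_mul, coeffPoly_coeff] at h1
  rcases Nat.eq_zero_or_pos (j : ℕ) with hj | hj
  · have hj0 : j = 0 := Fin.ext hj
    rw [hj, zero_add, revAt_le le_rfl, Nat.sub_self, hj0] at h1
    have h2 := coeffPoly_coeff c 0
    rw [Fin.val_zero] at h2
    rw [h2, Complex.add_conj] at h1
    have h3 : 2 * (c 0).re = 0 := by exact_mod_cast h1
    rw [hj0]
    exact Complex.ext (by simpa using h3) (by simpa using h0)
  · rw [revAt_eq_self_of_lt (by omega),
      coeff_eq_zero_of_natDegree_lt (by have := natDegree_coeffPoly_le c; omega), map_zero,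
      add_zero] at h1
    exact h1

/-- A polynomial with an angular zero of order greater than one has a double zero. -/
theorem double_zero_of_angular {R : ℂ[X]} {σ : ℂ} (hσ : ‖σ‖ = 1) {g : 𝔻 → ℂ}
    (hg : HasAngularLimit g σ 0) (h : ∀ z : 𝔻, R.eval (z : ℂ) = (z - σ) * g z) :
    R.eval σ = 0 ∧ R.derivative.eval σ = 0 := by
  have h0 : R.eval σ = 0 := by
    have h1 : HasAngularLimit (fun z => R.eval (z : ℂ)) σ (R.eval σ) :=
      HasAngularLimit.of_continuousAt (F := fun z => R.eval z) (Polynomial.continuous R).continuousAt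
    have h2 : HasAngularLimit (fun z => R.eval (z : ℂ)) σ ((σ - σ) * 0) :=
      ((HasAngularLimit.of_continuousAt (F := fun z => z - σ) (by fun_prop)).mul hg).congr
        fun z => (h z).symm
    rw [h1.unique hσ h2, mul_zero]
  refine ⟨h0, ?_⟩
  have hd : HasAngularLimit (fun z => R.eval (z : ℂ) / (z - σ)) σ (R.derivative.eval σ) := by
    intro M hM
    have hcoe : Tendsto (fun z : 𝔻 => (z : ℂ))
        (comap (fun z : 𝔻 => (z : ℂ)) (𝓝 σ) ⊓ 𝓟 (stolzAngle σ M)) (𝓝[≠] σ) := by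
      refine tendsto_nhdsWithin_iff.2 ⟨tendsto_comap.mono_left inf_le_left,
        Eventually.of_forall fun z hz => ?_⟩
      exact ne_of_norm_lt_one hσ z.norm_lt_one (sub_eq_zero.2 (mem_singleton_iff.1 hz).symm)
    have h3 := (hasDerivAt_iff_tendsto_slope.1 (R.hasDerivAt σ)).comp hcoe
    refine h3.congr fun z => ?_
    rw [Function.comp_apply, slope_def_field, h0, sub_zero]
  refine (hd.congr fun z => ?_).unique hσ hg
  have : (z : ℂ) - σ ≠ 0 := by
    rw [← neg_sub]; exact neg_ne_zero.2 (ne_of_norm_lt_one hσ z.norm_lt_one)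
  rw [h, mul_div_cancel_left₀ _ this]

theorem hasAngularLimit_sum_cayley {σ : Fin n → ℂ} (hσ : ∀ k, ‖σ k‖ = 1)
    (hinj : Function.Injective σ) (α : Fin n → ℝ) (k : Fin n) :
    HasAngularLimit (fun z => (σ k - z) * ∑ j, α j * ((σ j + z) / (σ j - z))) (σ k)
      (2 * σ k * α k) := by
  have h1 : HasAngularLimit (fun z => α k * (σ k + z) +
      (σ k - z) * ∑ j ∈ Finset.univ.erase k, α j * ((σ j + z) / (σ j - z))) (σ k)
      (α k * (σ k + σ k) +
      (σ k - σ k) * ∑ j ∈ Finset.univ.erase k, α j * ((σ j + σ k) / (σ j - σ k))) := by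
    refine HasAngularLimit.of_continuousAt (F := fun z => α k * (σ k + z) +
      (σ k - z) * ∑ j ∈ Finset.univ.erase k, α j * ((σ j + z) / (σ j - z))) ?_
    refine ContinuousAt.add (by fun_prop) (ContinuousAt.mul (by fun_prop)
      (tendsto_finsetSum _ fun j hj => ?_))
    refine ContinuousAt.mul (by fun_prop) (ContinuousAt.div (by fun_prop) (by fun_prop) ?_)
    exact sub_ne_zero.2 fun h => (Finset.mem_erase.1 hj).1 (hinj h)
  refine (h1.congr fun z => ?_).congr_lim (by ring)
  rw [← Finset.add_sum_erase _ _ (Finset.mem_univ k), mul_add]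
  have := ne_of_norm_lt_one (hσ k) z.norm_lt_one
  field_simp

theorem re_sum_cayley_eq_zero {σ : Fin n → ℂ} (hσ : ∀ k, ‖σ k‖ = 1) (α : Fin n → ℝ) {ζ : ℂ}
    (hζ : ‖ζ‖ = 1) : (∑ k, (α k : ℂ) * ((σ k + ζ) / (σ k - ζ))).re = 0 := by
  rw [Complex.re_sum]
  refine Finset.sum_eq_zero fun k _ => ?_
  rw [Complex.re_ofReal_mul, re_cayley (hσ k), hζ]
  simp

/-- Double zeros at n distinct points exhaust the degree 2n. -/
theorem corrTrigPoly_eq_C_mul {p : ℂ → ℂ} {σ : Fin n → ℂ} (hσ : ∀ k, ‖σ k‖ = 1)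
    (hinj : Function.Injective σ) {c : Fin (n + 1) → ℂ} {s : ℝ}
    (h1 : ∀ k, 2 * ((corrPoly p c).eval (σ k)).im + s = 0)
    (h2 : ∀ k, (σ k * (corrPoly p c).derivative.eval (σ k)).re = 0) :
    ∃ κ, corrTrigPoly p c s = C κ * rootPoly σ ^ 2 := by
  have hval : ∀ k, corr p c (σ k) + Complex.I * s = 0 := fun k => by
    rw [corr_of_norm_eq_one p c (hσ k), ← mul_add, ← Complex.ofReal_add, h1 k]
    simp
  refine eq_C_mul_rootPoly_sq hinj (natDegree_corrTrigPoly_le p c s) (fun k => ?_) fun k => ?_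
  · rw [eval_corrTrigPoly p c s (ne_zero_of_norm_eq_one (hσ k)), hval, mul_zero]
  · have hσ0 := ne_zero_of_norm_eq_one (hσ k)
    have hd := hasDerivAt_corr p c (hσ k)
    rw [h2 k, Complex.ofReal_zero, mul_zero, zero_mul] at hd
    have hd2 := ((hasDerivAt_pow n (σ k))).mul (hd.add_const (Complex.I * s))
    rw [hval, mul_zero, mul_zero, add_zero] at hd2
    have hd3 : HasDerivAt (fun z => (corrTrigPoly p c s).eval z) 0 (σ k) := by
      refine hd2.congr_of_eventuallyEq ?_
      filter_upwards [isOpen_ne.mem_nhds hσ0] with z hz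
      exact eval_corrTrigPoly p c s hz
    exact ((corrTrigPoly p c s).hasDerivAt (σ k)).unique hd3

theorem eval_trigPoly_mul_eq {p : ℂ → ℂ} (hp : DifferentiableOn ℂ p (ball 0 1))
    {c : Fin (n + 1) → ℂ} {s : ℝ} (hT : ∀ z, ‖z‖ < 1 → pert p c z + Complex.I * s = 0)
    {z : ℂ} (hz : ‖z‖ < 1) :
    (trigPoly c).eval z * p z = -(corrTrigPoly p c s).eval z := by
  refine eqOn_ball_of_eqOn_diff (F := fun z => (trigPoly c).eval z * p z)
    (H := fun z => -(corrTrigPoly p c s).eval z)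
    ((Polynomial.continuous _).continuousOn.mul hp.continuousOn)
    (Polynomial.continuous _).neg.continuousOn (finite_singleton 0) (fun z hz hz0 => ?_) hz
  have hz0 : z ≠ 0 := hz0
  simp only [eval_trigPoly c hz0, eval_corrTrigPoly p c s hz0]
  have := hT z hz
  rw [pert_eq_trig_mul_add_corr p c hz0] at this
  linear_combination z ^ n * this

/-- If it were zero, `trigPoly` would vanish on the disc since p has no zeros, so c = 0; what is
left is the monomial i s z^n, forcing s = 0 as well. -/
theorem corrTrigPoly_ne_zero {p : ℂ → ℂ} (hp : DifferentiableOn ℂ p (ball 0 1))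
    (hp0 : ∀ z, ‖z‖ < 1 → p z ≠ 0) {c : Fin (n + 1) → ℂ} {s : ℝ} (hne : c ≠ 0 ∨ s ≠ 0)
    (h0 : (c 0).im = 0) (hT : ∀ z, ‖z‖ < 1 → pert p c z + Complex.I * s = 0) :
    corrTrigPoly p c s ≠ 0 := by
  intro hκ
  have hH0 : trigPoly c = 0 := by
    refine eq_zero_of_infinite_isRoot _ (Set.Infinite.mono (s := ball 0 1) (fun z hz => ?_) ?_)
    · have hz : ‖z‖ < 1 := by simpa using hz
      have := eval_trigPoly_mul_eq hp hT hz
      rw [hκ, eval_zero, neg_zero] at this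
      exact (mul_eq_zero.1 this).resolve_right (hp0 z hz)
    · exact infinite_of_mem_nhds (0 : ℂ) (ball_mem_nhds 0 one_pos)
  have hc := eq_zero_of_trigPoly_eq_zero hH0 h0
  refine hne.elim (fun h => h hc) (fun h => h ?_)
  have h3 : corrTrigPoly p c s = C (Complex.I * s) * X ^ n := by
    simp [hc, corrTrigPoly, corrPoly]
  have h4 : (C (Complex.I * s) * X ^ n : ℂ[X]).coeff n = 0 := by rw [← h3, hκ, coeff_zero]
  rw [coeff_C_mul, coeff_X_pow, if_pos rfl, mul_one] at h4
  exact Complex.ofReal_eq_zero.1 ((mul_eq_zero.1 h4).resolve_left Complex.I_ne_zero)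

theorem norm_lt_one_ne {σ : Fin n → ℂ} (hσ : ∀ k, ‖σ k‖ = 1) {z : ℂ} (hz : ‖z‖ < 1) (k : Fin n) :
    z ≠ σ k := fun h => ne_of_norm_lt_one (hσ k) hz (sub_eq_zero.2 h.symm)

/-- Both terms of the difference have mass α_k at σ_k, so σ_k - z times it tends to 0. With the
square of `rootPoly`, R is z - σ_k times something tending to 0, a double zero; the degree leaves
only a constant. -/
theorem eq_C_mul_rootPoly_sq_of_angular {q : ℂ → ℂ} {σ : Fin n → ℂ} (hσ : ∀ k, ‖σ k‖ = 1)
    (hinj : Function.Injective σ) {α : Fin n → ℝ}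
    (hα : ∀ k, HasAngularLimit (fun z => (σ k - z) * q z) (σ k) (2 * σ k * α k))
    {R : ℂ[X]} (hR : R.natDegree ≤ 2 * n)
    (hReval : ∀ z, ‖z‖ < 1 → R.eval z =
      (rootPoly σ).eval z ^ 2 * (q z - ∑ k, α k * ((σ k + z) / (σ k - z)))) :
    ∃ κ, R = C κ * rootPoly σ ^ 2 := by
  have hdz : ∀ k, R.eval (σ k) = 0 ∧ R.derivative.eval (σ k) = 0 := by
    intro k
    have h3 := (hα k).sub (hasAngularLimit_sum_cayley hσ hinj α k)
    rw [sub_self] at h3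
    set Q := ∏ j ∈ Finset.univ.erase k, (X - C (σ j)) with hQ
    have h4 : HasAngularLimit (fun z : 𝔻 => -Q.eval (z : ℂ) ^ 2) (σ k) (-Q.eval (σ k) ^ 2) :=
      HasAngularLimit.of_continuousAt (F := fun z => -Q.eval z ^ 2)
        ((Polynomial.continuous Q).pow 2).neg.continuousAt
    refine double_zero_of_angular (hσ k) ((h4.mul h3).congr_lim (mul_zero _)) fun z => ?_
    rw [hReval z z.norm_lt_one, rootPoly_eq_mul σ k, ← hQ, eval_mul, eval_sub, eval_X, eval_C]
    ring
  exact eq_C_mul_rootPoly_sq hinj hR (fun k => (hdz k).1) fun k => (hdz k).2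

/-- At a point of the circle off the σ_k, κ' plus the kernel sum is the quotient of a real number by
a nonzero imaginary one, and the kernel sum is itself imaginary. -/
theorem re_eq_zero_of_trigPoly_eq {p : ℂ → ℂ} {σ : Fin n → ℂ} (hσ : ∀ k, ‖σ k‖ = 1)
    {α : Fin n → ℝ} {c : Fin (n + 1) → ℂ} {s : ℝ} {κ κ' : ℂ} (hκ0 : κ ≠ 0)
    (hκ : corrTrigPoly p c s = C κ * rootPoly σ ^ 2)
    (hκ' : -(C κ⁻¹ * trigPoly c) - rootPoly σ * massPoly σ α = C κ' * rootPoly σ ^ 2) :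
    κ'.re = 0 := by
  obtain ⟨ζ, hζ, hζσ⟩ := exists_norm_eq_one_notMem σ
  have hζ0 := ne_zero_of_norm_eq_one hζ
  have h3 := congrArg (eval ζ) hκ'
  have h4 := congrArg (eval ζ) hκ
  have hQ0 := eval_rootPoly_ne_zero hζσ
  simp only [eval_sub, eval_neg, eval_mul, eval_C, eval_pow, eval_massPoly σ α hζσ] at h3
  simp only [eval_mul, eval_C, eval_pow, eval_corrTrigPoly p c s hζ0,
    corr_of_norm_eq_one p c hζ] at h4
  rw [eval_trigPoly c hζ0, trig_of_norm_eq_one c hζ] at h3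
  have hSre := re_sum_cayley_eq_zero hσ α hζ
  generalize 2 * ((coeffPoly c).eval ζ).re = t at *
  generalize 2 * ((corrPoly p c).eval ζ).im = u at *
  generalize (rootPoly σ).eval ζ = Q at *
  generalize ∑ k, (α k : ℂ) * ((σ k + ζ) / (σ k - ζ)) = S at *
  have hz : ζ ^ n ≠ 0 := pow_ne_zero n hζ0
  have h5 : -(t : ℂ) = ((u + s : ℝ) : ℂ) * (Complex.I * (κ' + S)) := by
    have h7 : κ * (-(κ⁻¹ * (ζ ^ n * (t : ℂ))) - Q * (Q * S)) = κ * (κ' * Q ^ 2) := by rw [h3]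
    have h8 : κ * κ⁻¹ = 1 := mul_inv_cancel₀ hκ0
    refine mul_left_cancel₀ hz ?_
    push_cast
    linear_combination h7 + (ζ ^ n * (t : ℂ)) * h8 - (κ' + S) * h4
  have h9 : u + s ≠ 0 := by
    intro h
    have h10 : ζ ^ n * (Complex.I * ((u + s : ℝ) : ℂ)) = κ * Q ^ 2 := by
      push_cast
      linear_combination h4
    rw [h, Complex.ofReal_zero, mul_zero, mul_zero] at h10
    exact mul_ne_zero hκ0 (pow_ne_zero 2 hQ0) h10.symm
  have h11 := congrArg Complex.im h5
  rw [Complex.im_ofReal_mul, Complex.I_mul_im, Complex.add_re, hSre, add_zero, Complex.neg_im,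
    Complex.ofReal_im, neg_zero] at h11
  exact (mul_eq_zero.1 h11.symm).resolve_left h9

/-- If a nontrivial admissible perturbation vanishes, then the reciprocal of `p` is a sum of Cayley
kernels up to an imaginary constant. -/
theorem inv_eq_of_pert_eq_zero {p : ℂ → ℂ} (hp : DifferentiableOn ℂ p (ball 0 1))
    (hp0 : ∀ z, ‖z‖ < 1 → p z ≠ 0) {σ : Fin n → ℂ} (hσ : ∀ k, ‖σ k‖ = 1)
    (hinj : Function.Injective σ) {α : Fin n → ℝ}
    (hα : ∀ k, HasAngularLimit (fun z => (σ k - z) * (p z)⁻¹) (σ k) (2 * σ k * α k))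
    {c : Fin (n + 1) → ℂ} {s : ℝ} (hne : c ≠ 0 ∨ s ≠ 0)
    (h1 : ∀ k, 2 * ((corrPoly p c).eval (σ k)).im + s = 0)
    (h2 : ∀ k, (σ k * (corrPoly p c).derivative.eval (σ k)).re = 0) (h0 : (c 0).im = 0)
    (hT : ∀ z, ‖z‖ < 1 → pert p c z + Complex.I * s = 0) :
    ∃ b : ℝ, ∀ z, ‖z‖ < 1 →
      (p z)⁻¹ = Complex.I * b + ∑ k, α k * ((σ k + z) / (σ k - z)) := by
  obtain ⟨κ, hκ⟩ := corrTrigPoly_eq_C_mul hσ hinj h1 h2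
  have hκ0 : κ ≠ 0 := by
    rintro rfl
    exact corrTrigPoly_ne_zero hp hp0 hne h0 hT (by rw [hκ, C_0, zero_mul])
  -- The relation p · `trigPoly` = -κ `rootPoly`² makes 1/p equal to -`trigPoly`/(κ `rootPoly`²);
  -- the kernels are subtracted after clearing denominators.
  have hReval : ∀ z, ‖z‖ < 1 →
      (-(C κ⁻¹ * trigPoly c) - rootPoly σ * massPoly σ α).eval z =
      (rootPoly σ).eval z ^ 2 * ((p z)⁻¹ - ∑ k, α k * ((σ k + z) / (σ k - z))) := by
    intro z hz
    have h3 := eval_trigPoly_mul_eq hp hT hz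
    rw [hκ, eval_mul, eval_pow, eval_C] at h3
    have h5 : (trigPoly c).eval z = -(κ * (rootPoly σ).eval z ^ 2 * (p z)⁻¹) := by
      rw [← mul_inv_cancel_right₀ (hp0 z hz) ((trigPoly c).eval z), h3]
      ring
    rw [eval_sub, eval_neg, eval_mul, eval_mul, eval_C, eval_massPoly σ α (norm_lt_one_ne hσ hz), h5]
    have h8 : κ⁻¹ * κ = 1 := inv_mul_cancel₀ hκ0
    linear_combination ((rootPoly σ).eval z ^ 2 * (p z)⁻¹) * h8
  obtain ⟨κ', hκ'⟩ := eq_C_mul_rootPoly_sq_of_angular hσ hinj hα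
    ((natDegree_sub_le _ _).trans (max_le
      (by rw [natDegree_neg]; exact (natDegree_C_mul_le _ _).trans (natDegree_trigPoly_le c))
      (natDegree_mul_le.trans (by
        rw [natDegree_rootPoly]; have := natDegree_massPoly_le σ α; omega)))) hReval
  have hκre := re_eq_zero_of_trigPoly_eq hσ hκ0 hκ hκ'
  refine ⟨κ'.im, fun z hz => ?_⟩
  have h3 := hReval z hz
  rw [hκ', eval_mul, eval_C, eval_pow, mul_comm] at h3
  have h4 := mul_left_cancel₀
    (pow_ne_zero 2 (eval_rootPoly_ne_zero (norm_lt_one_ne hσ hz))) h3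
  have h5 : κ' = Complex.I * κ'.im := Complex.ext (by simp [hκre]) (by simp)
  rw [← h5, h4]
  ring

end

/-! ### Rational functions with n atoms and their decompositions. -/

section
open Polynomial

variable {n : ℕ}

theorem eval_massPoly_self (σ : Fin n → ℂ) (α : Fin n → ℝ) (k : Fin n) :
    (massPoly σ α).eval (σ k) =
      -(α k : ℂ) * ((σ k + σ k) * ∏ j ∈ Finset.univ.erase k, (σ k - σ j)) := by
  rw [massPoly, eval_finsetSum, Finset.sum_eq_single k]
  · simp [eval_prod]
  · intro j _ hjk
    have : (∏ i ∈ Finset.univ.erase j, (X - C (σ i))).eval (σ k) = 0 := by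
      rw [eval_prod]
      exact Finset.prod_eq_zero (Finset.mem_erase.2 ⟨hjk.symm, Finset.mem_univ k⟩) (by simp)
    rw [eval_mul, eval_mul, this, mul_zero, mul_zero]
  · simp

theorem coeff_massPoly (σ : Fin n → ℂ) (α : Fin n → ℝ) :
    (massPoly σ α).coeff n = -((∑ k, α k : ℝ) : ℂ) := by
  rw [massPoly, finsetSum_coeff]
  push_cast
  rw [← Finset.sum_neg_distrib]
  refine Finset.sum_congr rfl fun k _ => ?_
  have hm : ((X + C (σ k)) * ∏ j ∈ Finset.univ.erase k, (X - C (σ j))).Monic :=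
    (monic_X_add_C _).mul (monic_prod_of_monic _ _ fun j _ => monic_X_sub_C _)
  have hd : ((X + C (σ k)) * ∏ j ∈ Finset.univ.erase k, (X - C (σ j))).natDegree = n := by
    have hn : 0 < n := k.pos
    rw [(monic_X_add_C _).natDegree_mul (monic_prod_of_monic _ _ fun j _ => monic_X_sub_C _),
      natDegree_X_add_C, natDegree_prod_of_monic _ _ fun j _ => monic_X_sub_C _]
    simp
    omega
  have h := hm.coeff_natDegree
  rw [hd] at h
  rw [coeff_C_mul, h, mul_one]

/-- The numerator of `i b + ∑ α_k (σ_k + z) / (σ_k - z)` over the denominator `rootPoly σ`. -/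
noncomputable def numPoly (σ : Fin n → ℂ) (α : Fin n → ℝ) (b : ℂ) : ℂ[X] :=
  C b * rootPoly σ + massPoly σ α

theorem natDegree_numPoly_le (σ : Fin n → ℂ) (α : Fin n → ℝ) (b : ℂ) :
    (numPoly σ α b).natDegree ≤ n :=
  natDegree_add_le_of_degree_le ((natDegree_C_mul_le _ _).trans (natDegree_rootPoly σ).le)
    (natDegree_massPoly_le σ α)

theorem eval_numPoly (σ : Fin n → ℂ) (α : Fin n → ℝ) (b : ℂ) {z : ℂ} (hz : ∀ k, z ≠ σ k) :
    (numPoly σ α b).eval z =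
      (rootPoly σ).eval z * (b + ∑ k, α k * ((σ k + z) / (σ k - z))) := by
  rw [numPoly, eval_add, eval_mul, eval_C, eval_massPoly σ α hz]
  ring

theorem sum_pos_of_pos [NeZero n] {α : Fin n → ℝ} (hα : ∀ k, 0 < α k) : 0 < ∑ k, α k :=
  Finset.sum_pos (fun k _ => hα k) Finset.univ_nonempty

theorem coeff_numPoly_ne_zero [NeZero n] (σ : Fin n → ℂ) {α : Fin n → ℝ} (hα : ∀ k, 0 < α k)
    (b : ℝ) : (numPoly σ α (Complex.I * b)).coeff n ≠ 0 := by
  intro h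
  have h1 := (monic_rootPoly σ).coeff_natDegree
  rw [natDegree_rootPoly] at h1
  rw [numPoly, coeff_add, coeff_C_mul, h1, mul_one, coeff_massPoly] at h
  have h2 := congrArg Complex.re h
  simp only [Complex.add_re, Complex.neg_re, Complex.ofReal_re, Complex.I_mul_re,
    Complex.ofReal_im, Complex.zero_re] at h2
  linarith [sum_pos_of_pos hα]

theorem eval_numPoly_self_ne_zero {σ : Fin n → ℂ} (hσ : ∀ k, ‖σ k‖ = 1)
    (hinj : Function.Injective σ) {α : Fin n → ℝ} (hα : ∀ k, 0 < α k) (b : ℂ) (k : Fin n) :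
    (numPoly σ α b).eval (σ k) ≠ 0 := by
  have h0 : (rootPoly σ).eval (σ k) = 0 := by rw [rootPoly_eq_mul σ k]; simp
  rw [numPoly, eval_add, eval_mul, h0, mul_zero, zero_add, eval_massPoly_self, ← two_mul]
  refine mul_ne_zero (neg_ne_zero.2 (by exact_mod_cast (hα k).ne')) (mul_ne_zero
    (mul_ne_zero two_ne_zero (ne_zero_of_norm_eq_one (hσ k))) (Finset.prod_ne_zero_iff.2 ?_))
  exact fun j hj => sub_ne_zero.2 fun h => (Finset.mem_erase.1 hj).1 (hinj h).symm

/-- Off the circle the kernel sum has real part of the sign of 1-|ζ|², so it cannot cancel ib. -/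
theorem norm_eq_one_of_eval_numPoly_eq_zero [NeZero n] {σ : Fin n → ℂ} (hσ : ∀ k, ‖σ k‖ = 1)
    {α : Fin n → ℝ} (hα : ∀ k, 0 < α k) {b : ℝ} {ζ : ℂ}
    (h : (numPoly σ α (Complex.I * b)).eval ζ = 0) : ‖ζ‖ = 1 := by
  by_contra hζ
  have hζσ : ∀ k, ζ ≠ σ k := fun k hk => hζ (by rw [hk, hσ])
  rw [eval_numPoly σ α _ hζσ] at h
  have h1 := congrArg Complex.re ((mul_eq_zero.1 h).resolve_left (eval_rootPoly_ne_zero hζσ))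
  simp only [Complex.add_re, Complex.I_mul_re, Complex.ofReal_im, neg_zero, zero_add,
    Complex.re_sum, Complex.re_ofReal_mul, Complex.zero_re, re_cayley (hσ _)] at h1
  have h2 : (1 - ‖ζ‖ ^ 2) * ∑ k, α k / ‖σ k - ζ‖ ^ 2 = 0 := by
    rw [← h1, Finset.mul_sum]
    exact Finset.sum_congr rfl fun k _ => by ring
  rcases mul_eq_zero.1 h2 with h3 | h3
  · exact hζ ((pow_eq_one_iff_of_nonneg (norm_nonneg ζ) two_ne_zero).1 (by linarith))
  · refine (sum_pos_of_pos fun k => ?_).ne' h3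
    have := norm_pos_iff.2 (sub_ne_zero.2 (hζσ k).symm)
    have := hα k
    positivity

/-- The value of a polynomial at a boundary point is determined by its angular limit. -/
theorem eval_eq_of_angular {P : ℂ[X]} {σ l : ℂ} (hσ : ‖σ‖ = 1) {g : 𝔻 → ℂ}
    (hg : HasAngularLimit g σ l) (h : ∀ z : 𝔻, P.eval (z : ℂ) = g z) : P.eval σ = l := by
  have h1 : HasAngularLimit (fun z => P.eval (z : ℂ)) σ (P.eval σ) :=
    HasAngularLimit.of_continuousAt (F := fun z => P.eval z) (Polynomial.continuous P).continuousAt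
  exact h1.unique hσ (hg.congr fun z => (h z).symm)

theorem hasAngularLimit_eval (P : ℂ[X]) (σ : ℂ) :
    HasAngularLimit (fun z : 𝔻 => P.eval (z : ℂ)) σ (P.eval σ) :=
  HasAngularLimit.of_continuousAt (F := fun z => P.eval z) (Polynomial.continuous P).continuousAt

/-- The numerator factors over `n` distinct points of the unit circle. -/
theorem exists_numPoly_eq [NeZero n] {σ : Fin n → ℂ} (hσ : ∀ k, ‖σ k‖ = 1)
    (hinj : Function.Injective σ) {α : Fin n → ℝ} (hα : ∀ k, 0 < α k) {b : ℝ} {p : ℂ → ℂ}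
    (hp : DifferentiableOn ℂ p (ball 0 1)) (hre : ∀ z, ‖z‖ < 1 → 0 ≤ (p z).re)
    (hq : ∀ z, ‖z‖ < 1 → (numPoly σ α (Complex.I * b)).eval z * p z = (rootPoly σ).eval z) :
    ∃ (ζ : Fin n → ℂ) (c : ℂ), c ≠ 0 ∧ (∀ j, ‖ζ j‖ = 1) ∧ Function.Injective ζ ∧
      numPoly σ α (Complex.I * b) = C c * rootPoly ζ := by
  set N := numPoly σ α (Complex.I * b) with hN
  have hcoeff : N.coeff n ≠ 0 := coeff_numPoly_ne_zero σ hα b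
  have hN0 : N ≠ 0 := by rintro h; rw [h] at hcoeff; simp at hcoeff
  have hdeg : N.natDegree = n :=
    le_antisymm (natDegree_numPoly_le _ _ _) (le_natDegree_of_ne_zero hcoeff)
  have hnorm : ∀ ζ, N.eval ζ = 0 → ‖ζ‖ = 1 := fun ζ =>
    norm_eq_one_of_eval_numPoly_eq_zero hσ hα
  -- At a double zero ζ of N, finiteness of the mass of p would make N p = `rootPoly σ` vanish at ζ.
  -- Then ζ would be some σ_k, where N is nonzero.
  have hnodup : N.roots.Nodup := by
    rw [Multiset.nodup_iff_count_le_one]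
    intro ζ
    rw [count_roots]
    by_contra hlt
    obtain ⟨R, hR⟩ := (le_rootMultiplicity_iff hN0).1 (show 2 ≤ rootMultiplicity ζ N by omega)
    have hζ0 : N.eval ζ = 0 := by rw [hR]; simp
    have hζ := hnorm ζ hζ0
    obtain ⟨β, -, -, hβ⟩ := julia_wolff hp hre hζ
    have h1 := ((hasAngularLimit_eval ((C ζ - X) * R) ζ).mul hβ)
    have h2 := eval_eq_of_angular (P := rootPoly σ) hζ h1 fun z => by
      rw [← hq z z.norm_lt_one, hR]
      simp only [eval_mul, eval_pow, eval_sub, eval_X, eval_C]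
      ring
    rw [eval_mul, eval_sub, eval_C, eval_X, sub_self, zero_mul, zero_mul] at h2
    refine eval_rootPoly_ne_zero (fun k hk => ?_) h2
    exact eval_numPoly_self_ne_zero hσ hinj hα (Complex.I * b) k (by rw [← hk]; exact hζ0)
  have hcard : N.roots.toFinset.card = n := by
    rw [Multiset.toFinset_card_of_nodup hnodup, ← hdeg]
    exact (IsAlgClosed.splits N).natDegree_eq_card_roots.symm
  let e := N.roots.toFinset.equivFinOfCardEq hcard
  have hroot : ∀ j, N.eval (e.symm j : ℂ) = 0 := fun j =>
    (mem_roots hN0).1 (Multiset.mem_toFinset.1 (e.symm j).2)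
  have hinje : Function.Injective fun j => (e.symm j : ℂ) :=
    Subtype.val_injective.comp e.symm.injective
  obtain ⟨c, hc⟩ := eq_C_mul_rootPoly hinje (natDegree_numPoly_le _ _ _) hroot
  refine ⟨fun j => (e.symm j : ℂ), c, ?_, fun j => hnorm _ (hroot j), hinje, hc⟩
  rintro rfl
  rw [C_0, zero_mul] at hc
  exact hN0 hc

/-- A function with prescribed masses at the poles differs from the Cayley kernel sum by an
imaginary constant. -/
theorem exists_eq_sum_cayley [NeZero n] {σ ζ : Fin n → ℂ} (hσ : ∀ k, ‖σ k‖ = 1)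
    (hζ : ∀ k, ‖ζ k‖ = 1) (hinj : Function.Injective ζ) {α β : Fin n → ℝ} {b : ℝ} {c : ℂ}
    (hc : c ≠ 0) (hN : numPoly σ α (Complex.I * b) = C c * rootPoly ζ) {p : ℂ → ℂ}
    (hq : ∀ z, ‖z‖ < 1 → (numPoly σ α (Complex.I * b)).eval z * p z = (rootPoly σ).eval z)
    (hβ : ∀ k, HasAngularLimit (fun z => (ζ k - z) * p z) (ζ k) (2 * ζ k * β k)) :
    ∃ κ : ℂ, κ.re = 0 ∧ ∀ z, ‖z‖ < 1 → p z = κ + ∑ k, β k * ((ζ k + z) / (ζ k - z)) := by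
  -- After clearing denominators, equal masses make T vanish at every ζ_k; its degree is at most n.
  set T := rootPoly σ - C c * massPoly ζ β with hT
  have hTeval : ∀ z, ‖z‖ < 1 → T.eval z =
      c * (rootPoly ζ).eval z * (p z - ∑ k, β k * ((ζ k + z) / (ζ k - z))) := by
    intro z hz
    rw [hT, eval_sub, eval_mul, eval_C, ← hq z hz, hN,
      eval_massPoly ζ β (norm_lt_one_ne hζ hz), eval_mul, eval_C]
    ring
  obtain ⟨κ, hκ⟩ : ∃ κ, T = C κ * rootPoly ζ := by
    refine eq_C_mul_rootPoly hinj ((natDegree_sub_le _ _).trans (max_le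
      (natDegree_rootPoly σ).le ((natDegree_C_mul_le _ _).trans (natDegree_massPoly_le ζ β))))
      fun k => ?_
    have h3 := (hβ k).sub (hasAngularLimit_sum_cayley hζ hinj β k)
    rw [sub_self] at h3
    set Q := ∏ j ∈ Finset.univ.erase k, (X - C (ζ j)) with hQ
    refine eval_eq_of_angular (hζ k)
      (((hasAngularLimit_eval (-(C c * Q)) (ζ k)).mul h3).congr_lim (mul_zero _)) fun z => ?_
    rw [hTeval z z.norm_lt_one, rootPoly_eq_mul ζ k, ← hQ]
    simp only [eval_mul, eval_sub, eval_X, eval_C, eval_neg]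
    ring
  refine ⟨c⁻¹ * κ, ?_, fun z hz => ?_⟩
  -- At a point of the circle avoiding both families, the constant is a difference of two imaginary
  -- numbers: the reciprocal of ib plus one kernel sum, and the other kernel sum.
  · obtain ⟨ξ, hξ, hξn⟩ := exists_norm_eq_one_notMem (Sum.elim σ ζ)
    have hξσ : ∀ k, ξ ≠ σ k := fun k => hξn (Sum.inl k)
    have hξζ : ∀ k, ξ ≠ ζ k := fun k => hξn (Sum.inr k)
    have h1 := congrArg (eval ξ) hκ
    have h2 := congrArg (eval ξ) hN
    rw [hT, eval_sub, eval_mul, eval_C, eval_massPoly ζ β hξζ, eval_mul, eval_C] at h1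
    rw [eval_numPoly σ α _ hξσ, eval_mul, eval_C] at h2
    have hA := re_sum_cayley_eq_zero hσ α hξ
    have hB := re_sum_cayley_eq_zero hζ β hξ
    have hP := eval_rootPoly_ne_zero hξσ
    have hR := eval_rootPoly_ne_zero hξζ
    generalize ∑ k, (α k : ℂ) * ((σ k + ξ) / (σ k - ξ)) = A at *
    generalize ∑ k, (β k : ℂ) * ((ζ k + ξ) / (ζ k - ξ)) = B at *
    generalize (rootPoly σ).eval ξ = P at *
    generalize (rootPoly ζ).eval ξ = R at *
    have hq0 : Complex.I * b + A ≠ 0 := by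
      intro h
      rw [h, mul_zero] at h2
      exact mul_ne_zero hc hR h2.symm
    have h3 : c⁻¹ * κ = (Complex.I * b + A)⁻¹ - B := by
      field_simp
      refine mul_left_cancel₀ hR ?_
      linear_combination -(Complex.I * b + A) * h1 + h2
    rw [h3, Complex.sub_re, Complex.inv_re, hB, Complex.add_re, hA]
    simp
  · have h1 := hTeval z hz
    rw [hκ, eval_mul, eval_C] at h1
    have hR := eval_rootPoly_ne_zero (norm_lt_one_ne hζ hz)
    have h2 : κ = c * (p z - ∑ k, β k * ((ζ k + z) / (ζ k - z))) :=
      mul_left_cancel₀ hR (by linear_combination h1)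
    rw [h2, inv_mul_cancel_left₀ hc]
    ring

/-- The reciprocal of a sum of Cayley kernels is extreme up to scaling among the functions with
nonnegative real part vanishing at the given boundary points. -/
theorem eq_mul_of_add_eq [NeZero n] {σ : Fin n → ℂ} (hσ : ∀ k, ‖σ k‖ = 1)
    (hinj : Function.Injective σ) {α : Fin n → ℝ} (hα : ∀ k, 0 < α k) {b : ℝ} {p p₁ p₂ : ℂ → ℂ}
    (hp₁ : DifferentiableOn ℂ p₁ (ball 0 1)) (hre₁ : ∀ z, ‖z‖ < 1 → 0 ≤ (p₁ z).re)
    (hp₂ : DifferentiableOn ℂ p₂ (ball 0 1)) (hre₂ : ∀ z, ‖z‖ < 1 → 0 ≤ (p₂ z).re)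
    {s t : ℝ} (hs : 0 < s) (ht : 0 < t) (hsum : ∀ z, ‖z‖ < 1 → p z = s * p₁ z + t * p₂ z)
    (hq : ∀ z, ‖z‖ < 1 → (Complex.I * b + ∑ k, α k * ((σ k + z) / (σ k - z))) * p z = 1)
    (hz : ∀ k, HasAngularLimit (fun z => p₁ z) (σ k) 0) :
    ∃ κ : ℂ, ∀ z, ‖z‖ < 1 → p₁ z = κ * p z := by
  have hp : DifferentiableOn ℂ p (ball 0 1) :=
    ((hp₁.const_mul _).add (hp₂.const_mul _)).congr fun z hz => hsum z (by simpa using hz)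
  have hre : ∀ z, ‖z‖ < 1 → 0 ≤ (p z).re := fun z hz => by
    rw [hsum z hz, Complex.add_re, Complex.re_ofReal_mul, Complex.re_ofReal_mul]
    have := hre₁ z hz
    have := hre₂ z hz
    positivity
  have hqN : ∀ z, ‖z‖ < 1 →
      (numPoly σ α (Complex.I * b)).eval z * p z = (rootPoly σ).eval z := fun z hz => by
    rw [eval_numPoly σ α _ (norm_lt_one_ne hσ hz), mul_assoc, hq z hz, mul_one]
  obtain ⟨ζ, c, hc, hζ, hζi, hN⟩ := exists_numPoly_eq hσ hinj hα hp hre hqN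
  choose β₁ hβ₁' using fun k => julia_wolff hp₁ hre₁ (hζ k)
  choose β₂ hβ₂' using fun k => julia_wolff hp₂ hre₂ (hζ k)
  have hβ₁ := fun k => (hβ₁' k).2.2
  have hβ₂ := fun k => (hβ₂' k).2.2
  have hβ : ∀ k, HasAngularLimit (fun z => (ζ k - z) * p z) (ζ k)
      (2 * ζ k * ((s * β₁ k + t * β₂ k : ℝ) : ℂ)) := fun k => by
    refine ((((HasAngularLimit.const (s : ℂ)).mul (hβ₁ k)).add
      ((HasAngularLimit.const (t : ℂ)).mul (hβ₂ k))).congr fun z => ?_).congr_lim ?_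
    · rw [hsum z z.norm_lt_one]
      ring
    · push_cast
      ring
  obtain ⟨κ, hκ, hpκ⟩ := exists_eq_sum_cayley hσ hζ hζi hc hN hqN hβ
  have hr₁ := re_sub_sum_nonneg hp₁ hre₁ hζ hζi hβ₁ Finset.univ
  have hr₂ := re_sub_sum_nonneg hp₂ hre₂ hζ hζi hβ₂ Finset.univ
  have h01 : ‖(0 : ℂ)‖ < 1 := by simp
  -- Removing the masses leaves remainders with nonnegative real part whose combination with weights
  -- s, t is the imaginary constant κ; hence the real part of each is 0, and the first remainder is
  -- constant.
  have hre0 : (p₁ 0 - ∑ k, β₁ k * ((ζ k + 0) / (ζ k - 0))).re = 0 := by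
    have h1 := hpκ 0 h01
    rw [hsum 0 h01] at h1
    have h2 : s * (p₁ 0 - ∑ k, β₁ k * ((ζ k + 0) / (ζ k - 0))) +
        t * (p₂ 0 - ∑ k, β₂ k * ((ζ k + 0) / (ζ k - 0))) = κ := by
      have h3 : ∑ k, ((s * β₁ k + t * β₂ k : ℝ) : ℂ) * ((ζ k + 0) / (ζ k - 0)) =
          s * ∑ k, β₁ k * ((ζ k + 0) / (ζ k - 0)) +
          t * ∑ k, β₂ k * ((ζ k + 0) / (ζ k - 0)) := by
        rw [Finset.mul_sum, Finset.mul_sum, ← Finset.sum_add_distrib]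
        refine Finset.sum_congr rfl fun k _ => ?_
        push_cast
        ring
      rw [h3] at h1
      linear_combination h1
    have h4 := congrArg Complex.re h2
    rw [Complex.add_re, Complex.re_ofReal_mul, Complex.re_ofReal_mul, hκ] at h4
    nlinarith [hr₁ 0 h01, hr₂ 0 h01, mul_nonneg hs.le (hr₁ 0 h01), mul_nonneg ht.le (hr₂ 0 h01)]
  have hconst : ∀ z, ‖z‖ < 1 → p₁ z - ∑ k, β₁ k * ((ζ k + z) / (ζ k - z)) =
      p₁ 0 - ∑ k, β₁ k * ((ζ k + 0) / (ζ k - 0)) := fun z hz =>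
    eq_of_re_eq_zero
      (p := fun z => p₁ z - ∑ k, β₁ k * ((ζ k + z) / (ζ k - z)))
      (hp₁.sub (DifferentiableOn.fun_sum fun k _ => (differentiableOn_cayley (hζ k)).const_mul _))
      hr₁ h01 hre0 hz
  generalize p₁ 0 - ∑ k, β₁ k * ((ζ k + 0) / (ζ k - 0)) = κ₁ at hconst
  have hU : ∀ z, ‖z‖ < 1 → (C c * numPoly ζ β₁ κ₁).eval z =
      (numPoly σ α (Complex.I * b)).eval z * p₁ z := fun z hz => by
    rw [hN, eval_mul, eval_mul, eval_C, eval_numPoly ζ β₁ _ (norm_lt_one_ne hζ hz),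
      ← hconst z hz]
    ring
  -- Now p₁ is rational over the denominator N of p. Its numerator has degree at most n and vanishes
  -- at every σ_k because p₁ does, so it is a multiple of `rootPoly σ`.
  obtain ⟨κ', hκ'⟩ := eq_C_mul_rootPoly hinj
    ((natDegree_C_mul_le _ _).trans (natDegree_numPoly_le ζ β₁ κ₁)) fun k =>
      eval_eq_of_angular (hσ k) (((hasAngularLimit_eval _ (σ k)).mul (hz k)).congr_lim
        (mul_zero _)) fun z => hU z z.norm_lt_one
  refine ⟨κ', fun z hz => ?_⟩
  have h1 := hU z hz
  rw [hκ', eval_mul, eval_C, ← hqN z hz] at h1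
  refine mul_left_cancel₀ (a := (numPoly σ α (Complex.I * b)).eval z) ?_ (by linear_combination -h1)
  intro h
  have := hqN z hz
  rw [h, zero_mul] at this
  exact eval_rootPoly_ne_zero (norm_lt_one_ne hσ hz) this.symm

end

/-! ### Extreme points of the class. -/

theorem isHol_const_mul {f : 𝔻 → ℂ} (hf : IsHol f) (c : ℂ) : IsHol (fun z => c * f z) := by
  obtain ⟨F, hF, hFf⟩ := hf.exists_ext
  have := isHol_coe_of_differentiableOn (hF.const_mul c)
  simpa only [hFf] using this

theorem HasSpectralValue.const_mul {G : 𝔻 → ℂ} {σ : ℂ} {l : ℝ} (h : HasSpectralValue G σ l)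
    (c : ℝ) : HasSpectralValue (fun z => (c : ℂ) * G z) σ (c * l) :=
  (((HasAngularLimit.const (c : ℂ)).mul h).congr fun z => (mul_div_assoc _ _ _).symm).congr_lim
    (by push_cast; rfl)

variable {n : ℕ}

/-- Rescaling time multiplies generators by positive constants. -/
theorem smul_mem_genClass {τ : ℂ} {σ : Fin n → ℂ} {φ : ℝ≥0 → 𝔻 → 𝔻} {G : 𝔻 → ℂ}
    (hφ : IsSemigroup φ) (hG : IsGenerator φ G) (hDW : HasDWPoint φ τ)
    (hF : ∀ k, IsSemigroupBRFP φ (σ k)) {l : Fin n → ℝ}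
    (hl : ∀ k, l k < 0 ∧ HasSpectralValue G (σ k) (l k)) {c : ℝ≥0} (hc : 0 < c)
    (hsum : c * ∑ k, |l k| ≤ 1) : (fun z => (c : ℂ) * G z) ∈ GenClass τ σ := by
  have hc' : (0 : ℝ) < c := hc
  refine Or.inr ⟨fun t => φ (c * t), ⟨fun t => hφ.hol _, fun z => ?_, fun s t z => ?_, fun z => ?_⟩,
    ⟨isHol_const_mul hG.1 _, fun z t => ?_⟩, fun t => hDW _, fun k t => hF k _,
    fun k => c * l k, fun k => ⟨mul_neg_of_pos_of_neg hc' (hl k).1, (hl k).2.const_mul c⟩, ?_⟩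
  · rw [mul_zero, hφ.zero]
  · rw [mul_add, hφ.add]
  · refine (hφ.tendsto z).comp (tendsto_nhdsWithin_iff.2 ⟨?_, ?_⟩)
    · have : Continuous fun t : ℝ≥0 => c * t := by fun_prop
      simpa using (this.tendsto 0).mono_left nhdsWithin_le_nhds
    · filter_upwards [self_mem_nhdsWithin] with t ht
      exact mul_pos hc ht
  · have h1 := hG.2 z (c * t)
    rw [NNReal.coe_mul] at h1
    have h2 : HasDerivWithinAt (fun s : ℝ => (c : ℝ) * s) c (Ici 0) t := by
      simpa using ((hasDerivWithinAt_id (t : ℝ) (Ici 0)).const_mul (c : ℝ))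
    have h3 := h1.scomp (t : ℝ) h2 fun s (hs : 0 ≤ s) => mul_nonneg hc'.le hs
    refine (h3.congr_of_mem (fun s _ => ?_) t.2).congr_deriv ?_
    · rw [Function.comp_apply, Real.toNNReal_mul hc'.le, Real.toNNReal_coe]
    · rw [Complex.real_smul]
  · simpa only [abs_mul, abs_of_pos hc', ← Finset.mul_sum] using hsum

/-- Members of `Gen_τ(F)` have a Berkson-Porta representation and spectral values. -/
theorem exists_berkson_porta_of_mem {τ : ℂ} (hτ : ‖τ‖ ≤ 1) {σ : Fin n → ℂ} {G : 𝔻 → ℂ}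
    (hG : G ∈ GenClass τ σ) : ∃ (p : ℂ → ℂ) (l : Fin n → ℝ),
      DifferentiableOn ℂ p (ball 0 1) ∧ (∀ z, ‖z‖ < 1 → 0 ≤ (p z).re) ∧
      (G = fun z : 𝔻 => (τ - z) * (1 - conj τ * z) * p z) ∧
      (∀ k, HasSpectralValue (fun z : 𝔻 => (τ - z) * (1 - conj τ * z) * p z) (σ k) (l k)) ∧
      (∀ k, l k ≤ 0) ∧ ∑ k, |l k| ≤ 1 := by
  rcases hG with rfl | ⟨φ, hφ, hG, hDW, -, l, hl, hsum⟩
  · refine ⟨0, 0, differentiableOn_const _, fun _ _ => le_rfl, ?_, fun k => ?_, fun _ => le_rfl, ?_⟩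
    · funext z
      simp
    · refine ((HasAngularLimit.const 0).congr fun z => ?_).congr_lim ?_ <;> simp
    · simp
  · obtain ⟨p, hp, hre, hGp⟩ := exists_berkson_porta hφ hG hτ hDW
    obtain rfl : G = fun z : 𝔻 => (τ - z) * (1 - conj τ * z) * p z := funext hGp
    exact ⟨p, l, hp, hre, rfl, fun k => (hl k).2, fun k => (hl k).1.le, hsum⟩

theorem hasAngularLimit_zero_of_spectral {τ σ : ℂ} (hτ : ‖τ‖ ≤ 1) (hσ : ‖σ‖ = 1) (hτσ : τ ≠ σ)
    {p : ℂ → ℂ} {l : ℝ}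
    (h : HasSpectralValue (fun z : 𝔻 => (τ - z) * (1 - conj τ * z) * p z) σ l) :
    HasAngularLimit (fun z => p z) σ 0 := by
  refine (((HasAngularLimit.of_continuousAt (F := fun z => σ - z) (by fun_prop)).mul
    (hasAngularLimit_div_of_spectral hτ hσ hτσ h)).congr fun z => ?_).congr_lim (by simp)
  exact mul_div_cancel₀ _ (ne_of_norm_lt_one hσ z.norm_lt_one)

/-- The Berkson-Porta factor is determined by the generator. -/
theorem eq_of_factor_mul_eq {τ : ℂ} (hτ : ‖τ‖ ≤ 1) {p q : ℂ → ℂ}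
    (hp : DifferentiableOn ℂ p (ball 0 1)) (hq : DifferentiableOn ℂ q (ball 0 1))
    (h : ∀ z : 𝔻, (τ - z) * (1 - conj τ * z) * p z = (τ - z) * (1 - conj τ * z) * q z) {z : ℂ}
    (hz : ‖z‖ < 1) : p z = q z :=
  eqOn_ball_of_eqOn_diff hp.continuousOn hq.continuousOn (finite_singleton τ)
    (fun w hw hwτ => mul_left_cancel₀ (factor_ne_zero_of_mem hτ hw hwτ)
      (h (Complex.UnitDisc.mk w hw))) hz

theorem re_inv_sum_cayley_pos [NeZero n] {σ : Fin n → ℂ} (hσ : ∀ k, ‖σ k‖ = 1) {α : Fin n → ℝ}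
    (hα : ∀ k, 0 < α k) (b : ℝ) {z : ℂ} (hz : ‖z‖ < 1) :
    0 < (Complex.I * b + ∑ k, α k * ((σ k + z) / (σ k - z))).re := by
  simp only [Complex.add_re, Complex.I_mul_re, Complex.ofReal_im, neg_zero, zero_add,
    Complex.re_sum, Complex.re_ofReal_mul]
  exact Finset.sum_pos (fun k _ => mul_pos (hα k) (cayley_re_pos (hσ k) hz)) Finset.univ_nonempty

theorem mass_pos {τ σ : ℂ} (hτσ : τ ≠ σ) {l : ℝ} (hl : l < 0) : 0 < ‖τ - σ‖ ^ 2 / (2 * |l|) := by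
  have := norm_pos_iff.2 (sub_ne_zero.2 hτσ)
  have := abs_pos.2 hl.ne
  positivity

theorem spectral_of_mass {τ σ : ℂ} (hσ : ‖σ‖ = 1) (hτσ : τ ≠ σ) {q : ℂ → ℂ} {l : ℝ} (hl : l < 0)
    (h : HasAngularLimit (fun z => (σ - z) * q z) σ (2 * σ * (‖τ - σ‖ ^ 2 / (2 * |l|) : ℝ))) :
    HasSpectralValue (fun z : 𝔻 => (τ - z) * (1 - conj τ * z) * (q z)⁻¹) σ l := by
  have hσ0 := ne_zero_of_norm_eq_one hσ
  have hm : ((‖τ - σ‖ ^ 2 / (2 * |l|) : ℝ) : ℂ) ≠ 0 := by exact_mod_cast (mass_pos hτσ hl).ne'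
  refine hasSpectralValue_of_div (p := fun z => (q z)⁻¹) hσ hτσ ((((HasAngularLimit.const 1).div h
    (mul_ne_zero (mul_ne_zero two_ne_zero hσ0) hm)).congr fun z => ?_).congr_lim ?_)
  · rw [one_div, mul_inv, mul_comm, div_eq_mul_inv]
  · rw [sub_mul_one_sub_conj_mul hσ, abs_of_neg hl]
    have h1 : (l : ℂ) ≠ 0 := by exact_mod_cast hl.ne
    have h2 : (‖τ - σ‖ : ℂ) ≠ 0 := by
      exact_mod_cast (norm_pos_iff.2 (sub_ne_zero.2 hτσ)).ne'
    push_cast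
    field_simp

theorem hasAngularLimit_const_add_sum_cayley {σ : Fin n → ℂ} (hσ : ∀ k, ‖σ k‖ = 1)
    (hinj : Function.Injective σ) (α : Fin n → ℝ) (b : ℂ) (k : Fin n) :
    HasAngularLimit (fun z => (σ k - z) * (b + ∑ j, α j * ((σ j + z) / (σ j - z)))) (σ k)
      (2 * σ k * α k) := by
  have h1 : HasAngularLimit (fun z => (σ k - z) * b) (σ k) ((σ k - σ k) * b) :=
    HasAngularLimit.of_continuousAt (F := fun z => (σ k - z) * b) (by fun_prop)
  refine ((h1.add (hasAngularLimit_sum_cayley hσ hinj α k)).congr fun z => ?_).congr_lim ?_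
  · rw [mul_add]
  · rw [sub_self, zero_mul, zero_add]

/-- The functions with reciprocal a sum of Cayley kernels of full mass are extreme. -/
theorem mem_extremePoints_of_inv_eq [NeZero n] {σ : Fin n → ℂ} (hσ : ∀ k, ‖σ k‖ = 1)
    (hinj : Function.Injective σ) {τ : ℂ} (hτ : ‖τ‖ ≤ 1) (hτσ : ∀ k, τ ≠ σ k) {b : ℝ}
    {α : Fin n → ℝ} (hα : ∀ k, 0 < α k) {L : Fin n → ℝ} (hL : ∀ k, L k < 0)
    (hsum : ∑ k, |L k| = 1) {p : ℂ → ℂ} (hp : DifferentiableOn ℂ p (ball 0 1))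
    (hre : ∀ z, ‖z‖ < 1 → 0 < (p z).re)
    (hs : ∀ k, HasSpectralValue (fun z : 𝔻 => (τ - z) * (1 - conj τ * z) * p z) (σ k) (L k))
    (hq : ∀ z, ‖z‖ < 1 → (Complex.I * b + ∑ k, α k * ((σ k + z) / (σ k - z))) * p z = 1) :
    (fun z : 𝔻 => (τ - z) * (1 - conj τ * z) * p z) ∈ extremePoints ℝ (GenClass τ σ) := by
  refine mem_extremePoints_iff_left.2 ⟨mem_genClass hσ hτ hτσ hp hre hL hs hsum.le, ?_⟩
  rintro G₁ hG₁ G₂ hG₂ ⟨s, t, hs0, ht0, hst, hG⟩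
  obtain ⟨p₁, l₁, hp₁, hre₁, rfl, hs₁, hl₁, hsum₁⟩ := exists_berkson_porta_of_mem hτ hG₁
  obtain ⟨p₂, l₂, hp₂, hre₂, rfl, hs₂, hl₂, hsum₂⟩ := exists_berkson_porta_of_mem hτ hG₂
  have hG' : ∀ z : 𝔻, (s : ℂ) * ((τ - z) * (1 - conj τ * z) * p₁ z) +
      t * ((τ - z) * (1 - conj τ * z) * p₂ z) = (τ - z) * (1 - conj τ * z) * p z := fun z => by
    have := congrFun hG z
    simpa only [Pi.add_apply, Pi.smul_apply, Complex.real_smul] using this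
  have hpp : ∀ z, ‖z‖ < 1 → p z = s * p₁ z + t * p₂ z := fun z hz =>
    eq_of_factor_mul_eq hτ hp ((hp₁.const_mul _).add (hp₂.const_mul _))
      (fun w => by rw [← hG' w]; simp only [Pi.add_apply]; ring) hz
  obtain ⟨κ, hκ⟩ := eq_mul_of_add_eq hσ hinj hα hp₁ hre₁ hp₂ hre₂ hs0 ht0 hpp hq
    fun k => hasAngularLimit_zero_of_spectral hτ (hσ k) (hτσ k) (hs₁ k)
  have hLl : ∀ k, L k = s * l₁ k + t * l₂ k := fun k => by
    have h1 := (((hs₁ k).const_mul s).add ((hs₂ k).const_mul t)).congr fun z => by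
      rw [← add_div, hG']
    exact_mod_cast (hs k).unique (hσ k) h1
  have hκl : ∀ k, (l₁ k : ℂ) = κ * L k := fun k => by
    refine (hs₁ k).unique (hσ k) (((HasAngularLimit.const κ).mul (hs k)).congr fun z => ?_)
    beta_reduce
    rw [hκ z z.norm_lt_one]
    ring
  have hneg : ∀ l : Fin n → ℝ, (∀ k, l k ≤ 0) → ∑ k, |l k| = -∑ k, l k := fun l hl => by
    rw [← Finset.sum_neg_distrib]
    exact Finset.sum_congr rfl fun k _ => abs_of_nonpos (hl k)
  rw [hneg L fun k => (hL k).le] at hsum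
  rw [hneg l₁ hl₁] at hsum₁
  rw [hneg l₂ hl₂] at hsum₂
  have hS : ∑ k, L k = s * ∑ k, l₁ k + t * ∑ k, l₂ k := by
    rw [Finset.mul_sum, Finset.mul_sum, ← Finset.sum_add_distrib]
    exact Finset.sum_congr rfl fun k _ => hLl k
  -- Both sums are at least -1 and their weighted mean is -1.
  have hS1 : ∑ k, l₁ k = -1 := by nlinarith
  have hκ1 : κ = 1 := by
    have h1 : ((∑ k, l₁ k : ℝ) : ℂ) = κ * ((∑ k, L k : ℝ) : ℂ) := by
      push_cast
      rw [Finset.mul_sum]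
      exact Finset.sum_congr rfl fun k _ => hκl k
    rw [hS1, show ∑ k, L k = -1 by linarith] at h1
    push_cast at h1
    linear_combination h1
  funext z
  rw [hκ z z.norm_lt_one, hκ1, one_mul]

theorem mem_extremePoints_of_eq [NeZero n] {σ : Fin n → ℂ} (hσ : ∀ k, ‖σ k‖ = 1)
    (hinj : Function.Injective σ) {τ : ℂ} (hτ : ‖τ‖ ≤ 1) (hτσ : ∀ k, τ ≠ σ k) (b : ℝ)
    {L : Fin n → ℝ} (hL : ∀ k, L k < 0) (hsum : ∑ k, |L k| = 1) :
    (fun z : 𝔻 => (τ - (z : ℂ)) * (1 - conj τ * (z : ℂ)) * (Complex.I * b + p0 τ σ L z)⁻¹) ∈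
      extremePoints ℝ (GenClass τ σ) := by
  have hα : ∀ k, 0 < ‖τ - σ k‖ ^ 2 / (2 * |L k|) := fun k => mass_pos (hτσ k) (hL k)
  have hqre : ∀ z, ‖z‖ < 1 → 0 < (Complex.I * b + p0 τ σ L z).re := fun z hz =>
    re_inv_sum_cayley_pos hσ hα b hz
  have hq0 : ∀ z, ‖z‖ < 1 → Complex.I * b + p0 τ σ L z ≠ 0 := fun z hz h => by
    have := hqre z hz
    rw [h] at this
    exact lt_irrefl _ this
  have hqd : DifferentiableOn ℂ (fun z => Complex.I * b + p0 τ σ L z) (ball 0 1) :=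
    (differentiableOn_const _).add
      (DifferentiableOn.fun_sum fun k _ => (differentiableOn_cayley (hσ k)).const_mul _)
  refine mem_extremePoints_of_inv_eq (p := fun z => (Complex.I * b + p0 τ σ L z)⁻¹) hσ hinj hτ hτσ
    hα hL hsum (hqd.inv fun z hz => hq0 z (by simpa using hz)) (fun z hz => ?_) (fun k => ?_)
    fun z hz => mul_inv_cancel₀ (hq0 z hz)
  · rw [Complex.inv_re]
    exact div_pos (hqre z hz) (Complex.normSq_pos.2 (hq0 z hz))
  · exact spectral_of_mass (q := fun z => Complex.I * b + p0 τ σ L z) (hσ k) (hτσ k) (hL k)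
      (hasAngularLimit_const_add_sum_cayley hσ hinj _ _ k)

/-- With S = ∑|l_k| < 1, the multiple 2/(1+S) of G is still admissible as 2S ≤ 1+S, and G lies
strictly between 0 and this multiple. -/
theorem sum_abs_eq_one_of_mem_extremePoints {τ : ℂ} {σ : Fin n → ℂ} {φ : ℝ≥0 → 𝔻 → 𝔻} {G : 𝔻 → ℂ}
    (hG0 : G ≠ 0) (hext : G ∈ extremePoints ℝ (GenClass τ σ))
    (hφ : IsSemigroup φ) (hG : IsGenerator φ G) (hDW : HasDWPoint φ τ)
    (hF : ∀ k, IsSemigroupBRFP φ (σ k)) {l : Fin n → ℝ}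
    (hl : ∀ k, l k < 0 ∧ HasSpectralValue G (σ k) (l k)) (hsum : ∑ k, |l k| ≤ 1) :
    ∑ k, |l k| = 1 := by
  by_contra hne
  have hS0 : 0 ≤ ∑ k, |l k| := Finset.sum_nonneg fun k _ => abs_nonneg _
  have hS1 : ∑ k, |l k| < 1 := lt_of_le_of_ne hsum hne
  obtain ⟨S, hS⟩ : ∃ S : ℝ≥0, (S : ℝ) = ∑ k, |l k| := ⟨⟨_, hS0⟩, rfl⟩
  rw [← hS] at hS1
  have hpos : (0 : ℝ) < 1 + S := by positivity
  have hmem := smul_mem_genClass hφ hG hDW hF hl (c := 2 / (1 + S)) (by positivity) (by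
    rw [← hS]
    push_cast
    rw [div_mul_eq_mul_div, div_le_one hpos]
    linarith)
  refine hG0 ((mem_extremePoints_iff_left.1 hext).2 0 (Or.inl rfl) _ hmem
    ⟨1 - (1 + S) / 2, (1 + S) / 2, by linarith, by positivity, by ring, ?_⟩).symm
  funext z
  simp only [smul_zero, zero_add, Pi.smul_apply, Complex.real_smul]
  have : (1 + (S : ℝ) : ℂ) ≠ 0 := by exact_mod_cast hpos.ne'
  push_cast
  field_simp

/-- The nonzero extreme points have a reciprocal factor that is a sum of Cayley kernels. -/
theorem exists_eq_of_mem_extremePoints {σ : Fin n → ℂ} (hσ : ∀ k, ‖σ k‖ = 1)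
    (hinj : Function.Injective σ) {τ : ℂ} (hτ : ‖τ‖ ≤ 1) (hτσ : ∀ k, τ ≠ σ k) {G : 𝔻 → ℂ}
    (hG0 : G ≠ 0) (hext : G ∈ extremePoints ℝ (GenClass τ σ)) :
    ∃ (b : ℝ) (L : Fin n → ℝ), (∀ k, L k < 0) ∧ ∑ k, |L k| = 1 ∧
      ∀ z : 𝔻, G z = (τ - (z : ℂ)) * (1 - conj τ * (z : ℂ)) *
        (Complex.I * (b : ℂ) + p0 τ σ L (z : ℂ))⁻¹ := by
  obtain ⟨φ, hφ, hG, hDW, hF, l, hls, hsum⟩ := hext.1.resolve_left hG0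
  have hsum1 := sum_abs_eq_one_of_mem_extremePoints hG0 hext hφ hG hDW hF hls hsum
  obtain ⟨k₀⟩ : Nonempty (Fin n) := by
    by_contra h
    rw [not_nonempty_iff] at h
    simp at hsum1
  obtain ⟨p, hp, hre, hGp⟩ := exists_berkson_porta hφ hG hτ hDW
  obtain rfl : G = fun z : 𝔻 => (τ - z) * (1 - conj τ * z) * p z := funext hGp
  have hl : ∀ k, l k < 0 := fun k => (hls k).1
  have hs := fun k => (hls k).2
  -- If Re p vanished somewhere, p would be constant; the spectral value makes p tend to 0 at
  -- σ_{k₀}, so G would be 0.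
  have hre' : ∀ z, ‖z‖ < 1 → 0 < (p z).re := by
    intro w hw
    refine lt_of_le_of_ne (hre w hw) fun h => hG0 ?_
    have h1 : ∀ z, ‖z‖ < 1 → p z = p w := fun z hz =>
      eq_of_re_eq_zero hp hre hw h.symm hz
    have h2 : p w = 0 := (HasAngularLimit.const (p w)).unique (hσ k₀)
      ((hasAngularLimit_zero_of_spectral hτ (hσ k₀) (hτσ k₀) (hs k₀)).congr
        fun z => h1 z z.norm_lt_one)
    funext z
    rw [h1 z z.norm_lt_one, h2, mul_zero]
    rfl
  have hp0 : ∀ z, ‖z‖ < 1 → p z ≠ 0 := fun z hz h => by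
    have := hre' z hz
    rw [h] at this
    exact lt_irrefl _ this
  obtain ⟨c, s, hne, h1, h2, h3, h0⟩ := exists_admissible p σ fun k => |l k|
  have hM : 0 ≤ ∑ j, ‖c j‖ := Finset.sum_nonneg fun j _ => norm_nonneg _
  -- The summand 1 keeps the denominator positive when c = 0 and makes the smallness condition
  -- strict.
  set ε : ℝ := 1 / (2 * (∑ j, ‖c j‖) + 1) with hε
  have hε0 : 0 < ε := by positivity
  have hε1 : 2 * (∑ j, ‖c j‖) * |ε| < 1 := by
    rw [abs_of_pos hε0, hε, mul_one_div, div_lt_one (by positivity)]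
    linarith
  have hplus := pert_mem_genClass hσ hτ hτσ hp hre' hl hs hsum h1 h2 h3 hε1
  have hminus := pert_mem_genClass hσ hτ hτσ hp hre' hl hs hsum h1 h2 h3
    (ε := -ε) (by rwa [abs_neg])
  -- G is the midpoint of its two perturbations, so extremality forces the perturbation to vanish.
  have heq := (mem_extremePoints_iff_left.1 hext).2 _ hplus _ hminus
    ⟨1 / 2, 1 / 2, by norm_num, by norm_num, by norm_num, by
      funext z
      simp only [Pi.add_apply, Pi.smul_apply, Complex.real_smul]
      push_cast
      ring⟩
  have hpd : DifferentiableOn ℂ (fun z => pert p c z + Complex.I * s) (ball 0 1) :=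
    (differentiableOn_pert hp c).add (differentiableOn_const _)
  have hT : ∀ z, ‖z‖ < 1 → pert p c z + Complex.I * s = 0 := by
    intro z hz
    have h4 := eq_of_factor_mul_eq hτ (hp.add (hpd.const_mul (ε : ℂ))) hp
      (fun w => congrFun heq w) hz
    simp only [Pi.add_apply, add_eq_left] at h4
    exact (mul_eq_zero.1 h4).resolve_left (by exact_mod_cast hε0.ne')
  obtain ⟨b, hb⟩ := inv_eq_of_pert_eq_zero hp hp0 hσ hinj
    (fun k => mass_of_spectral hτ (hσ k) (hτσ k) (hl k) (hs k)) hne h1 h2 h0 hT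
  refine ⟨b, l, hl, hsum1, fun z => ?_⟩
  rw [p0, ← hb z z.norm_lt_one, inv_inv]

end DiscSemigroup

theorem mainTheorem9 {n : ℕ} (σ : Fin n → ℂ) (hσ : ∀ k, ‖σ k‖ = 1)
    (hσinj : Function.Injective σ) (τ : ℂ) (hτ : ‖τ‖ ≤ 1) (hτσ : ∀ k, τ ≠ σ k)
    (G : 𝔻 → ℂ) (hG : G ≠ 0) :
    G ∈ Set.extremePoints ℝ (DiscSemigroup.GenClass τ σ) ↔
      ∃ (b : ℝ) (L : Fin n → ℝ), (∀ k, L k < 0) ∧ ∑ k, |L k| = 1 ∧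
        ∀ z : 𝔻, G z = (τ - (z : ℂ)) * (1 - conj τ * (z : ℂ)) /
          (Complex.I * (b : ℂ) + DiscSemigroup.p0 τ σ L (z : ℂ)) := by
  simp only [div_eq_mul_inv]
  refine ⟨DiscSemigroup.exists_eq_of_mem_extremePoints hσ hσinj hτ hτσ hG, ?_⟩
  rintro ⟨b, L, hL, hsum, hGL⟩
  have : NeZero n := ⟨by
    rintro rfl
    simp at hsum⟩
  rw [show G = _ from funext hGL]
  exact DiscSemigroup.mem_extremePoints_of_eq hσ hσinj hτ hτσ b hL hsum
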